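/- Let $n\ge 1$, $\beta\in(0,2]$, $\alpha\in(0,n)$, $p>n/(n-\alpha)$, $q\ge 1$, and let $u_0\in L^s(\mathbb{R}^n)\cap L^\infty(\mathbb{R}^n)$ be real-valued, where $n/(n-\alpha)<s<n(p-1)/\alpha$. Consider the problem $$u_t+(-\Delta)^{\beta/2}u=I_\alpha(|u|^p)\,|u|^q\quad (x\in\mathbb{R}^n,\ t>0),\qquad u(0)=u_0, \tag{P}$$ where $$I_\alpha(f)(x)=A_\alpha\int_{\mathbb{R}^n}\frac{f(y)}{|x-y|^{n-\alpha}}\,dy,\qquad A_\alpha=\frac{\Gamma(\frac{n-\alpha}{2})}{\Gamma(\frac{\alpha}{2})\,\pi^{n/2}\,2^{\alpha}}.$$ Let $S_\beta(0)$ be the identity and, for $t>0$, let $S_\beta(t)$ be the convolution with $S_\beta(x,t)=(2\pi)^{-n}\int_{\mathbb{R}^n}e^{ix\cdot\xi-t|\xi|^\beta}\,d\xi$. For $0<T<\infty$, a mild solution of (P) on $[0,T]$ is a function $u\in C([0,T],L^s(\mathbb{R}^n))\cap L^\infty((0,T),L^\infty(\mathbb{R}^n))$ with $u(0)=u_0$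 and $$u(t)=S_\beta(t)u_0+\int_0^tS_\beta(t-\tau)\big[I_\alpha(|u(\tau)|^p)\,|u(\tau)|^q\big]\,d\tau\qquad\text{for all } t\in[0,T],$$ the integral being a Bochner integral in $L^s(\mathbb{R}^n)$. Then there is a $T=T(u_0)>0$ such that (P) has a unique mild solution $u$ on $[0,T]$. Moreover: (i) Problem (P) has a maximal mild solution: there are $T_{\max}=T_{\max}(u_0)\in(0,\infty]$ and $U:[0,T_{\max})\to L^s(\mathbb{R}^n)$ such that the restriction of $U$ to $[0,T']$ is a mild solution on $[0,T']$ for every $T'\in(0,T_{\max})$, and every mild solution on an interval $[0,T']$, $T'>0$, satisfies $T'<T_{\max}$ and coincides with $U$ on $[0,T']$ (in particular $U$ extends $u$). Furthermore, either $T_{\max}=\infty$, or $T_{\max}<\infty$ and $$\lim_{t\to T_{\max}^-}\big(\|U(t)\|_{L^\infty(\mathbb{R}^n)}+\|U(t)\|_{L^s(\mathbb{R}^n)}\big)=+\infty.$$ (ii) If $u_0\ge 0$ almost everywhere, then $u(t)\ge0$ almost everywhere for all $t\in[0,T]$, and $U(t)\ge 0$ almost everywhere for all $t\in[0,T_{\max})$.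 -/

import Mathlib

noncomputable section

namespace Hartree

open MeasureTheory Set Filter Topology

/-- The Euclidean space `ℝⁿ`. -/
abbrev Space (n : ℕ) : Type := EuclideanSpace ℝ (Fin n)

/-- The space `L^s(ℝⁿ)` of real-valued functions, for a real exponent `s`. -/
abbrev Leb (n : ℕ) (s : ℝ) : Type :=
  Lp ℝ (ENNReal.ofReal s) (volume : Measure (Space n))

/-- The fundamental solution of `∂ₜ u + (-Δ)^{β/2} u = 0` on `ℝⁿ`, at time `t > 0`:
`S_β(x, t) = (2π)^{-n} ∫ exp (i x·ξ - t |ξ|^β) dξ`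
(the integral is real, because its integrand is even in `ξ` up to complex conjugation). -/
def kernel {n : ℕ} (β t : ℝ) (x : Space n) : ℝ :=
  ((2 * Real.pi) ^ n)⁻¹ *
    (∫ ξ : Space n, Complex.exp
      (Complex.I * ((inner ℝ x ξ : ℝ) : ℂ) - ((t * ‖ξ‖ ^ β : ℝ) : ℂ))).re

/-- The semigroup `S_β(t) f`: convolution with the fundamental solution for `t ≠ 0`,
and the identity for `t = 0`. -/
def semigroup {n : ℕ} (β t : ℝ) (f : Space n → ℝ) : Space n → ℝ :=
  if t = 0 then f else fun x => ∫ y, kernel β t (x - y) * f y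

/-- The normalization constant of the Riesz potential,
`A_α = Γ((n-α)/2) / (Γ(α/2) π^{n/2} 2^α)`. -/
def rieszConst (n : ℕ) (α : ℝ) : ℝ :=
  Real.Gamma (((n : ℝ) - α) / 2) /
    (Real.Gamma (α / 2) * Real.pi ^ ((n : ℝ) / 2) * 2 ^ α)

/-- The Riesz potential `I_α(f)(x) = A_α ∫ f(y) / |x - y|^{n-α} dy`. -/
def rieszPotential {n : ℕ} (α : ℝ) (f : Space n → ℝ) (x : Space n) : ℝ :=
  rieszConst n α * ∫ y, f y / ‖x - y‖ ^ ((n : ℝ) - α)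

/-- The Hartree-type nonlinearity `I_α(|v|^p) |v|^q`. -/
def nonlinearity {n : ℕ} (α p q : ℝ) (v : Space n → ℝ) (x : Space n) : ℝ :=
  rieszPotential α (fun y => |v y| ^ p) x * |v x| ^ q

/-- `u` is a mild solution on `[0, T]`, in `C([0,T], L^s) ∩ L^∞((0,T), L^∞)`, of
`∂ₜ u + (-Δ)^{β/2} u = I_α(|u|^p) |u|^q`, `u(0) = u₀`. Only the values of `u` on `[0, T]`
matter. -/
structure IsMildSolution {n : ℕ} {s : ℝ} [Fact (1 ≤ ENNReal.ofReal s)]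
    (α β p q : ℝ) (u₀ : Leb n s) (T : ℝ) (u : ℝ → Leb n s) : Prop where
  /-- `u ∈ C([0,T], L^s)` -/
  continuousOn : ContinuousOn u (Icc 0 T)
  /-- `u ∈ L^∞((0,T), L^∞)`: almost everywhere on `(0,T)`, `u` is given by a strongly measurable,
  essentially bounded function with values in `L^∞(ℝⁿ)`. -/
  memLinfty : ∃ v : ℝ → Lp ℝ ⊤ (volume : Measure (Space n)),
    MemLp v ⊤ (volume.restrict (Ioo 0 T)) ∧
    ∀ᵐ t ∂(volume.restrict (Ioo 0 T)), (v t : Space n → ℝ) =ᵐ[volume] (u t : Space n → ℝ)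
  /-- `u(0) = u₀` -/
  initial : u 0 = u₀
  /-- `u(t) = S_β(t) u₀ + ∫₀ᵗ S_β(t-τ) [I_α(|u(τ)|^p) |u(τ)|^q] dτ` for all `t ∈ [0,T]`. The
  integrand `g` takes values in `L^s(ℝⁿ)` and is integrable in the sense of Bochner. -/
  duhamel : ∀ t ∈ Icc 0 T, ∃ (w : Leb n s) (g : ℝ → Leb n s),
    (w : Space n → ℝ) =ᵐ[volume] semigroup β t u₀ ∧
    (∀ᵐ τ ∂(volume.restrict (Ioo 0 t)),
      (g τ : Space n → ℝ) =ᵐ[volume] semigroup β (t - τ) (nonlinearity α p q (u τ))) ∧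
    IntervalIntegrable g volume 0 t ∧
    u t = w + ∫ τ in (0 : ℝ)..t, g τ

/-- `u` is the maximal mild solution and `[0, Tmax)`, with `0 < Tmax ≤ ∞`, is its interval of
existence: `u` is a mild solution on `[0, T]` for every `T < Tmax`, and every mild solution on some
`[0, T]`, `T > 0`, is a restriction of `u`, with `T < Tmax`. -/
structure IsMaximalMildSolution {n : ℕ} {s : ℝ} [Fact (1 ≤ ENNReal.ofReal s)]
    (α β p q : ℝ) (u₀ : Leb n s) (Tmax : EReal) (u : ℝ → Leb n s) : Prop where
  pos : 0 < Tmax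
  isMild : ∀ T : ℝ, 0 < T → (T : EReal) < Tmax → IsMildSolution α β p q u₀ T u
  maximal : ∀ (T : ℝ) (v : ℝ → Leb n s), 0 < T → IsMildSolution α β p q u₀ T v →
    (T : EReal) < Tmax ∧ EqOn v u (Icc 0 T)

end Hartree

end

/-!
The proof works in `L^s`, on the balls `supBall M` of functions whose `L^s` and `L^∞` norms are at
most `M`. These balls are closed and convex in `L^s`, and on each of them the nonlinearity is
Lipschitz *for the `L^s` norm alone*. Hence the local theory (contraction principle, Gronwall
uniqueness, concatenation, maximal solution) is that of a locally Lipschitz semilinear equation in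
one Banach space. It is carried out for an abstract `SemilinearProblem`, where the local existence
time depends only on the size of the initial value. A bounded sequence of values near a finite
`Tmax` would therefore allow a continuation past `Tmax`, which gives blow-up of the full limit.

Three facts feed this scheme.

* The kernel of the semigroup is a probability density. With `‖ξ‖ ^ β` written as an integral of
  `1 - exp (-r ‖ξ‖ ^ 2)` in `r` (Bernstein), `exp (-t ‖ξ‖ ^ β)` is a pointwise limit of
  characteristic functions of compound Poisson laws, up to constants. So the Gaussian
  regularizations of its Fourier transform are nonnegative
  (`isFourierNonneg_exp_neg_mul_norm_rpow`), and since it is integrable, Fourier inversion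
  identifies it with the characteristic function of its explicit density
  (`charFun_withDensity_invFourierDensity`). The semigroup law is then uniqueness of characteristic
  functions, contractivity and positivity hold because `S_β(t)` averages translations, and strong
  continuity is that of translations in `L^s`.
* The nonlinearity is Lipschitz on `supBall M` (`Exponents.norm_nonlinearityLp_sub_le`). The Riesz
  kernel is cut at radius one. The inner part is a finite measure, so it acts on `L^s`, and the
  factor `|v| ^ q` is bounded. The outer part is treated by Hölder's inequality with exponents
  `a`, `n / α`, `s`, where `1 / a = 1 - α / n - 1 / s`: the condition `s > n / (n - α)` says that
  `1 / a > 0`, which makes the outer kernel an element of `L^a`, and the condition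
  `s < n (p - 1) / α` puts `|v| ^ (p - 1)` in `L^(n / α)`.
* A mild solution is strongly measurable with values in the nonseparable space `L^∞`. It is even
  continuous there at positive times (`SemilinearProblem.Mild.eventually_sub_mem_B`), because the
  kernels depend continuously on `t > 0` in `L^1` (`tendsto_integral_abs_kernel_sub`).

Nonnegativity is immediate from the Duhamel formula, as the nonlinearity is nonnegative.
-/

noncomputable section

open MeasureTheory ProbabilityTheory Set Filter Topology FourierTransform
open scoped ENNReal NNReal RealInnerProductSpace

namespace Hartree

/-! ### Positive definite functions -/

section PositiveDefinite

variable {V : Type*} [NormedAddCommGroup V] [InnerProductSpace ℝ V] [FiniteDimensional ℝ V]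
  [MeasurableSpace V] [BorelSpace V]

/-- A real function which is the characteristic function of some finite measure. -/
def IsRealCharFun (φ : V → ℝ) : Prop :=
  ∃ μ : Measure V, IsFiniteMeasure μ ∧ ∀ ξ, charFun μ ξ = (φ ξ : ℂ)

/-- The Gaussian regularizations of `φ` have nonnegative Fourier transforms. Unlike
`IsRealCharFun`, this is visibly stable under bounded pointwise limits. -/
def IsFourierNonneg (φ : V → ℝ) : Prop :=
  ∀ δ : ℝ, 0 < δ → ∀ w : V,
    0 ≤ (𝓕 (fun ξ : V => (φ ξ : ℂ) * Complex.exp (-(δ : ℂ) * ‖ξ‖ ^ 2)) w).re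

omit [FiniteDimensional ℝ V] in
theorem isRealCharFun_one : IsRealCharFun (fun _ : V => (1 : ℝ)) :=
  ⟨Measure.dirac 0, inferInstance, fun ξ => by simp [charFun_dirac]⟩

theorem IsRealCharFun.mul {φ ψ : V → ℝ} (hφ : IsRealCharFun φ) (hψ : IsRealCharFun ψ) :
    IsRealCharFun (fun ξ => φ ξ * ψ ξ) := by
  obtain ⟨μ, hμ, h1⟩ := hφ
  obtain ⟨ν, hν, h2⟩ := hψ
  exact ⟨μ ∗ ν, inferInstance, fun ξ => by rw [charFun_conv, h1, h2]; push_cast; rfl⟩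

theorem IsRealCharFun.pow {φ : V → ℝ} (hφ : IsRealCharFun φ) (k : ℕ) :
    IsRealCharFun (fun ξ => φ ξ ^ k) := by
  induction k with
  | zero => simpa using isRealCharFun_one
  | succ k ih => simpa only [pow_succ] using ih.mul hφ

theorem IsRealCharFun.add {φ ψ : V → ℝ} (hφ : IsRealCharFun φ) (hψ : IsRealCharFun ψ) :
    IsRealCharFun (fun ξ => φ ξ + ψ ξ) := by
  obtain ⟨μ, hμ, h1⟩ := hφ
  obtain ⟨ν, hν, h2⟩ := hψ
  refine ⟨μ + ν, inferInstance, fun ξ => ?_⟩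
  have hi : ∀ (ρ : Measure V) [IsFiniteMeasure ρ],
      Integrable (fun x : V => Complex.exp (inner ℝ x ξ * Complex.I)) ρ := fun ρ _ =>
    Integrable.of_bound (by fun_prop) 1 (ae_of_all _ fun x => by
      rw [Complex.norm_exp_ofReal_mul_I])
  rw [Complex.ofReal_add, ← h1, ← h2]
  simp only [charFun_apply]
  exact integral_add_measure (hi μ) (hi ν)

omit [FiniteDimensional ℝ V] [BorelSpace V] in
theorem IsRealCharFun.const_mul {φ : V → ℝ} (hφ : IsRealCharFun φ) {c : ℝ} (hc : 0 ≤ c) :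
    IsRealCharFun (fun ξ => c * φ ξ) := by
  obtain ⟨μ, hμ, h1⟩ := hφ
  refine ⟨c.toNNReal • μ, inferInstance, fun ξ => ?_⟩
  rw [charFun_apply, integral_smul_nnreal_measure, ← charFun_apply, h1, NNReal.smul_def,
    Real.coe_toNNReal _ hc, Complex.real_smul]
  push_cast; rfl

theorem IsRealCharFun.sum {φ : ℕ → V → ℝ} (hφ : ∀ k, IsRealCharFun (φ k)) (N : ℕ) :
    IsRealCharFun (fun ξ => ∑ k ∈ Finset.range N, φ k ξ) := by
  induction N with
  | zero => simpa using (isRealCharFun_one (V := V)).const_mul le_rfl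
  | succ N ih => simpa only [Finset.sum_range_succ] using ih.add (hφ N)

theorem IsRealCharFun.measurable {φ : V → ℝ} (hφ : IsRealCharFun φ) : Measurable φ := by
  obtain ⟨μ, hμ, h1⟩ := hφ
  have h : φ = fun ξ => (charFun μ ξ).re := by ext ξ; simp [h1]
  rw [h]
  exact Complex.measurable_re.comp measurable_charFun

/-- Integrating `exp (-r ‖ξ‖²)` against a finite measure in `r ≥ 0` gives the characteristic
function of a mixture of centred Gaussian laws. -/
theorem isRealCharFun_integral_exp_neg_mul_sq (ρ : Measure ℝ) [IsFiniteMeasure ρ]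
    (hρ : ∀ᵐ r ∂ρ, 0 ≤ r) :
    IsRealCharFun (fun ξ : V => ∫ r, Real.exp (-r * ‖ξ‖ ^ 2) ∂ρ) := by
  have hm : Measurable (fun z : ℝ × V => Real.sqrt (2 * z.1) • z.2) := by fun_prop
  refine ⟨(ρ.prod (stdGaussian V)).map (fun z => Real.sqrt (2 * z.1) • z.2), inferInstance,
    fun ξ => ?_⟩
  rw [charFun_apply, integral_map hm.aemeasurable (by fun_prop), integral_prod]
  · rw [← integral_complex_ofReal]
    refine integral_congr_ae ?_
    filter_upwards [hρ] with r hr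
    have h := charFun_stdGaussian (E := V) (Real.sqrt (2 * r) • ξ)
    simp only [charFun_apply, inner_smul_right] at h
    simp only [inner_smul_left]
    simp only [RCLike.conj_to_real]
    rw [h, norm_smul, Real.norm_of_nonneg (Real.sqrt_nonneg _), Complex.ofReal_exp]
    congr 1
    rw [← Complex.ofReal_pow, mul_pow, Real.sq_sqrt (by positivity)]
    push_cast
    ring
  · refine Integrable.of_bound (by fun_prop) 1 (ae_of_all _ fun x => by
      rw [Complex.norm_exp_ofReal_mul_I])

theorem integrable_exp_neg_mul_sq_norm {δ : ℝ} (hδ : 0 < δ) :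
    Integrable (fun ξ : V => Complex.exp (-(δ : ℂ) * ‖ξ‖ ^ 2)) := by
  simpa using GaussianFourier.integrable_cexp_neg_mul_sq_norm_add (V := V) (b := (δ : ℂ))
    (by simpa using hδ) 0 0

/-- The Fourier transform of a Gaussian is a positive Gaussian. -/
theorem fourier_exp_neg_mul_sq_norm {δ : ℝ} (hδ : 0 < δ) (w : V) :
    𝓕 (fun ξ : V => Complex.exp (-(δ : ℂ) * ‖ξ‖ ^ 2)) w =
      (((Real.pi / δ) ^ (Module.finrank ℝ V / 2 : ℝ) *
        Real.exp (-(Real.pi ^ 2 / δ) * ‖w‖ ^ 2) : ℝ) : ℂ) := by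
  rw [fourier_gaussian_innerProductSpace (by simpa using hδ)]
  push_cast
  rw [Complex.ofReal_cpow (by positivity)]
  push_cast
  congr 2
  ring

/-- By Fubini, the transform is an average of translates of the positive Gaussian. -/
theorem IsRealCharFun.isFourierNonneg {φ : V → ℝ} (hφ : IsRealCharFun φ) :
    IsFourierNonneg φ := by
  obtain ⟨μ, hμ, h1⟩ := hφ
  intro δ hδ w
  have hg := integrable_exp_neg_mul_sq_norm (V := V) hδ
  have key : 𝓕 (fun ξ : V => (φ ξ : ℂ) * Complex.exp (-(δ : ℂ) * ‖ξ‖ ^ 2)) w =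
      ∫ y, 𝓕 (fun ξ : V => Complex.exp (-(δ : ℂ) * ‖ξ‖ ^ 2)) (w - (2 * Real.pi)⁻¹ • y) ∂μ := by
    simp only [Real.fourier_eq', ← h1, charFun_apply, smul_eq_mul]
    have : ∀ v : V, Complex.exp (((-2 * Real.pi * inner ℝ v w : ℝ) : ℂ) * Complex.I) *
        ((∫ x, Complex.exp ((inner ℝ x v : ℝ) * Complex.I) ∂μ) *
          Complex.exp (-(δ : ℂ) * ‖v‖ ^ 2)) =
        ∫ x, Complex.exp ((inner ℝ x v : ℝ) * Complex.I) *
          (Complex.exp (((-2 * Real.pi * inner ℝ v w : ℝ) : ℂ) * Complex.I) *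
            Complex.exp (-(δ : ℂ) * ‖v‖ ^ 2)) ∂μ := by
      intro v
      rw [integral_mul_const]; ring
    simp only [this]
    rw [integral_integral_swap]
    · refine integral_congr_ae (ae_of_all _ fun y => integral_congr_ae (ae_of_all _ fun v => ?_))
      simp only
      rw [← mul_assoc, ← Complex.exp_add]
      congr 2
      rw [inner_sub_right, inner_smul_right, real_inner_comm y v]
      push_cast
      field_simp
      ring
    · have hi : Integrable (fun z : V × V => Complex.exp (-(δ : ℂ) * ‖z.1‖ ^ 2))
          (volume.prod μ) := hg.comp_fst μ
      refine hi.mono (by fun_prop) (ae_of_all _ fun z => ?_)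
      simp only [Function.uncurry, norm_mul, Complex.norm_exp_ofReal_mul_I, one_mul, le_refl]
  rw [key]
  simp only [fourier_exp_neg_mul_sq_norm hδ]
  rw [integral_complex_ofReal, Complex.ofReal_re]
  exact integral_nonneg fun y => by positivity

theorem IsFourierNonneg.of_tendsto {φ : V → ℝ} {ψ : ℕ → V → ℝ} (hψ : ∀ k, IsFourierNonneg (ψ k))
    (hm : ∀ k, Measurable (ψ k)) {C : ℝ} (hb : ∀ k ξ, |ψ k ξ| ≤ C)
    (hlim : ∀ ξ, Tendsto (fun k => ψ k ξ) atTop (𝓝 (φ ξ))) : IsFourierNonneg φ := by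
  intro δ hδ w
  have hg := integrable_exp_neg_mul_sq_norm (V := V) hδ
  have h : Tendsto
      (fun k => 𝓕 (fun ξ : V => (ψ k ξ : ℂ) * Complex.exp (-(δ : ℂ) * ‖ξ‖ ^ 2)) w) atTop
      (𝓝 (𝓕 (fun ξ : V => (φ ξ : ℂ) * Complex.exp (-(δ : ℂ) * ‖ξ‖ ^ 2)) w)) := by
    simp only [Real.fourier_eq', smul_eq_mul]
    refine tendsto_integral_of_dominated_convergence
      (fun ξ => C * ‖Complex.exp (-(δ : ℂ) * ‖ξ‖ ^ 2)‖) (fun k => ?_) (hg.norm.const_mul C)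
      (fun k => ae_of_all _ fun ξ => ?_) (ae_of_all _ fun ξ => ?_)
    · have := hm k
      exact Measurable.aestronglyMeasurable (by fun_prop)
    · rw [norm_mul, Complex.norm_exp_ofReal_mul_I, one_mul, norm_mul, Complex.norm_real]
      gcongr
      exact hb k ξ
    · exact ((Complex.continuous_ofReal.tendsto _).comp (hlim ξ)).mul_const _ |>.const_mul _
  exact ge_of_tendsto' ((Complex.continuous_re.tendsto _).comp h) fun k => hψ k δ hδ w

theorem IsFourierNonneg.const_mul {φ : V → ℝ} (hφ : IsFourierNonneg φ) {c : ℝ} (hc : 0 ≤ c) :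
    IsFourierNonneg (fun ξ => c * φ ξ) := by
  intro δ hδ w
  have : 𝓕 (fun ξ : V => ((c * φ ξ : ℝ) : ℂ) * Complex.exp (-(δ : ℂ) * ‖ξ‖ ^ 2)) w =
      c * 𝓕 (fun ξ : V => (φ ξ : ℂ) * Complex.exp (-(δ : ℂ) * ‖ξ‖ ^ 2)) w := by
    simp only [Real.fourier_eq', smul_eq_mul]
    rw [← integral_const_mul]
    congr 1; ext v; push_cast; ring
  rw [this, Complex.re_ofReal_mul]
  exact mul_nonneg hc (hφ δ hδ w)

/-- The exponential of a characteristic function is a limit of sums of powers (this is the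
characteristic function of a compound Poisson law, up to a factor). -/
theorem IsRealCharFun.isFourierNonneg_exp {φ : V → ℝ} (hφ : IsRealCharFun φ) {C : ℝ}
    (hC : ∀ ξ, |φ ξ| ≤ C) : IsFourierNonneg (fun ξ => Real.exp (φ ξ)) := by
  have hs : ∀ x : ℝ, HasSum (fun k : ℕ => (k.factorial : ℝ)⁻¹ * x ^ k) (Real.exp x) := fun x => by
    have := NormedSpace.expSeries_div_hasSum_exp (𝔸 := ℝ) x
    rw [← Real.exp_eq_exp_ℝ] at this
    simpa only [div_eq_inv_mul] using this
  have hc : ∀ N, IsRealCharFun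
      (fun ξ => ∑ k ∈ Finset.range N, (k.factorial : ℝ)⁻¹ * φ ξ ^ k) :=
    IsRealCharFun.sum fun k => (hφ.pow k).const_mul (by positivity)
  refine IsFourierNonneg.of_tendsto (fun N => (hc N).isFourierNonneg)
    (fun N => (hc N).measurable) (C := Real.exp C) (fun N ξ => ?_)
    (fun ξ => (hs (φ ξ)).tendsto_sum_nat)
  calc |∑ k ∈ Finset.range N, (k.factorial : ℝ)⁻¹ * φ ξ ^ k|
      ≤ ∑ k ∈ Finset.range N, |(k.factorial : ℝ)⁻¹ * φ ξ ^ k| := Finset.abs_sum_le_sum_abs _ _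
    _ ≤ ∑ k ∈ Finset.range N, (k.factorial : ℝ)⁻¹ * C ^ k := by
        refine Finset.sum_le_sum fun k _ => ?_
        rw [abs_mul, abs_pow, abs_of_nonneg (by positivity : (0 : ℝ) ≤ (k.factorial : ℝ)⁻¹)]
        gcongr
        exact hC ξ
    _ ≤ Real.exp C := sum_le_hasSum _ (fun k _ => by
        have : 0 ≤ C := (abs_nonneg _).trans (hC 0)
        positivity) (hs C)

end PositiveDefinite

/-! ### Subordination: `exp (-t ‖ξ‖ ^ β)` is positive definite for `β ≤ 2` -/

theorem integrableOn_one_sub_exp_mul_rpow {γ : ℝ} (h0 : 0 < γ) (h1 : γ < 1) {a : ℝ} (ha : 0 ≤ a) :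
    IntegrableOn (fun r : ℝ => (1 - Real.exp (-r * a)) * r ^ (-1 - γ)) (Ioi 0) := by
  have hm : Measurable (fun r : ℝ => (1 - Real.exp (-r * a)) * r ^ (-1 - γ)) := by fun_prop
  rw [← Ioc_union_Ioi_eq_Ioi (zero_le_one (α := ℝ))]
  refine IntegrableOn.union ?_ ?_
  · have hi : IntegrableOn (fun r : ℝ => a * r ^ (-γ)) (Ioc 0 1) := by
      have := (intervalIntegral.intervalIntegrable_rpow' (a := 0) (b := 1) (r := -γ)
        (by linarith)).const_mul a
      rwa [intervalIntegrable_iff_integrableOn_Ioc_of_le zero_le_one] at this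
    refine hi.mono' hm.aestronglyMeasurable
      ((ae_restrict_iff' measurableSet_Ioc).2 (ae_of_all _ fun r hr => ?_))
    have hr0 : 0 < r := hr.1
    have h2 : 0 ≤ 1 - Real.exp (-r * a) := by
      have : Real.exp (-r * a) ≤ 1 := Real.exp_le_one_iff.2 (by nlinarith)
      linarith
    have h3 : 1 - Real.exp (-r * a) ≤ r * a := by
      have := Real.add_one_le_exp (-r * a)
      linarith
    rw [Real.norm_of_nonneg (by positivity)]
    calc (1 - Real.exp (-r * a)) * r ^ (-1 - γ) ≤ (r * a) * r ^ (-1 - γ) := by gcongr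
      _ = a * r ^ (-γ) := by
        rw [show -γ = 1 + (-1 - γ) by ring, Real.rpow_add hr0, Real.rpow_one]
        ring_nf
  · have hi := integrableOn_Ioi_rpow_of_lt (a := -1 - γ) (by linarith) (zero_lt_one (α := ℝ))
    refine hi.mono' hm.aestronglyMeasurable
      ((ae_restrict_iff' measurableSet_Ioi).2 (ae_of_all _ fun r hr => ?_))
    have hr0 : 0 < r := zero_lt_one.trans hr
    have h2 : 0 ≤ 1 - Real.exp (-r * a) := by
      have : Real.exp (-r * a) ≤ 1 := Real.exp_le_one_iff.2 (by nlinarith)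
      linarith
    rw [Real.norm_of_nonneg (by positivity)]
    have h3 : 1 - Real.exp (-r * a) ≤ 1 := by linarith [Real.exp_pos (-r * a)]
    exact mul_le_of_le_one_left (by positivity) h3

/-- The Bernstein representation of a fractional power, `a ^ γ = c⁻¹ ∫₀^∞ (1 - e^{-ra}) r^{-1-γ} dr`
with `c` the value of the integral at `a = 1`. -/
theorem integral_one_sub_exp_mul_rpow {γ : ℝ} (h0 : 0 < γ) {a : ℝ} (ha : 0 ≤ a) :
    ∫ r in Ioi (0 : ℝ), (1 - Real.exp (-r * a)) * r ^ (-1 - γ) =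
      a ^ γ * ∫ r in Ioi (0 : ℝ), (1 - Real.exp (-r)) * r ^ (-1 - γ) := by
  rcases ha.eq_or_lt with rfl | ha
  · simp [h0.ne']
  have h := integral_comp_mul_left_Ioi
    (fun r : ℝ => (1 - Real.exp (-r)) * r ^ (-1 - γ)) 0 ha
  rw [mul_zero, smul_eq_mul, inv_mul_eq_div, eq_div_iff ha.ne'] at h
  rw [← h, ← integral_mul_const, ← integral_const_mul]
  refine setIntegral_congr_fun measurableSet_Ioi fun r hr => ?_
  have hr0 : (0 : ℝ) < r := hr
  rw [Real.mul_rpow ha.le hr0.le, show a ^ (-1 - γ) = (a ^ γ)⁻¹ * a⁻¹ by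
    rw [show -1 - γ = -γ + -1 by ring, Real.rpow_add ha, Real.rpow_neg ha.le, Real.rpow_neg_one]]
  have : a ^ γ ≠ 0 := (Real.rpow_pos_of_pos ha _).ne'
  rw [show -r * a = -(a * r) by ring]
  field_simp

theorem integral_one_sub_exp_neg_mul_rpow_pos {γ : ℝ} (h0 : 0 < γ) (h1 : γ < 1) :
    0 < ∫ r in Ioi (0 : ℝ), (1 - Real.exp (-r)) * r ^ (-1 - γ) := by
  have hpos : ∀ r ∈ Ioi (0 : ℝ), 0 < (1 - Real.exp (-r)) * r ^ (-1 - γ) := fun r hr => by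
    have hr0 : (0 : ℝ) < r := hr
    have : Real.exp (-r) < 1 := by simpa using hr0
    exact mul_pos (by linarith) (by positivity)
  have hi : IntegrableOn (fun r : ℝ => (1 - Real.exp (-r)) * r ^ (-1 - γ)) (Ioi 0) := by
    simpa using integrableOn_one_sub_exp_mul_rpow h0 h1 zero_le_one
  rw [setIntegral_pos_iff_support_of_nonneg_ae
    ((ae_restrict_iff' measurableSet_Ioi).2 (ae_of_all _ fun r hr => (hpos r hr).le)) hi]
  have : Function.support (fun r : ℝ => (1 - Real.exp (-r)) * r ^ (-1 - γ)) ∩ Ioi 0 = Ioi 0 :=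
    inter_eq_right.2 fun r hr => (hpos r hr).ne'
  rw [this]
  simp

section

variable {V : Type*} [NormedAddCommGroup V] [InnerProductSpace ℝ V] [FiniteDimensional ℝ V]
  [MeasurableSpace V] [BorelSpace V]

/-- Truncating the Bernstein representation of `‖ξ‖ ^ β = (‖ξ‖ ^ 2) ^ (β / 2)` at small `r` leaves
the exponential of (a constant minus) a mixture of Gaussian characteristic functions. -/
theorem isFourierNonneg_exp_neg_mul_norm_rpow {β t : ℝ} (hβ : 0 < β ∧ β ≤ 2) (ht : 0 ≤ t) :
    IsFourierNonneg (fun ξ : V => Real.exp (-(t * ‖ξ‖ ^ β))) := by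
  rcases hβ.2.eq_or_lt with rfl | hβ2
  · have h := (isRealCharFun_integral_exp_neg_mul_sq (V := V) (Measure.dirac t)
      (by simpa [ae_dirac_eq] using ht)).isFourierNonneg
    simpa using h
  set γ := β / 2 with hγ
  have h0 : 0 < γ := by rw [hγ]; linarith [hβ.1]
  have h1 : γ < 1 := by rw [hγ]; linarith
  set c := ∫ r in Ioi (0 : ℝ), (1 - Real.exp (-r)) * r ^ (-1 - γ) with hc
  have hc0 : 0 < c := integral_one_sub_exp_neg_mul_rpow_pos h0 h1
  set ε : ℕ → ℝ := fun k => 1 / ((k : ℝ) + 1) with hε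
  have hε0 : ∀ k, 0 < ε k := fun k => by rw [hε]; positivity
  have hU : ⋃ k, Ioi (ε k) = Ioi (0 : ℝ) := by
    ext r
    simp only [mem_iUnion, mem_Ioi]
    exact ⟨fun ⟨k, hk⟩ => (hε0 k).trans hk, fun hr => exists_nat_one_div_lt hr⟩
  have hmono : Monotone fun k => Ioi (ε k) := fun i j hij => Ioi_subset_Ioi
    (one_div_le_one_div_of_le (by positivity) (by simpa using hij))
  -- `ψ k` is the exponential with the Bernstein integral truncated to `r > ε k`
  set ψ : ℕ → V → ℝ := fun k ξ =>
    Real.exp (-(t / c * ∫ r in Ioi (ε k), (1 - Real.exp (-r * ‖ξ‖ ^ 2)) * r ^ (-1 - γ))) with hψ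
  have hpow : ∀ k, IntegrableOn (fun r : ℝ => r ^ (-1 - γ)) (Ioi (ε k)) := fun k =>
    integrableOn_Ioi_rpow_of_lt (by linarith) (hε0 k)
  set ρ : ℕ → Measure ℝ := fun k =>
    (volume.restrict (Ioi (ε k))).withDensity (fun r => ENNReal.ofReal (r ^ (-1 - γ))) with hρ
  have hρfin : ∀ k, IsFiniteMeasure (ρ k) := fun k =>
    isFiniteMeasure_withDensity_ofReal (hpow k).2
  have hρint : ∀ k (ξ : V), ∫ r, Real.exp (-r * ‖ξ‖ ^ 2) ∂(ρ k) =
      ∫ r in Ioi (ε k), Real.exp (-r * ‖ξ‖ ^ 2) * r ^ (-1 - γ) := fun k ξ => by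
    rw [hρ, integral_withDensity_eq_integral_toReal_smul (by fun_prop)
      (ae_of_all _ fun _ => ENNReal.ofReal_lt_top)]
    refine setIntegral_congr_fun measurableSet_Ioi fun r hr => ?_
    have hr0 : 0 < r := (hε0 k).trans hr
    simp only [smul_eq_mul]
    rw [ENNReal.toReal_ofReal (by positivity), mul_comm]
  have hcf : ∀ k, IsRealCharFun (fun ξ : V => t / c * ∫ r, Real.exp (-r * ‖ξ‖ ^ 2) ∂(ρ k)) :=
    fun k => (isRealCharFun_integral_exp_neg_mul_sq (ρ k) (by
      refine (withDensity_absolutelyContinuous _ _).ae_le ?_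
      exact (ae_restrict_iff' measurableSet_Ioi).2 (ae_of_all _ fun r hr =>
        ((hε0 k).trans hr).le))).const_mul (by positivity)
  have hψeq : ∀ k, ψ k = fun ξ => Real.exp (-(t / c * ∫ r in Ioi (ε k), r ^ (-1 - γ))) *
      Real.exp (t / c * ∫ r, Real.exp (-r * ‖ξ‖ ^ 2) ∂(ρ k)) := fun k => by
    ext ξ
    rw [← Real.exp_add, hρint]
    simp only [hψ, sub_mul, one_mul]
    rw [integral_sub (hpow k)]
    · congr 1; ring
    · refine (hpow k).mono' (Measurable.aestronglyMeasurable (by fun_prop))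
        ((ae_restrict_iff' measurableSet_Ioi).2 (ae_of_all _ fun r hr => ?_))
      have hr0 : 0 < r := (hε0 k).trans hr
      rw [Real.norm_of_nonneg (by positivity)]
      refine mul_le_of_le_one_left (by positivity) (Real.exp_le_one_iff.2 ?_)
      have : 0 ≤ r * ‖ξ‖ ^ 2 := by positivity
      linarith
  refine IsFourierNonneg.of_tendsto (ψ := ψ) (fun k => ?_) (fun k => ?_) (C := 1)
    (fun k ξ => ?_) (fun ξ => ?_)
  · rw [hψeq]
    obtain ⟨μ, hμ, hμ1⟩ := hcf k
    refine ((hcf k).isFourierNonneg_exp (C := μ.real univ) fun ξ => ?_).const_mul (by positivity)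
    have := norm_charFun_le (μ := μ) ξ
    rwa [hμ1, Complex.norm_real] at this
  · rw [hψeq]
    exact ((hcf k).measurable.exp).const_mul _
  · rw [abs_of_nonneg (by positivity)]
    refine Real.exp_le_one_iff.2 (neg_nonpos.2 (mul_nonneg (by positivity) ?_))
    refine setIntegral_nonneg measurableSet_Ioi fun r hr => ?_
    have hr0 : 0 < r := (hε0 k).trans hr
    have : Real.exp (-r * ‖ξ‖ ^ 2) ≤ 1 := Real.exp_le_one_iff.2 (by
      have : 0 ≤ r * ‖ξ‖ ^ 2 := by positivity
      linarith)
    exact mul_nonneg (by linarith) (by positivity)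
  · have h := tendsto_setIntegral_of_monotone (μ := volume) (s := fun k => Ioi (ε k))
      (f := fun r : ℝ => (1 - Real.exp (-r * ‖ξ‖ ^ 2)) * r ^ (-1 - γ))
      (fun _ => measurableSet_Ioi) hmono
      (by rw [hU]; exact integrableOn_one_sub_exp_mul_rpow h0 h1 (by positivity))
    rw [hU, integral_one_sub_exp_mul_rpow h0 (by positivity)] at h
    have h2 := (Real.continuous_exp.tendsto _).comp ((h.const_mul (t / c)).neg)
    have he : t * ‖ξ‖ ^ β = t / c * ((‖ξ‖ ^ 2) ^ γ * c) := by
      rw [← Real.rpow_natCast ‖ξ‖ 2, ← Real.rpow_mul (norm_nonneg _), hγ]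
      field_simp
      norm_num
    rw [he]
    exact h2

end

/-! ### Densities with a given characteristic function -/

section

variable {V : Type*} [NormedAddCommGroup V] [InnerProductSpace ℝ V] [FiniteDimensional ℝ V]
  [MeasurableSpace V] [BorelSpace V]

/-- For integrable `φ` the Gaussian regularization can be removed. -/
theorem IsFourierNonneg.fourier_re_nonneg {φ : V → ℝ} (hφ : IsFourierNonneg φ)
    (hi : Integrable φ) (w : V) : 0 ≤ (𝓕 (fun ξ => (φ ξ : ℂ)) w).re := by
  have h : Tendsto (fun k : ℕ => 𝓕 (fun ξ : V =>
      (φ ξ : ℂ) * Complex.exp (-((1 / ((k : ℝ) + 1) : ℝ) : ℂ) * ‖ξ‖ ^ 2)) w) atTop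
      (𝓝 (𝓕 (fun ξ : V => (φ ξ : ℂ)) w)) := by
    simp only [Real.fourier_eq', smul_eq_mul]
    refine tendsto_integral_of_dominated_convergence (fun ξ => ‖φ ξ‖) (fun k => ?_) hi.norm
      (fun k => ae_of_all _ fun ξ => ?_) (ae_of_all _ fun ξ => ?_)
    · have := hi.aestronglyMeasurable.aemeasurable
      exact AEMeasurable.aestronglyMeasurable (by fun_prop)
    · rw [norm_mul, Complex.norm_exp_ofReal_mul_I, one_mul, norm_mul, Complex.norm_real]
      refine mul_le_of_le_one_right (norm_nonneg _) ?_
      rw [Complex.norm_exp, ← Complex.ofReal_pow, ← Complex.ofReal_neg, ← Complex.ofReal_mul,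
        Complex.ofReal_re, Real.exp_le_one_iff]
      have : 0 ≤ 1 / ((k : ℝ) + 1) * ‖ξ‖ ^ 2 := by positivity
      linarith
    · have h1 : Tendsto (fun k : ℕ => Complex.exp (-((1 / ((k : ℝ) + 1) : ℝ) : ℂ) * ‖ξ‖ ^ 2)) atTop
          (𝓝 (Complex.exp (-((0 : ℝ) : ℂ) * ‖ξ‖ ^ 2))) := by
        refine ((by fun_prop : Continuous fun x : ℝ =>
          Complex.exp (-(x : ℂ) * ‖ξ‖ ^ 2)).tendsto 0).comp tendsto_one_div_add_atTop_nhds_zero_nat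
      simp only [Complex.ofReal_zero, neg_zero, zero_mul, Complex.exp_zero] at h1
      simpa using (h1.const_mul (φ ξ : ℂ)).const_mul
        (Complex.exp (((-2 * Real.pi * inner ℝ ξ w : ℝ) : ℂ) * Complex.I))
  exact ge_of_tendsto' ((Complex.continuous_re.tendsto _).comp h) fun k =>
    hφ _ (by positivity) w

theorem fourier_eq_ofReal_re_of_even {φ : V → ℝ} (heven : ∀ ξ, φ (-ξ) = φ ξ) (w : V) :
    𝓕 (fun ξ => (φ ξ : ℂ)) w = ((𝓕 (fun ξ => (φ ξ : ℂ)) w).re : ℂ) := by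
  refine (Complex.conj_eq_iff_re.1 ?_).symm
  simp only [Real.fourier_eq', smul_eq_mul]
  rw [← integral_conj, ← integral_neg_eq_self]
  congr 1; ext ξ
  simp only [map_mul, Complex.conj_ofReal, heven, ← Complex.exp_conj, Complex.conj_I,
    inner_neg_left]
  congr 2
  push_cast; ring

/-- The Fourier transform of a bounded function, if nonnegative, is integrable: test it against
Gaussians, whose Fourier transforms have integral one. -/
theorem integrable_fourier_of_nonneg {φ : V → ℝ} (hi : Integrable φ) (hb : ∀ ξ, |φ ξ| ≤ 1)
    (heven : ∀ ξ, φ (-ξ) = φ ξ) (hpos : ∀ w, 0 ≤ (𝓕 (fun ξ => (φ ξ : ℂ)) w).re) :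
    Integrable (𝓕 (fun ξ => (φ ξ : ℂ))) := by
  have hcont : Continuous (𝓕 (fun ξ => (φ ξ : ℂ))) :=
    VectorFourier.fourierIntegral_continuous Real.continuous_fourierChar
      (by exact continuous_inner) hi.ofReal
  set g : V → ℝ := fun w => (𝓕 (fun ξ => (φ ξ : ℂ)) w).re with hg
  have hgc : Continuous g := Complex.continuous_re.comp hcont
  have hGg : 𝓕 (fun ξ => (φ ξ : ℂ)) = fun w => (g w : ℂ) :=
    funext fun w => fourier_eq_ofReal_re_of_even heven w
  rw [hGg]
  refine Integrable.ofReal ?_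
  have hgbd : ∀ w, ‖g w‖ ≤ ∫ ξ, ‖φ ξ‖ := fun w => by
    refine (Complex.abs_re_le_norm _).trans ?_
    refine (VectorFourier.norm_fourierIntegral_le_integral_norm _ _ _ _ _).trans_eq ?_
    simp
  -- the Gaussian means of `g` are at most one
  have hmean : ∀ δ : ℝ, 0 < δ → ∫⁻ w, ENNReal.ofReal (g w * Real.exp (-δ * ‖w‖ ^ 2)) ≤ 1 := by
    intro δ hδ
    have hgauss := integrable_exp_neg_mul_sq_norm (V := V) hδ
    have hgauss' : Integrable (fun w : V => Real.exp (-δ * ‖w‖ ^ 2)) := by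
      have := hgauss.re
      refine this.congr (ae_of_all _ fun w => ?_)
      have : Complex.exp (-(δ : ℂ) * ‖w‖ ^ 2) = ((Real.exp (-δ * ‖w‖ ^ 2) : ℝ) : ℂ) := by
        push_cast; rfl
      simp only [this]
      exact Complex.ofReal_re _
    have hprod : Integrable (fun w => g w * Real.exp (-δ * ‖w‖ ^ 2)) :=
      hgauss'.bdd_mul hgc.aestronglyMeasurable (ae_of_all _ hgbd)
    rw [← ofReal_integral_eq_lintegral_ofReal hprod
      (ae_of_all _ fun w => mul_nonneg (hpos w) (Real.exp_pos _).le)]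
    rw [ENNReal.ofReal_le_one]
    have hflip := VectorFourier.integral_fourierIntegral_smul_eq_flip (μ := (volume : Measure V))
      (ν := (volume : Measure V)) (L := innerₗ V) Real.continuous_fourierChar
      (by exact continuous_inner) hi.ofReal hgauss
    have hflip2 : ∫ w, 𝓕 (fun ξ => (φ ξ : ℂ)) w * Complex.exp (-(δ : ℂ) * ‖w‖ ^ 2) =
        ∫ ξ, (φ ξ : ℂ) * 𝓕 (fun w : V => Complex.exp (-(δ : ℂ) * ‖w‖ ^ 2)) ξ := by
      rw [flip_innerₗ] at hflip
      exact hflip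
    set k : V → ℝ := fun w => (Real.pi / δ) ^ (Module.finrank ℝ V / 2 : ℝ) *
        Real.exp (-(Real.pi ^ 2 / δ) * ‖w‖ ^ 2) with hk
    have hkint : ∫ w, k w = 1 := by
      rw [hk, integral_const_mul, GaussianFourier.integral_rexp_neg_mul_sq_norm (by positivity),
        ← Real.mul_rpow (by positivity) (by positivity)]
      rw [show Real.pi / δ * (Real.pi / (Real.pi ^ 2 / δ)) = 1 by
        have := Real.pi_pos
        field_simp]
      simp
    have hki : Integrable k := by
      by_contra h
      rw [integral_undef h] at hkint
      exact zero_ne_one hkint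
    have hreal : ∫ w, g w * Real.exp (-δ * ‖w‖ ^ 2) = ∫ ξ, φ ξ * k ξ := by
      have h3 : ((∫ w, g w * Real.exp (-δ * ‖w‖ ^ 2) : ℝ) : ℂ) = ((∫ ξ, φ ξ * k ξ : ℝ) : ℂ) := by
        rw [← integral_complex_ofReal, ← integral_complex_ofReal]
        rw [hGg] at hflip2
        simp only [fourier_exp_neg_mul_sq_norm hδ] at hflip2
        simp only [hk]
        push_cast
        push_cast at hflip2
        exact hflip2
      exact_mod_cast h3
    rw [hreal, ← hkint]
    have hk0 : ∀ ξ, 0 ≤ k ξ := fun ξ => by rw [hk]; positivity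
    refine integral_mono (hki.bdd_mul hi.aestronglyMeasurable (ae_of_all _ hb)) hki fun ξ => ?_
    exact mul_le_of_le_one_left (hk0 ξ) ((le_abs_self _).trans (hb ξ))
  refine ⟨hgc.aestronglyMeasurable, ?_⟩
  rw [hasFiniteIntegral_iff_ofReal (ae_of_all _ hpos)]
  have hfatou := lintegral_liminf_le (μ := (volume : Measure V)) (u := atTop)
    (f := fun (k : ℕ) w => ENNReal.ofReal (g w * Real.exp (-(1 / ((k : ℝ) + 1)) * ‖w‖ ^ 2)))
    (fun k => by have := hgc.measurable; fun_prop)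
  have hlim : ∀ w, liminf (fun k : ℕ =>
      ENNReal.ofReal (g w * Real.exp (-(1 / ((k : ℝ) + 1)) * ‖w‖ ^ 2))) atTop =
      ENNReal.ofReal (g w) := fun w => by
    refine Tendsto.liminf_eq ?_
    have : Tendsto (fun k : ℕ => g w * Real.exp (-(1 / ((k : ℝ) + 1)) * ‖w‖ ^ 2)) atTop
        (𝓝 (g w * Real.exp (-0 * ‖w‖ ^ 2))) :=
      ((by fun_prop : Continuous fun x : ℝ => g w * Real.exp (-x * ‖w‖ ^ 2)).tendsto 0).comp
        tendsto_one_div_add_atTop_nhds_zero_nat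
    simp only [neg_zero, zero_mul, Real.exp_zero, mul_one] at this
    exact (ENNReal.continuous_ofReal.tendsto _).comp this
  simp only [hlim] at hfatou
  refine lt_of_le_of_lt (hfatou.trans ?_) ENNReal.one_lt_top
  refine liminf_le_of_le (by isBoundedDefault) fun b hb => ?_
  obtain ⟨k, hk⟩ := hb.exists
  exact hk.trans (hmean _ (by positivity))

/-- The inverse Fourier transform, with the normalization of the kernel of the semigroup. -/
def invFourierDensity (φ : V → ℝ) (x : V) : ℝ :=
  ((2 * Real.pi) ^ Module.finrank ℝ V)⁻¹ *
    (∫ ξ : V, Complex.exp (Complex.I * ((inner ℝ x ξ : ℝ) : ℂ)) * (φ ξ : ℂ)).re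

theorem invFourierDensity_eq_fourier {φ : V → ℝ} (heven : ∀ ξ, φ (-ξ) = φ ξ) (x : V) :
    invFourierDensity φ x = ((2 * Real.pi) ^ Module.finrank ℝ V)⁻¹ *
      (𝓕 (fun ξ => (φ ξ : ℂ)) ((2 * Real.pi)⁻¹ • x)).re := by
  rw [invFourierDensity, Real.fourier_eq', ← integral_neg_eq_self]
  congr 3; ext ξ
  rw [heven, smul_eq_mul, inner_neg_right, inner_smul_right, real_inner_comm]
  congr 2
  have := Real.pi_pos
  push_cast
  field_simp

theorem continuous_invFourierDensity {φ : V → ℝ} (hi : Integrable φ)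
    (heven : ∀ ξ, φ (-ξ) = φ ξ) : Continuous (invFourierDensity φ) := by
  have hcont : Continuous (𝓕 (fun ξ => (φ ξ : ℂ))) :=
    VectorFourier.fourierIntegral_continuous Real.continuous_fourierChar
      (by exact continuous_inner) hi.ofReal
  rw [funext (invFourierDensity_eq_fourier heven)]
  fun_prop

theorem IsFourierNonneg.invFourierDensity_nonneg {φ : V → ℝ} (hφ : IsFourierNonneg φ)
    (hi : Integrable φ) (heven : ∀ ξ, φ (-ξ) = φ ξ) (x : V) : 0 ≤ invFourierDensity φ x := by
  rw [invFourierDensity_eq_fourier heven]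
  exact mul_nonneg (by positivity) (hφ.fourier_re_nonneg hi _)

theorem integrable_invFourierDensity {φ : V → ℝ} (hφ : IsFourierNonneg φ) (hi : Integrable φ)
    (hb : ∀ ξ, |φ ξ| ≤ 1) (heven : ∀ ξ, φ (-ξ) = φ ξ) : Integrable (invFourierDensity φ) := by
  rw [funext (invFourierDensity_eq_fourier heven)]
  exact (((integrable_fourier_of_nonneg hi hb heven (hφ.fourier_re_nonneg hi)).re).comp_smul
    (by positivity)).const_mul _

/-- Bochner's theorem for an integrable function `φ`, with an explicit density. -/
theorem charFun_withDensity_invFourierDensity {φ : V → ℝ} (hφ : IsFourierNonneg φ)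
    (hc : Continuous φ) (hi : Integrable φ) (hb : ∀ ξ, |φ ξ| ≤ 1) (heven : ∀ ξ, φ (-ξ) = φ ξ)
    (ξ : V) :
    charFun (volume.withDensity fun x => ENNReal.ofReal (invFourierDensity φ x)) ξ = φ ξ := by
  have hinv : 𝓕⁻ (𝓕 (fun ξ => (φ ξ : ℂ))) = fun ξ => (φ ξ : ℂ) :=
    (Complex.continuous_ofReal.comp hc).fourierInv_fourier_eq hi.ofReal
      (integrable_fourier_of_nonneg hi hb heven (hφ.fourier_re_nonneg hi))
  have h1 := congrFun hinv ξ
  have hm : Measurable (invFourierDensity φ) := (continuous_invFourierDensity hi heven).measurable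
  rw [← h1, Real.fourierInv_eq', charFun_apply,
    integral_withDensity_eq_integral_toReal_smul (by fun_prop)
      (ae_of_all _ fun _ => ENNReal.ofReal_lt_top)]
  have h2 := Measure.integral_comp_inv_smul (volume : Measure V)
    (fun v : V => Complex.exp (((2 * Real.pi * inner ℝ v ξ : ℝ) : ℂ) * Complex.I) *
      𝓕 (fun ξ => (φ ξ : ℂ)) v) (2 * Real.pi)
  have hpi : (0 : ℝ) < (2 * Real.pi) ^ Module.finrank ℝ V := by positivity
  rw [abs_of_pos hpi] at h2
  simp only [smul_eq_mul]
  rw [← inv_smul_eq_iff₀ hpi.ne', ← integral_smul] at h2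
  rw [← h2]
  congr 1; ext x
  rw [ENNReal.toReal_ofReal (hφ.invFourierDensity_nonneg hi heven x),
    invFourierDensity_eq_fourier heven, fourier_eq_ofReal_re_of_even heven, Complex.real_smul,
    Complex.real_smul, inner_smul_left]
  simp only [RCLike.conj_to_real, Complex.ofReal_re]
  have : 2 * Real.pi * ((2 * Real.pi)⁻¹ * inner ℝ x ξ) = inner ℝ x ξ := by
    have := Real.pi_pos
    field_simp
  rw [this]
  push_cast
  ring

end

/-! ### The fundamental solution as a convolution semigroup of probability measures -/

theorem integrable_exp_neg_mul_norm_rpow {n : ℕ} (hn : 1 ≤ n) {β t : ℝ} (hβ : 0 < β) (ht : 0 < t) :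
    Integrable (fun ξ : Space n => Real.exp (-(t * ‖ξ‖ ^ β))) := by
  have : NeZero n := ⟨by lia⟩
  have : Nontrivial (Space n) := by
    have : Nonempty (Fin n) := ⟨0⟩
    infer_instance
  rw [integrable_fun_norm_addHaar (volume : Measure (Space n))
    (f := fun r : ℝ => Real.exp (-(t * r ^ β))), finrank_euclideanSpace_fin]
  have hq : (-1 : ℝ) < ((n - 1 : ℕ) : ℝ) := by
    have : (0 : ℝ) ≤ ((n - 1 : ℕ) : ℝ) := Nat.cast_nonneg _
    linarith
  refine (integrableOn_rpow_mul_exp_neg_mul_rpow hq hβ ht).congr (ae_of_all _ fun x => ?_)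
  simp [Real.rpow_natCast]

theorem kernel_eq_invFourierDensity {n : ℕ} (β t : ℝ) :
    kernel (n := n) β t = invFourierDensity (fun ξ => Real.exp (-(t * ‖ξ‖ ^ β))) := by
  ext x
  rw [kernel, invFourierDensity, finrank_euclideanSpace_fin]
  congr 3; ext ξ
  rw [sub_eq_add_neg, Complex.exp_add]
  push_cast; rfl

theorem abs_exp_neg_mul_norm_rpow_le_one {n : ℕ} {β t : ℝ} (ht : 0 ≤ t) (ξ : Space n) :
    |Real.exp (-(t * ‖ξ‖ ^ β))| ≤ 1 := by
  rw [abs_of_pos (Real.exp_pos _), Real.exp_le_one_iff, neg_nonpos]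
  positivity

theorem continuous_exp_neg_mul_norm_rpow {n : ℕ} {β t : ℝ} (hβ : 0 < β) :
    Continuous (fun ξ : Space n => Real.exp (-(t * ‖ξ‖ ^ β))) := by
  have : Continuous (fun ξ : Space n => ‖ξ‖ ^ β) :=
    continuous_norm.rpow_const fun _ => Or.inr hβ.le
  fun_prop

theorem kernel_nonneg {n : ℕ} (hn : 1 ≤ n) {β t : ℝ} (hβ : 0 < β ∧ β ≤ 2) (ht : 0 < t)
    (x : Space n) : 0 ≤ kernel β t x := by
  rw [kernel_eq_invFourierDensity]
  exact (isFourierNonneg_exp_neg_mul_norm_rpow hβ ht.le).invFourierDensity_nonneg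
    (integrable_exp_neg_mul_norm_rpow hn hβ.1 ht) (by simp) x

theorem continuous_kernel {n : ℕ} (hn : 1 ≤ n) {β t : ℝ} (hβ : 0 < β) (ht : 0 < t) :
    Continuous (kernel (n := n) β t) := by
  rw [kernel_eq_invFourierDensity]
  exact continuous_invFourierDensity (integrable_exp_neg_mul_norm_rpow hn hβ ht) (by simp)

/-- The probability measure with density `kernel β t`, the law of a symmetric stable vector. -/
def kernelMeasure (n : ℕ) (β t : ℝ) : Measure (Space n) :=
  volume.withDensity fun x => ENNReal.ofReal (kernel β t x)

section

variable {n : ℕ} {β : ℝ}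

theorem isFiniteMeasure_kernelMeasure (hn : 1 ≤ n) (hβ : 0 < β ∧ β ≤ 2) {t : ℝ} (ht : 0 < t) :
    IsFiniteMeasure (kernelMeasure n β t) := by
  refine isFiniteMeasure_withDensity_ofReal ?_
  rw [kernel_eq_invFourierDensity]
  exact (integrable_invFourierDensity (isFourierNonneg_exp_neg_mul_norm_rpow hβ ht.le)
    (integrable_exp_neg_mul_norm_rpow hn hβ.1 ht) (abs_exp_neg_mul_norm_rpow_le_one ht.le)
    (by simp)).2

theorem charFun_kernelMeasure (hn : 1 ≤ n) (hβ : 0 < β ∧ β ≤ 2) {t : ℝ} (ht : 0 < t)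
    (ξ : Space n) : charFun (kernelMeasure n β t) ξ = Real.exp (-(t * ‖ξ‖ ^ β)) := by
  rw [kernelMeasure, kernel_eq_invFourierDensity]
  exact charFun_withDensity_invFourierDensity (isFourierNonneg_exp_neg_mul_norm_rpow hβ ht.le)
    (continuous_exp_neg_mul_norm_rpow hβ.1) (integrable_exp_neg_mul_norm_rpow hn hβ.1 ht)
    (abs_exp_neg_mul_norm_rpow_le_one ht.le) (by simp) ξ

theorem isProbabilityMeasure_kernelMeasure (hn : 1 ≤ n) (hβ : 0 < β ∧ β ≤ 2) {t : ℝ} (ht : 0 < t) :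
    IsProbabilityMeasure (kernelMeasure n β t) := by
  have := isFiniteMeasure_kernelMeasure hn hβ ht
  have h := charFun_kernelMeasure hn hβ ht (0 : Space n)
  rw [charFun_zero, norm_zero, Real.zero_rpow hβ.1.ne'] at h
  have h1 : (kernelMeasure n β t).real univ = 1 := by
    simpa using h
  exact ⟨by rwa [measureReal_def, ENNReal.toReal_eq_one_iff] at h1⟩

/-- The convolution semigroup of stable laws, for all real times: the law at time `t` is the
rescaling by `t ^ (1 / β)` of the law at time one, and the Dirac mass at `0` for `t ≤ 0`. -/
def stableMeasure (n : ℕ) (β t : ℝ) : Measure (Space n) :=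
  (kernelMeasure n β 1).map fun x => (max t 0 ^ (1 / β)) • x

theorem isProbabilityMeasure_stableMeasure (hn : 1 ≤ n) (hβ : 0 < β ∧ β ≤ 2) (t : ℝ) :
    IsProbabilityMeasure (stableMeasure n β t) :=
  have := isProbabilityMeasure_kernelMeasure hn hβ one_pos
  Measure.isProbabilityMeasure_map (by fun_prop)

theorem charFun_stableMeasure (hn : 1 ≤ n) (hβ : 0 < β ∧ β ≤ 2) {t : ℝ} (ht : 0 ≤ t)
    (ξ : Space n) : charFun (stableMeasure n β t) ξ = Real.exp (-(t * ‖ξ‖ ^ β)) := by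
  rw [stableMeasure, charFun_map_smul, charFun_kernelMeasure hn hβ one_pos, max_eq_left ht,
    norm_smul, Real.norm_of_nonneg (by positivity), Real.mul_rpow (by positivity) (by positivity),
    ← Real.rpow_mul ht, one_div_mul_cancel hβ.1.ne', Real.rpow_one, one_mul]

theorem stableMeasure_eq_kernelMeasure (hn : 1 ≤ n) (hβ : 0 < β ∧ β ≤ 2) {t : ℝ} (ht : 0 < t) :
    stableMeasure n β t = kernelMeasure n β t := by
  have := isProbabilityMeasure_kernelMeasure hn hβ ht
  have := isProbabilityMeasure_stableMeasure hn hβ t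
  refine Measure.ext_of_charFun (funext fun ξ => ?_)
  rw [charFun_stableMeasure hn hβ ht.le, charFun_kernelMeasure hn hβ ht]

theorem stableMeasure_zero (hn : 1 ≤ n) (hβ : 0 < β ∧ β ≤ 2) :
    stableMeasure n β 0 = Measure.dirac 0 := by
  have := isProbabilityMeasure_stableMeasure hn hβ 0
  refine Measure.ext_of_charFun (funext fun ξ => ?_)
  rw [charFun_stableMeasure hn hβ le_rfl, charFun_dirac]
  simp

theorem stableMeasure_add (hn : 1 ≤ n) (hβ : 0 < β ∧ β ≤ 2) {t r : ℝ} (ht : 0 ≤ t) (hr : 0 ≤ r) :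
    stableMeasure n β (t + r) = stableMeasure n β t ∗ stableMeasure n β r := by
  have := isProbabilityMeasure_stableMeasure hn hβ t
  have := isProbabilityMeasure_stableMeasure hn hβ r
  have := isProbabilityMeasure_stableMeasure hn hβ (t + r)
  refine Measure.ext_of_charFun (funext fun ξ => ?_)
  rw [charFun_conv, charFun_stableMeasure hn hβ (add_nonneg ht hr),
    charFun_stableMeasure hn hβ ht, charFun_stableMeasure hn hβ hr, ← Complex.ofReal_mul,
    ← Real.exp_add]
  congr 2; ring

end

/-! ### Averages of translations on `L^p` -/

section

variable {V : Type*} [NormedAddCommGroup V] [InnerProductSpace ℝ V] [FiniteDimensional ℝ V]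
  [MeasurableSpace V] [BorelSpace V] {p : ℝ≥0∞} [hp : Fact (1 ≤ p)]

/-- Translation by `y` on `L^p`, `f ↦ f (· - y)`. -/
def translate (y : V) : Lp ℝ p (volume : Measure V) →ₗᵢ[ℝ] Lp ℝ p (volume : Measure V) :=
  Lp.compMeasurePreservingₗᵢ ℝ (fun x => x - y) (measurePreserving_sub_right volume y)

theorem coeFn_translate (y : V) (f : Lp ℝ p (volume : Measure V)) :
    translate y f =ᵐ[volume] fun x => f (x - y) :=
  Lp.coeFn_compMeasurePreserving f (measurePreserving_sub_right volume y)

theorem continuous_translate (hp' : p ≠ ∞) (f : Lp ℝ p (volume : Measure V)) :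
    Continuous fun y : V => translate y f := by
  let g : C(V, C(V, V)) := ContinuousMap.curry ⟨fun z : V × V => z.2 - z.1, by fun_prop⟩
  exact Continuous.compMeasurePreservingLp (f := fun _ : V => f) (g := g) continuous_const
    g.continuous (fun y => measurePreserving_sub_right volume y) hp'

theorem translate_add (y z : V) (f : Lp ℝ p (volume : Measure V)) :
    translate (y + z) f = translate y (translate z f) := by
  refine Lp.ext ?_
  have h1 := (measurePreserving_sub_right (volume : Measure V) y).quasiMeasurePreserving.ae_eq_comp
    (coeFn_translate z f)
  filter_upwards [coeFn_translate (y + z) f, coeFn_translate y (translate z f), h1]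
    with x h2 h3 h4
  rw [h2, h3]
  simp only [Function.comp_apply] at h4
  rw [h4, sub_sub]

theorem translate_zero (f : Lp ℝ p (volume : Measure V)) : translate 0 f = f := by
  refine Lp.ext ?_
  filter_upwards [coeFn_translate 0 f] with x h
  rw [h, sub_zero]

theorem integrable_translate (hp' : p ≠ ∞) (μ : Measure V) [IsFiniteMeasure μ]
    (f : Lp ℝ p (volume : Measure V)) : Integrable (fun y => translate y f) μ :=
  Integrable.of_bound (continuous_translate hp' f).aestronglyMeasurable ‖f‖
    (ae_of_all _ fun y => ((translate y).norm_map f).le)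

/-- Convolution with a finite measure, as an operator on `L^p`, `p < ∞`. -/
def avg (hp' : p ≠ ∞) (μ : Measure V) [IsFiniteMeasure μ] :
    Lp ℝ p (volume : Measure V) →L[ℝ] Lp ℝ p (volume : Measure V) :=
  LinearMap.mkContinuous
    { toFun := fun f => ∫ y, translate y f ∂μ
      map_add' := fun f g => by
        simp only [map_add]
        exact integral_add (integrable_translate hp' μ f) (integrable_translate hp' μ g)
      map_smul' := fun c f => by
        simp only [map_smul, RingHom.id_apply]
        exact integral_smul c _ }
    (μ.real univ) fun f => by
      refine (norm_integral_le_of_norm_le_const (C := ‖f‖)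
        (ae_of_all _ fun y => ((translate y).norm_map f).le)).trans_eq (mul_comm _ _)

variable (hp' : p ≠ ∞)

theorem avg_apply (μ : Measure V) [IsFiniteMeasure μ] (f : Lp ℝ p (volume : Measure V)) :
    avg hp' μ f = ∫ y, translate y f ∂μ := rfl

theorem norm_avg_apply_le (μ : Measure V) [IsFiniteMeasure μ] (f : Lp ℝ p (volume : Measure V)) :
    ‖avg hp' μ f‖ ≤ μ.real univ * ‖f‖ :=
  LinearMap.mkContinuous_norm_le _ measureReal_nonneg _ |> (avg hp' μ).le_of_opNorm_le <| f

theorem avg_dirac_zero (f : Lp ℝ p (volume : Measure V)) :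
    avg hp' (Measure.dirac 0) f = f := by
  rw [avg_apply, integral_dirac, translate_zero]

theorem avg_conv (μ ν : Measure V) [IsFiniteMeasure μ] [IsFiniteMeasure ν]
    (f : Lp ℝ p (volume : Measure V)) : avg hp' (μ ∗ ν) f = avg hp' μ (avg hp' ν f) := by
  simp only [avg_apply]
  rw [integral_conv (integrable_translate hp' _ f)]
  refine integral_congr_ae (ae_of_all _ fun y => ?_)
  simp only [translate_add]
  exact (translate y).toContinuousLinearMap.integral_comp_comm (integrable_translate hp' ν f)

theorem avg_mem {μ : Measure V} [IsProbabilityMeasure μ] {K : Set (Lp ℝ p (volume : Measure V))}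
    (hK : Convex ℝ K) (hKc : IsClosed K) (hKt : ∀ f ∈ K, ∀ y, translate y f ∈ K)
    {f : Lp ℝ p (volume : Measure V)} (hf : f ∈ K) : avg hp' μ f ∈ K :=
  hK.integral_mem hKc (ae_of_all _ fun y => hKt f hf y) (integrable_translate hp' μ f)

theorem setIntegral_norm_le (f : Lp ℝ p (volume : Measure V)) {A : Set V}
    (hA : volume A ≠ ∞) :
    ∫ x in A, ‖f x‖ ≤ (volume A ^ (1 - 1 / p.toReal)).toReal * ‖f‖ := by
  have hfA : MemLp f p (volume.restrict A) := (Lp.memLp f).restrict A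
  have h1 := eLpNorm_le_eLpNorm_mul_rpow_measure_univ (μ := volume.restrict A) hp.out
    hfA.aestronglyMeasurable
  have h2 : eLpNorm f p (volume.restrict A) ≤ eLpNorm f p volume :=
    eLpNorm_mono_measure _ Measure.restrict_le_self
  rw [integral_norm_eq_lintegral_enorm hfA.aestronglyMeasurable, ← eLpNorm_one_eq_lintegral_enorm,
    Lp.norm_def, mul_comm, ← ENNReal.toReal_mul]
  have hexp : 0 ≤ 1 - 1 / p.toReal := by
    rcases eq_or_ne p ∞ with rfl | h
    · simp
    have : 1 ≤ p.toReal := by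
      have := ENNReal.toReal_mono h hp.out
      simpa using this
    rw [sub_nonneg, div_le_one (by linarith)]
    exact this
  refine ENNReal.toReal_mono (ENNReal.mul_ne_top (Lp.memLp f).eLpNorm_ne_top
    (ENNReal.rpow_ne_top_of_nonneg hexp hA)) ?_
  refine h1.trans ?_
  simp only [Measure.restrict_apply_univ, ENNReal.toReal_one, div_one]
  gcongr

theorem integrableOn_coeFn (f : Lp ℝ p (volume : Measure V)) {A : Set V}
    (hA : volume A ≠ ∞) : IntegrableOn f A := by
  have : IsFiniteMeasure (volume.restrict A) := ⟨by simpa using hA.lt_top⟩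
  exact ((Lp.memLp f).restrict A).integrable hp.out

/-- Integration over a set of finite measure, as a continuous functional on `L^p`. -/
def setIntegralCLM (p : ℝ≥0∞) [hp : Fact (1 ≤ p)] (A : Set V) (hA : volume A ≠ ∞) :
    Lp ℝ p (volume : Measure V) →L[ℝ] ℝ :=
  LinearMap.mkContinuous
    { toFun := fun f => ∫ x in A, f x
      map_add' := fun f g => by
        rw [← integral_add (integrableOn_coeFn f hA) (integrableOn_coeFn g hA)]
        exact integral_congr_ae (ae_restrict_of_ae (Lp.coeFn_add f g))
      map_smul' := fun c f => by
        rw [RingHom.id_apply, ← integral_smul]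
        exact integral_congr_ae (ae_restrict_of_ae (Lp.coeFn_smul c f)) }
    ((volume A ^ (1 - 1 / p.toReal)).toReal) fun f =>
      (norm_integral_le_integral_norm _).trans (setIntegral_norm_le f hA)

theorem setIntegralCLM_apply (A : Set V) (hA : volume A ≠ ∞) (f : Lp ℝ p (volume : Measure V)) :
    setIntegralCLM p A hA f = ∫ x in A, f x := rfl

theorem setIntegral_translate (f : Lp ℝ p (volume : Measure V)) (A : Set V) (y : V) :
    ∫ x in A, translate y f x = ∫ x in A, f (x - y) :=
  integral_congr_ae (ae_restrict_of_ae (coeFn_translate y f))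

theorem integrable_prod_coeFn_sub (μ : Measure V) [IsFiniteMeasure μ]
    (f : Lp ℝ p (volume : Measure V)) {A : Set V} (hA : volume A ≠ ∞) :
    Integrable (fun z : V × V => f (z.2 - z.1)) (μ.prod (volume.restrict A)) := by
  have : IsFiniteMeasure (volume.restrict A) := ⟨by simpa using hA.lt_top⟩
  have hm : StronglyMeasurable (fun z : V × V => f (z.2 - z.1)) :=
    (Lp.stronglyMeasurable f).comp_measurable (by fun_prop)
  rw [integrable_prod_iff hm.aestronglyMeasurable]
  refine ⟨ae_of_all _ fun y => ?_, ?_⟩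
  · exact (integrableOn_coeFn (translate y f) hA).congr (ae_restrict_of_ae (coeFn_translate y f))
  · refine Integrable.of_bound hm.norm.integral_prod_right.aestronglyMeasurable
      ((volume A ^ (1 - 1 / p.toReal)).toReal * ‖f‖) (ae_of_all _ fun y => ?_)
    rw [Real.norm_of_nonneg (integral_nonneg fun _ => norm_nonneg _)]
    have h := setIntegral_norm_le (translate y f) hA
    rw [(translate y).norm_map] at h
    refine le_trans (le_of_eq ?_) h
    refine integral_congr_ae (ae_restrict_of_ae ?_)
    filter_upwards [coeFn_translate y f] with x hx
    rw [hx]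

/-- The operator `avg` is given by the pointwise convolution. Both sides have the same integrals
over sets of finite measure. -/
theorem coeFn_avg (μ : Measure V) [IsFiniteMeasure μ] (f : Lp ℝ p (volume : Measure V)) :
    avg hp' μ f =ᵐ[volume] fun x => ∫ y, f (x - y) ∂μ := by
  refine ae_eq_of_forall_setIntegral_eq_of_sigmaFinite
    (fun A _ hA => integrableOn_coeFn _ hA.ne) (fun A _ hA => ?_) (fun A _ hA => ?_)
  · exact (integrable_prod_coeFn_sub μ f hA.ne).integral_prod_right
  · rw [← setIntegralCLM_apply A hA.ne, avg_apply,
      ← (setIntegralCLM p A hA.ne).integral_comp_comm (integrable_translate hp' μ f)]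
    simp only [setIntegralCLM_apply, setIntegral_translate]
    exact integral_integral_swap (integrable_prod_coeFn_sub μ f hA.ne)

theorem ae_integrable_coeFn_sub (μ : Measure V) [IsFiniteMeasure μ]
    (f : Lp ℝ p (volume : Measure V)) :
    ∀ᵐ x, Integrable (fun y => f (x - y)) μ := by
  have h : ∀ k : ℕ, ∀ᵐ x ∂(volume.restrict (Metric.ball (0 : V) k)),
      Integrable (fun y => f (x - y)) μ := fun k =>
    (integrable_prod_coeFn_sub μ f (measure_ball_lt_top.ne)).prod_left_ae
  have := (ae_restrict_iUnion_iff (μ := (volume : Measure V))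
    (fun k : ℕ => Metric.ball (0 : V) k) (fun x => Integrable (fun y => f (x - y)) μ)).2 h
  rwa [Metric.iUnion_ball_nat, Measure.restrict_univ] at this

end

/-! ### The semigroup on `L^s` and its invariant sets -/

section

variable {V : Type*} [NormedAddCommGroup V] [InnerProductSpace ℝ V] [FiniteDimensional ℝ V]
  [MeasurableSpace V] [BorelSpace V] {p : ℝ≥0∞} [hp : Fact (1 ≤ p)]

/-- The functions whose `L^p` and `L^∞` norms are at most `M`. -/
def supBall (V : Type*) [NormedAddCommGroup V] [InnerProductSpace ℝ V] [FiniteDimensional ℝ V]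
    [MeasurableSpace V] [BorelSpace V] (p : ℝ≥0∞) (M : ℝ) : Set (Lp ℝ p (volume : Measure V)) :=
  {f | ‖f‖ ≤ M ∧ ∀ᵐ x, |f x| ≤ M}

theorem isClosed_ae_abs_le (M : ℝ) :
    IsClosed {f : Lp ℝ p (volume : Measure V) | ∀ᵐ x, |f x| ≤ M} := by
  refine IsSeqClosed.isClosed fun u f hu hlim => ?_
  have h1 : TendstoInMeasure volume (fun k => (u k : V → ℝ)) atTop f :=
    tendstoInMeasure_of_tendsto_Lp hlim
  obtain ⟨φ, _, hφ⟩ := h1.exists_seq_tendsto_ae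
  have h2 : ∀ᵐ x, ∀ k, |u k x| ≤ M := ae_all_iff.2 hu
  filter_upwards [hφ, h2] with x hx hb
  exact le_of_tendsto' hx.abs fun k => hb _

theorem isClosed_supBall (M : ℝ) : IsClosed (supBall V p M) :=
  (isClosed_le continuous_norm continuous_const).inter (isClosed_ae_abs_le M)

theorem add_mem_supBall {a b : ℝ} {f g : Lp ℝ p (volume : Measure V)} (hf : f ∈ supBall V p a)
    (hg : g ∈ supBall V p b) : f + g ∈ supBall V p (a + b) := by
  refine ⟨(norm_add_le f g).trans (add_le_add hf.1 hg.1), ?_⟩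
  filter_upwards [hf.2, hg.2, Lp.coeFn_add f g] with x h1 h2 h3
  rw [h3]
  exact (abs_add_le _ _).trans (add_le_add h1 h2)

theorem smul_mem_supBall {a c : ℝ} {f : Lp ℝ p (volume : Measure V)} (hc : 0 ≤ c)
    (hf : f ∈ supBall V p a) : c • f ∈ supBall V p (c * a) := by
  refine ⟨?_, ?_⟩
  · rw [norm_smul, Real.norm_of_nonneg hc]
    exact mul_le_mul_of_nonneg_left hf.1 hc
  filter_upwards [hf.2, Lp.coeFn_smul c f] with x h1 h2
  rw [h2, Pi.smul_apply, smul_eq_mul, abs_mul, abs_of_nonneg hc]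
  exact mul_le_mul_of_nonneg_left h1 hc

theorem neg_mem_supBall {a : ℝ} {f : Lp ℝ p (volume : Measure V)} (hf : f ∈ supBall V p a) :
    -f ∈ supBall V p a := by
  refine ⟨(norm_neg f).trans_le hf.1, ?_⟩
  filter_upwards [hf.2, Lp.coeFn_neg f] with x h1 h2
  rwa [h2, Pi.neg_apply, abs_neg]

theorem convex_supBall (M : ℝ) : Convex ℝ (supBall V p M) := fun f hf g hg a b ha hb hab => by
  have := add_mem_supBall (smul_mem_supBall ha hf) (smul_mem_supBall hb hg)
  rwa [← add_mul, hab, one_mul] at this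

theorem supBall_mono (V : Type*) [NormedAddCommGroup V] [InnerProductSpace ℝ V]
    [FiniteDimensional ℝ V] [MeasurableSpace V] [BorelSpace V] (p : ℝ≥0∞) :
    Monotone (supBall V p) := fun _ _ h _ hf =>
  ⟨hf.1.trans h, hf.2.mono fun _ hx => hx.trans h⟩

omit hp in
theorem convex_Ici_zero : Convex ℝ (Ici (0 : Lp ℝ p (volume : Measure V))) := by
  intro f hf g hg a b ha hb _
  rw [mem_Ici, ← Lp.coeFn_nonneg] at hf hg ⊢
  filter_upwards [hf, hg, Lp.coeFn_add (a • f) (b • g), Lp.coeFn_smul a f, Lp.coeFn_smul b g]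
    with x h1 h2 h3 h4 h5
  rw [h3, Pi.add_apply, h4, h5]
  exact add_nonneg (mul_nonneg ha h1) (mul_nonneg hb h2)

theorem translate_mem_supBall {M : ℝ} {f : Lp ℝ p (volume : Measure V)} (hf : f ∈ supBall V p M)
    (y : V) : translate y f ∈ supBall V p M := by
  refine ⟨((translate y).norm_map f).trans_le hf.1, ?_⟩
  filter_upwards [coeFn_translate y f,
    (measurePreserving_sub_right (volume : Measure V) y).quasiMeasurePreserving.ae hf.2]
    with x h1 h2
  rw [h1]
  exact h2

theorem translate_nonneg {f : Lp ℝ p (volume : Measure V)} (hf : 0 ≤ f) (y : V) :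
    0 ≤ translate y f := by
  rw [← Lp.coeFn_nonneg] at hf ⊢
  filter_upwards [coeFn_translate y f,
    (measurePreserving_sub_right (volume : Measure V) y).quasiMeasurePreserving.ae hf] with x h1 h2
  rw [h1]
  exact h2

end

section

variable {n : ℕ} {β s : ℝ} [Fact (1 ≤ ENNReal.ofReal s)]

/-- The operator `S_β(t)` on `L^s`: the average of the translations against the stable law. -/
def stableOp (hn : 1 ≤ n) (hβ : 0 < β ∧ β ≤ 2) (t : ℝ) : Leb n s →L[ℝ] Leb n s :=
  have := isProbabilityMeasure_stableMeasure hn hβ t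
  avg ENNReal.ofReal_ne_top (stableMeasure n β t)

variable (hn : 1 ≤ n) (hβ : 0 < β ∧ β ≤ 2)

theorem stableOp_zero (f : Leb n s) : stableOp hn hβ 0 f = f := by
  have := isProbabilityMeasure_stableMeasure hn hβ 0
  have h : ∀ μ : Measure (Space n), μ = Measure.dirac 0 → ∀ _ : IsFiniteMeasure μ,
      avg ENNReal.ofReal_ne_top μ f = f := by
    rintro _ rfl _
    exact avg_dirac_zero _ f
  exact h _ (stableMeasure_zero hn hβ) inferInstance

theorem stableOp_add {t r : ℝ} (ht : 0 ≤ t) (hr : 0 ≤ r) (f : Leb n s) :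
    stableOp hn hβ (t + r) f = stableOp hn hβ t (stableOp hn hβ r f) := by
  have := isProbabilityMeasure_stableMeasure hn hβ t
  have := isProbabilityMeasure_stableMeasure hn hβ r
  have := isProbabilityMeasure_stableMeasure hn hβ (t + r)
  have h : ∀ μ : Measure (Space n), μ = stableMeasure n β t ∗ stableMeasure n β r →
      ∀ _ : IsFiniteMeasure μ, avg ENNReal.ofReal_ne_top μ f =
        stableOp hn hβ t (stableOp hn hβ r f) := by
    rintro _ rfl _
    exact avg_conv _ _ _ f
  exact h _ (stableMeasure_add hn hβ ht hr) inferInstance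

theorem norm_stableOp_le (t : ℝ) (f : Leb n s) : ‖stableOp hn hβ t f‖ ≤ ‖f‖ := by
  have := isProbabilityMeasure_stableMeasure hn hβ t
  refine (norm_avg_apply_le ENNReal.ofReal_ne_top (stableMeasure n β t) f).trans_eq ?_
  rw [probReal_univ, one_mul]

theorem continuous_stableOp (f : Leb n s) : Continuous fun t => stableOp hn hβ t f := by
  have := isProbabilityMeasure_kernelMeasure hn hβ one_pos
  have hc := continuous_translate ENNReal.ofReal_ne_top f
  have h : ∀ t, stableOp hn hβ t f =
      ∫ x, translate ((max t 0 ^ (1 / β)) • x) f ∂(kernelMeasure n β 1) := fun t => by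
    have h1 : stableOp hn hβ t f = ∫ y, translate y f ∂(stableMeasure n β t) := rfl
    rw [h1, stableMeasure, integral_map (by fun_prop) hc.aestronglyMeasurable]
  rw [funext h]
  have hβ' : 0 ≤ 1 / β := one_div_nonneg.2 hβ.1.le
  have hr : Continuous fun t : ℝ => max t 0 ^ (1 / β) :=
    (continuous_id.max continuous_const).rpow_const fun _ => Or.inr hβ'
  refine continuous_of_dominated (bound := fun _ => ‖f‖) (fun t => ?_) (fun t => ?_)
    (integrable_const _) (ae_of_all _ fun x => ?_)
  · exact (hc.comp (continuous_const_smul _)).aestronglyMeasurable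
  · exact ae_of_all _ fun x => ((translate _).norm_map f).le
  · exact hc.comp (hr.smul continuous_const)

theorem stableOp_mem_supBall {M : ℝ} {f : Leb n s} (t : ℝ)
    (hf : f ∈ supBall (Space n) (ENNReal.ofReal s) M) :
    stableOp hn hβ t f ∈ supBall (Space n) (ENNReal.ofReal s) M := by
  have := isProbabilityMeasure_stableMeasure hn hβ t
  exact avg_mem ENNReal.ofReal_ne_top (convex_supBall M) (isClosed_supBall M)
    (fun f hf y => translate_mem_supBall hf y) hf

theorem stableOp_nonneg {f : Leb n s} (t : ℝ) (hf : 0 ≤ f) : 0 ≤ stableOp hn hβ t f := by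
  have := isProbabilityMeasure_stableMeasure hn hβ t
  exact avg_mem (K := Ici 0) ENNReal.ofReal_ne_top convex_Ici_zero isClosed_Ici
    (fun f hf y => translate_nonneg hf y) hf

/-- The pointwise convolution of the statement does not depend on the representative and is the
operator `stableOp`. -/
theorem semigroup_ae_eq_stableOp {t : ℝ} (ht : 0 ≤ t) {h : Space n → ℝ} {f : Leb n s}
    (hf : h =ᵐ[volume] f) : semigroup β t h =ᵐ[volume] stableOp hn hβ t f := by
  rcases ht.eq_or_lt with rfl | ht0
  · rw [stableOp_zero]
    simpa [semigroup] using hf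
  have := isProbabilityMeasure_stableMeasure hn hβ t
  have h1 : stableOp hn hβ t f =ᵐ[volume] fun x => ∫ y, f (x - y) ∂(stableMeasure n β t) :=
    coeFn_avg ENNReal.ofReal_ne_top (stableMeasure n β t) f
  filter_upwards [h1] with x hx
  rw [hx, stableMeasure_eq_kernelMeasure hn hβ ht0, kernelMeasure,
    integral_withDensity_eq_integral_toReal_smul
      ((continuous_kernel hn hβ.1 ht0).measurable.ennreal_ofReal)
      (ae_of_all _ fun _ => ENNReal.ofReal_lt_top), semigroup, if_neg ht0.ne']
  have h2 : ∫ y, kernel β t (x - y) * h y = ∫ y, kernel β t (x - y) * f y :=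
    integral_congr_ae (by filter_upwards [hf] with y hy; rw [hy])
  rw [h2, ← integral_sub_left_eq_self _ _ x]
  refine integral_congr_ae (ae_of_all _ fun y => ?_)
  simp only [smul_eq_mul, sub_sub_cancel, ENNReal.toReal_ofReal (kernel_nonneg hn hβ ht0 _)]

/-! ### Continuity of the semigroup in the uniform norm at positive times -/

theorem continuousAt_kernel (hn : 1 ≤ n) (hβ : 0 < β ∧ β ≤ 2) (x : Space n) {t₀ : ℝ}
    (ht₀ : 0 < t₀) : ContinuousAt (fun t => kernel β t x) t₀ := by
  refine continuousAt_const.mul (Complex.continuous_re.continuousAt.comp ?_)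
  refine continuousAt_of_dominated
    (bound := fun ξ => Real.exp (-(t₀ / 2 * ‖ξ‖ ^ β))) ?_ ?_
    (integrable_exp_neg_mul_norm_rpow hn hβ.1 (by positivity)) ?_
  · exact Eventually.of_forall fun t => Measurable.aestronglyMeasurable (by fun_prop)
  · filter_upwards [Ioi_mem_nhds (by linarith : t₀ / 2 < t₀)] with t ht
    refine ae_of_all _ fun ξ => ?_
    rw [Complex.norm_exp]
    have h1 : (Complex.I * ((inner ℝ x ξ : ℝ) : ℂ) - ((t * ‖ξ‖ ^ β : ℝ) : ℂ)).re =
        -(t * ‖ξ‖ ^ β) := by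
      rw [Complex.sub_re, Complex.ofReal_re, Complex.re_mul_ofReal, Complex.I_re]
      ring
    rw [h1]
    have h2 : t₀ / 2 ≤ t := (le_of_lt ht)
    gcongr
  · exact ae_of_all _ fun ξ => by fun_prop

theorem integrable_kernel (hn : 1 ≤ n) (hβ : 0 < β ∧ β ≤ 2) {t : ℝ} (ht : 0 < t) :
    Integrable (kernel (n := n) β t) := by
  rw [kernel_eq_invFourierDensity]
  exact integrable_invFourierDensity (isFourierNonneg_exp_neg_mul_norm_rpow hβ ht.le)
    (integrable_exp_neg_mul_norm_rpow hn hβ.1 ht) (abs_exp_neg_mul_norm_rpow_le_one ht.le) (by simp)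

theorem integral_kernel (hn : 1 ≤ n) (hβ : 0 < β ∧ β ≤ 2) {t : ℝ} (ht : 0 < t) :
    ∫ x : Space n, kernel β t x = 1 := by
  have := isProbabilityMeasure_kernelMeasure hn hβ ht
  have h1 : kernelMeasure n β t univ = 1 := measure_univ
  rw [kernelMeasure, withDensity_apply _ MeasurableSet.univ, Measure.restrict_univ] at h1
  rw [integral_eq_lintegral_of_nonneg_ae (ae_of_all _ fun x => kernel_nonneg hn hβ ht x)
    (continuous_kernel hn hβ.1 ht).aestronglyMeasurable, h1, ENNReal.toReal_one]

/-- Scheffé's lemma for the kernels: they depend continuously on time in `L^1`. -/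
theorem tendsto_integral_abs_kernel_sub (hn : 1 ≤ n) (hβ : 0 < β ∧ β ≤ 2) {t₀ : ℝ}
    (ht₀ : 0 < t₀) :
    Tendsto (fun t => ∫ x : Space n, |kernel β t x - kernel β t₀ x|) (𝓝 t₀) (𝓝 0) := by
  have hi₀ := integrable_kernel (n := n) hn hβ ht₀
  have hmin : Tendsto (fun t => ∫ x : Space n, min (kernel β t x) (kernel β t₀ x)) (𝓝 t₀)
      (𝓝 (∫ x : Space n, min (kernel β t₀ x) (kernel β t₀ x))) := by
    refine tendsto_integral_filter_of_dominated_convergence (fun x => kernel β t₀ x) ?_ ?_ hi₀ ?_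
    · filter_upwards [Ioi_mem_nhds ht₀] with t ht
      exact ((continuous_kernel hn hβ.1 ht).min
        (continuous_kernel hn hβ.1 ht₀)).aestronglyMeasurable
    · filter_upwards [Ioi_mem_nhds ht₀] with t ht
      refine ae_of_all _ fun x => ?_
      rw [Real.norm_of_nonneg (le_min (kernel_nonneg hn hβ ht x) (kernel_nonneg hn hβ ht₀ x))]
      exact min_le_right _ _
    · refine ae_of_all _ fun x => ?_
      exact (continuousAt_kernel hn hβ x ht₀).tendsto.min tendsto_const_nhds
  simp only [min_self, integral_kernel hn hβ ht₀] at hmin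
  have h2 : Tendsto (fun t => 2 - 2 * ∫ x : Space n, min (kernel β t x) (kernel β t₀ x)) (𝓝 t₀)
      (𝓝 (2 - 2 * 1)) := (hmin.const_mul 2).const_sub 2
  norm_num at h2
  refine h2.congr' ?_
  filter_upwards [Ioi_mem_nhds ht₀] with t ht
  have hi := integrable_kernel (n := n) hn hβ ht
  have hpt : ∀ x : Space n, |kernel β t x - kernel β t₀ x| =
      (kernel β t x + kernel β t₀ x) - 2 * min (kernel β t x) (kernel β t₀ x) := fun x => by
    rcases le_total (kernel β t x) (kernel β t₀ x) with h | h
    · rw [min_eq_left h, abs_of_nonpos (by linarith)]; ring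
    · rw [min_eq_right h, abs_of_nonneg (by linarith)]; ring
  simp only [hpt]
  have hadd : Integrable fun x : Space n => kernel β t x + kernel β t₀ x := hi.add hi₀
  have hinf : Integrable fun x : Space n => 2 * min (kernel β t x) (kernel β t₀ x) :=
    (hi.inf hi₀).const_mul 2
  rw [integral_sub hadd hinf, integral_add hi hi₀,
    integral_const_mul, integral_kernel hn hβ ht, integral_kernel hn hβ ht₀]
  norm_num

theorem stableOp_ae_eq {t : ℝ} (ht : 0 < t) (f : Leb n s) :
    stableOp hn hβ t f =ᵐ[volume] fun x => ∫ y, kernel β t y * f (x - y) := by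
  filter_upwards [semigroup_ae_eq_stableOp hn hβ ht.le (ae_eq_refl f)] with x hx
  rw [← hx, semigroup, if_neg ht.ne', ← integral_sub_left_eq_self _ _ x]
  simp only [sub_sub_cancel]

/-- At positive times the semigroup is strongly continuous on `L^∞` as well. -/
theorem eventually_stableOp_sub_mem_supBall {M : ℝ} {f : Leb n s}
    (hf : f ∈ supBall (Space n) (ENNReal.ofReal s) M) {t₀ : ℝ} (ht₀ : 0 < t₀) {ε : ℝ}
    (hε : 0 < ε) : ∀ᶠ t in 𝓝 t₀, stableOp hn hβ t f - stableOp hn hβ t₀ f ∈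
      supBall (Space n) (ENNReal.ofReal s) ε := by
  have h1 : ∀ᶠ t in 𝓝 t₀, ‖stableOp hn hβ t f - stableOp hn hβ t₀ f‖ ≤ ε := by
    have := (continuous_stableOp hn hβ f).tendsto t₀
    filter_upwards [Metric.tendsto_nhds.1 this ε hε] with t ht
    rw [← dist_eq_norm]
    exact ht.le
  have h2 : Tendsto (fun t => (∫ x : Space n, |kernel β t x - kernel β t₀ x|) * M) (𝓝 t₀)
      (𝓝 (0 * M)) := (tendsto_integral_abs_kernel_sub hn hβ ht₀).mul_const M
  rw [zero_mul] at h2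
  filter_upwards [h1, h2.eventually_le_const hε, Ioi_mem_nhds ht₀] with t h3 h4 ht
  refine ⟨h3, ?_⟩
  filter_upwards [stableOp_ae_eq hn hβ ht f, stableOp_ae_eq hn hβ ht₀ f,
    Lp.coeFn_sub (stableOp hn hβ t f) (stableOp hn hβ t₀ f)] with x h5 h6 h7
  have hbd : ∀ᵐ y, ‖f (x - y)‖ ≤ M :=
    ((volume : Measure (Space n)).measurePreserving_sub_left x).quasiMeasurePreserving.ae hf.2
  have hfm : AEStronglyMeasurable (fun y => f (x - y)) :=
    ((Lp.stronglyMeasurable f).comp_measurable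
      (measurable_const.sub measurable_id)).aestronglyMeasurable
  have hi := integrable_kernel (n := n) hn hβ ht
  have hi₀ := integrable_kernel (n := n) hn hβ ht₀
  rw [h7, Pi.sub_apply, h5, h6, ← integral_sub (hi.mul_bdd hfm hbd) (hi₀.mul_bdd hfm hbd)]
  refine le_trans ?_ h4
  rw [← integral_mul_const, ← Real.norm_eq_abs]
  refine norm_integral_le_of_norm_le ((hi.sub hi₀).abs.mul_const M) ?_
  filter_upwards [hbd] with y hy
  rw [← sub_mul, norm_mul, Real.norm_eq_abs]
  exact mul_le_mul_of_nonneg_left hy (abs_nonneg _)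

end

/-! ### The Riesz kernel near and away from its singularity -/

/-- `|a ^ r - b ^ r| ≤ r M ^ (r - 1) |a - b|` for `a, b ∈ [0, M]`, `r ≥ 1`. -/
theorem abs_rpow_sub_rpow_le {a b r M : ℝ} (ha : 0 ≤ a) (hb : 0 ≤ b) (haM : a ≤ M) (hbM : b ≤ M)
    (hr : 1 ≤ r) : |a ^ r - b ^ r| ≤ r * M ^ (r - 1) * |a - b| := by
  wlog hba : b ≤ a generalizing a b
  · rw [abs_sub_comm, abs_sub_comm a]
    exact this hb ha hbM haM (le_of_not_ge hba)
  have h1 : b ^ r ≤ a ^ r := Real.rpow_le_rpow hb hba (by linarith)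
  rw [abs_of_nonneg (sub_nonneg.2 h1), abs_of_nonneg (sub_nonneg.2 hba)]
  have h2 : a ^ r - b ^ r ≤ r * a ^ (r - 1) * (a - b) := by
    rcases ha.eq_or_lt with rfl | ha
    · have : b = 0 := le_antisymm hba hb
      simp [this]
    have h3 : -1 ≤ b / a - 1 := by
      have : 0 ≤ b / a := by positivity
      linarith
    have h4 := one_add_mul_self_le_rpow_one_add h3 hr
    rw [add_sub_cancel, Real.div_rpow hb ha.le, le_div_iff₀ (by positivity)] at h4
    have h5 : a ^ r = a ^ (r - 1) * a := by
      rw [← Real.rpow_add_one ha.ne', sub_add_cancel]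
    have h6 : (1 + r * (b / a - 1)) * a ^ r = a ^ r + r * a ^ (r - 1) * (b - a) := by
      rw [h5]; field_simp
    rw [h6] at h4
    linarith
  refine h2.trans ?_
  have : a ^ (r - 1) ≤ M ^ (r - 1) := Real.rpow_le_rpow ha haM (by linarith)
  have : 0 ≤ a - b := by linarith
  gcongr

section

variable {n : ℕ} {α : ℝ}

theorem nontrivial_space (hn : 1 ≤ n) : Nontrivial (Space n) := by
  have : NeZero n := ⟨by lia⟩
  have : Nonempty (Fin n) := ⟨0⟩
  infer_instance

/-- The Riesz kernel, without its constant, inside the unit ball. The value at `z = 0` is `0`, by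
the convention for division by zero, and agrees with that of the integrand of `rieszPotential`. -/
def rieszNear (n : ℕ) (α : ℝ) (z : Space n) : ℝ≥0∞ :=
  (Iio (1 : ℝ)).indicator (fun r => ENNReal.ofReal (1 / r ^ ((n : ℝ) - α))) ‖z‖

/-- The Riesz kernel, without its constant, outside the unit ball. -/
def rieszFar (n : ℕ) (α : ℝ) (z : Space n) : ℝ≥0∞ :=
  (Ici (1 : ℝ)).indicator (fun r => ENNReal.ofReal (1 / r ^ ((n : ℝ) - α))) ‖z‖

theorem measurable_rieszNear : Measurable (rieszNear n α) := by
  have : Measurable ((Iio (1 : ℝ)).indicator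
      (fun r => ENNReal.ofReal (1 / r ^ ((n : ℝ) - α)))) :=
    Measurable.indicator (by fun_prop) measurableSet_Iio
  exact this.comp measurable_norm

theorem measurable_rieszFar : Measurable (rieszFar n α) := by
  have : Measurable ((Ici (1 : ℝ)).indicator
      (fun r => ENNReal.ofReal (1 / r ^ ((n : ℝ) - α)))) :=
    Measurable.indicator (by fun_prop) measurableSet_Ici
  exact this.comp measurable_norm

theorem rieszNear_add_rieszFar (z : Space n) :
    rieszNear n α z + rieszFar n α z = ENNReal.ofReal (1 / ‖z‖ ^ ((n : ℝ) - α)) := by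
  rw [rieszNear, rieszFar]
  rcases lt_or_ge ‖z‖ 1 with h | h
  · rw [indicator_of_mem (show ‖z‖ ∈ Iio (1 : ℝ) from h),
      indicator_of_notMem (by simpa using h), add_zero]
  · rw [indicator_of_notMem (by simpa using h),
      indicator_of_mem (show ‖z‖ ∈ Ici (1 : ℝ) from h), zero_add]

theorem lintegral_rieszNear_lt_top (hn : 1 ≤ n) (hα : 0 < α) :
    ∫⁻ z, rieszNear n α z < ∞ := by
  have := nontrivial_space hn
  set φ : ℝ → ℝ := (Iio (1 : ℝ)).indicator (fun r => 1 / r ^ ((n : ℝ) - α)) with hφ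
  have h1 : ∀ z : Space n, rieszNear n α z = ENNReal.ofReal (φ ‖z‖) := fun z => by
    rw [rieszNear, hφ]
    by_cases h : ‖z‖ ∈ Iio (1 : ℝ)
    · rw [indicator_of_mem h, indicator_of_mem h]
    · rw [indicator_of_notMem h, indicator_of_notMem h, ENNReal.ofReal_zero]
  have h2 : Integrable (fun z : Space n => φ ‖z‖) := by
    rw [integrable_fun_norm_addHaar (volume : Measure (Space n)), finrank_euclideanSpace_fin]
    have h3 : IntegrableOn (fun r : ℝ => r ^ (α - 1)) (Ioo 0 1) := by
      have := intervalIntegral.intervalIntegrable_rpow' (a := 0) (b := 1) (r := α - 1)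
        (by linarith)
      rw [intervalIntegrable_iff_integrableOn_Ioo_of_le zero_le_one] at this
      exact this
    have h4 : IntegrableOn ((Iio (1 : ℝ)).indicator fun r : ℝ => r ^ (α - 1)) (Ioi 0) := by
      rw [IntegrableOn, integrable_indicator_iff measurableSet_Iio, IntegrableOn,
        Measure.restrict_restrict measurableSet_Iio, inter_comm, Ioi_inter_Iio]
      exact h3
    refine h4.congr_fun (fun r hr => ?_) measurableSet_Ioi
    have hr0 : (0 : ℝ) < r := hr
    simp only [hφ, smul_eq_mul]
    by_cases h : r ∈ Iio (1 : ℝ)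
    · rw [indicator_of_mem h, indicator_of_mem h, ← Real.rpow_natCast, Nat.cast_sub hn,
        one_div, ← Real.rpow_neg hr0.le, ← Real.rpow_add hr0]
      congr 1; push_cast; ring
    · rw [indicator_of_notMem h, indicator_of_notMem h, mul_zero]
  rw [lintegral_congr h1]
  exact h2.lintegral_lt_top

theorem lintegral_rieszFar_rpow_lt_top (hn : 1 ≤ n) {a : ℝ} (ha : 0 < a)
    (hna : (n : ℝ) < (n - α) * a) : ∫⁻ z, rieszFar n α z ^ a < ∞ := by
  have := nontrivial_space hn
  set φ : ℝ → ℝ := (Ici (1 : ℝ)).indicator (fun r => r ^ (-(((n : ℝ) - α) * a))) with hφ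
  have h1 : ∀ z : Space n, rieszFar n α z ^ a = ENNReal.ofReal (φ ‖z‖) := fun z => by
    rw [rieszFar, hφ]
    by_cases h : ‖z‖ ∈ Ici (1 : ℝ)
    · have h0 : (0 : ℝ) ≤ ‖z‖ := norm_nonneg _
      rw [indicator_of_mem h, indicator_of_mem h,
        ENNReal.ofReal_rpow_of_nonneg (by positivity) ha.le, one_div, Real.rpow_neg h0,
        Real.inv_rpow (by positivity), Real.rpow_mul h0]
    · rw [indicator_of_notMem h, indicator_of_notMem h, ENNReal.ofReal_zero,
        ENNReal.zero_rpow_of_pos ha]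
  have h2 : Integrable (fun z : Space n => φ ‖z‖) := by
    rw [integrable_fun_norm_addHaar (volume : Measure (Space n)), finrank_euclideanSpace_fin]
    have h3 : IntegrableOn (fun r : ℝ => r ^ ((n : ℝ) - 1 - ((n : ℝ) - α) * a)) (Ici 1) := by
      rw [integrableOn_Ici_iff_integrableOn_Ioi]
      exact integrableOn_Ioi_rpow_of_lt (by linarith) one_pos
    have h4 : IntegrableOn ((Ici (1 : ℝ)).indicator
        fun r : ℝ => r ^ ((n : ℝ) - 1 - ((n : ℝ) - α) * a)) (Ioi 0) := by
      rw [IntegrableOn, integrable_indicator_iff measurableSet_Ici, IntegrableOn,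
        Measure.restrict_restrict measurableSet_Ici,
        inter_eq_left.2 (Ici_subset_Ioi.2 zero_lt_one)]
      exact h3
    refine h4.congr_fun (fun r hr => ?_) measurableSet_Ioi
    have hr0 : (0 : ℝ) < r := hr
    simp only [hφ, smul_eq_mul]
    by_cases h : r ∈ Ici (1 : ℝ)
    · rw [indicator_of_mem h, indicator_of_mem h, ← Real.rpow_natCast, Nat.cast_sub hn,
        ← Real.rpow_add hr0]
      congr 1; push_cast; ring
    · rw [indicator_of_notMem h, indicator_of_notMem h, mul_zero]
  rw [lintegral_congr h1]
  exact h2.lintegral_lt_top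

/-- The finite measure whose density is the Riesz kernel inside the unit ball. -/
def rieszNearMeasure (n : ℕ) (α : ℝ) : Measure (Space n) := volume.withDensity (rieszNear n α)

theorem isFiniteMeasure_rieszNearMeasure (hn : 1 ≤ n) (hα : 0 < α) :
    IsFiniteMeasure (rieszNearMeasure n α) :=
  isFiniteMeasure_withDensity (lintegral_rieszNear_lt_top hn hα).ne

/-- Hölder's inequality for the part of the Riesz potential away from the singularity. The exponents
`a`, `n / α`, `s` are conjugate. -/
theorem lintegral_rieszFar_mul_le {s : ℝ} (hα : 0 < α) (hs : 0 < s)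
    (hn : (0 : ℝ) < n) (hsα : α / n + 1 / s < 1) {m d : Space n → ℝ≥0∞} {p : ℝ}
    (hm : AEMeasurable m) (hd : AEMeasurable d) (x : Space n) :
    ∫⁻ y, rieszFar n α (x - y) * (m y ^ p * d y) ≤
      (∫⁻ z, rieszFar n α z ^ (1 - α / n - 1 / s)⁻¹) ^ (1 - α / n - 1 / s) *
      ((∫⁻ y, m y ^ (p * (n / α))) ^ (α / n) * (∫⁻ y, d y ^ s) ^ (1 / s)) := by
  set θ : ℝ := 1 - α / n - 1 / s with hθ
  have hθ0 : 0 < θ := by rw [hθ]; linarith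
  have hk : Measurable fun y => rieszFar n α (x - y) :=
    measurable_rieszFar.comp (measurable_const.sub measurable_id)
  have h := ENNReal.lintegral_mul_prod_norm_pow_le (μ := (volume : Measure (Space n)))
    (s := (Finset.univ : Finset (Fin 2))) (g := fun y => rieszFar n α (x - y) ^ θ⁻¹)
    (f := ![fun y => m y ^ (p * (n / α)), fun y => d y ^ s]) (hk.pow_const _).aemeasurable
    (fun i _ => by fin_cases i <;> simp <;> fun_prop) θ (p := ![α / n, 1 / s])
    (by simp [hθ]) hθ0.le (fun i _ => by fin_cases i <;> simp <;> positivity)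
  simp only [Fin.prod_univ_two, Matrix.cons_val_zero, Matrix.cons_val_one] at h
  have hsub : ∫⁻ y, rieszFar n α (x - y) ^ θ⁻¹ = ∫⁻ z, rieszFar n α z ^ θ⁻¹ :=
    lintegral_sub_left_eq_self (fun z => rieszFar n α z ^ θ⁻¹) x
  rw [hsub] at h
  refine le_trans (le_of_eq ?_) h
  congr 1; ext y
  rw [← ENNReal.rpow_mul, inv_mul_cancel₀ hθ0.ne', ENNReal.rpow_one, ← ENNReal.rpow_mul,
    ← ENNReal.rpow_mul, mul_one_div_cancel hs.ne', ENNReal.rpow_one]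
  congr 3
  field_simp

end

/-! ### The nonlinearity on bounded sets -/

section

variable {n : ℕ} {α p q s : ℝ} [Fact (1 ≤ ENNReal.ofReal s)]

omit [Fact (1 ≤ ENNReal.ofReal s)] in
theorem lintegral_enorm_rpow_eq (hs : 0 < s) (f : Leb n s) :
    (∫⁻ x, ‖f x‖ₑ ^ s) ^ (1 / s) = ENNReal.ofReal ‖f‖ := by
  rw [Lp.norm_def, ENNReal.ofReal_toReal (Lp.memLp f).eLpNorm_ne_top,
    eLpNorm_eq_lintegral_rpow_enorm_toReal (by simpa using hs) ENNReal.ofReal_ne_top,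
    ENNReal.toReal_ofReal hs.le]

/-- Interpolation between `L^s` and `L^∞`. -/
theorem lintegral_enorm_rpow_le_of_mem_supBall (hs : 0 < s) {e M : ℝ} (he : s ≤ e) {f : Leb n s}
    (hf : f ∈ supBall (Space n) (ENNReal.ofReal s) M) :
    ∫⁻ x, ‖f x‖ₑ ^ e ≤ ENNReal.ofReal M ^ e := by
  have h1 : ∫⁻ x, ‖f x‖ₑ ^ s ≤ ENNReal.ofReal M ^ s := by
    have := ENNReal.rpow_le_rpow ((lintegral_enorm_rpow_eq hs f).le.trans
      (ENNReal.ofReal_le_ofReal hf.1)) hs.le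
    rwa [← ENNReal.rpow_mul, one_div_mul_cancel hs.ne', ENNReal.rpow_one] at this
  calc ∫⁻ x, ‖f x‖ₑ ^ e ≤ ∫⁻ x, ENNReal.ofReal M ^ (e - s) * ‖f x‖ₑ ^ s := by
        refine lintegral_mono_ae ?_
        filter_upwards [hf.2] with x hx
        have h2 : ‖f x‖ₑ ≤ ENNReal.ofReal M := by
          rw [← ofReal_norm]
          exact ENNReal.ofReal_le_ofReal hx
        calc ‖f x‖ₑ ^ e = ‖f x‖ₑ ^ (e - s) * ‖f x‖ₑ ^ s := by
              rw [← ENNReal.rpow_add_of_nonneg _ _ (by linarith) hs.le, sub_add_cancel]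
          _ ≤ _ := by
              gcongr
    _ = ENNReal.ofReal M ^ (e - s) * ∫⁻ x, ‖f x‖ₑ ^ s := by
        refine lintegral_const_mul _ ?_
        exact (Lp.stronglyMeasurable f).measurable.enorm.pow_const _
    _ ≤ ENNReal.ofReal M ^ (e - s) * ENNReal.ofReal M ^ s := by gcongr
    _ = ENNReal.ofReal M ^ e := by
        rw [← ENNReal.rpow_add_of_nonneg _ _ (by linarith) hs.le, sub_add_cancel]

theorem ae_comp_sub_rieszNearMeasure {P : Space n → Prop} (h : ∀ᵐ x, P x) (x : Space n) :
    ∀ᵐ z ∂(rieszNearMeasure n α), P (x - z) := by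
  refine (withDensity_absolutelyContinuous _ _).ae_le ?_
  exact ((volume : Measure (Space n)).measurePreserving_sub_left x).quasiMeasurePreserving.ae h

/-- The convolution of `|f|` with the Riesz kernel inside the unit ball, in `L^s`. -/
def nearPart (hn : 1 ≤ n) (hα : 0 < α) (f : Leb n s) : Leb n s :=
  have := isFiniteMeasure_rieszNearMeasure hn hα
  avg ENNReal.ofReal_ne_top (rieszNearMeasure n α) |f|

theorem norm_nearPart_le (hn : 1 ≤ n) (hα : 0 < α) (f : Leb n s) :
    ‖nearPart hn hα f‖ ≤ (rieszNearMeasure n α).real univ * ‖f‖ := by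
  have := isFiniteMeasure_rieszNearMeasure hn hα
  refine (norm_avg_apply_le ENNReal.ofReal_ne_top (rieszNearMeasure n α) |f|).trans_eq ?_
  rw [norm_abs_eq_norm]

theorem nearPart_ae (hn : 1 ≤ n) (hα : 0 < α) (f : Leb n s) :
    ∀ᵐ x, 0 ≤ nearPart hn hα f x ∧
      ∫⁻ y, rieszNear n α (x - y) * ‖f y‖ₑ = ENNReal.ofReal (nearPart hn hα f x) := by
  have := isFiniteMeasure_rieszNearMeasure hn hα
  have h1 : nearPart hn hα f =ᵐ[volume] fun x => ∫ y, (|f| : Leb n s) (x - y)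
      ∂(rieszNearMeasure n α) := coeFn_avg ENNReal.ofReal_ne_top (rieszNearMeasure n α) |f|
  have habs : ∀ᵐ x, (|f| : Leb n s) x = |f x| := Lp.coeFn_abs f
  filter_upwards [h1, ae_integrable_coeFn_sub (rieszNearMeasure n α) (|f| : Leb n s)]
    with x hx hi
  have hnn : ∀ᵐ z ∂(rieszNearMeasure n α), 0 ≤ (|f| : Leb n s) (x - z) :=
    ae_comp_sub_rieszNearMeasure (P := fun x => 0 ≤ (|f| : Leb n s) x)
      (habs.mono fun y hy => hy ▸ abs_nonneg _) x
  refine ⟨hx ▸ integral_nonneg_of_ae hnn, ?_⟩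
  have hm : Measurable fun z => ‖(|f| : Leb n s) (x - z)‖ₑ :=
    ((Lp.stronglyMeasurable (|f| : Leb n s)).measurable.comp
      (measurable_const.sub measurable_id)).enorm
  calc ∫⁻ y, rieszNear n α (x - y) * ‖f y‖ₑ
      = ∫⁻ y, rieszNear n α (x - y) * ‖(|f| : Leb n s) (x - (x - y))‖ₑ := by
        refine lintegral_congr_ae ?_
        filter_upwards [habs] with y hy
        rw [sub_sub_cancel, hy, ← ofReal_norm |f y|, ← ofReal_norm, Real.norm_eq_abs,
          Real.norm_eq_abs,
          abs_abs]
    _ = ∫⁻ z, rieszNear n α z * ‖(|f| : Leb n s) (x - z)‖ₑ :=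
        lintegral_sub_left_eq_self (fun z => rieszNear n α z * ‖(|f| : Leb n s) (x - z)‖ₑ) x
    _ = ∫⁻ z, ‖(|f| : Leb n s) (x - z)‖ₑ ∂(rieszNearMeasure n α) :=
        (lintegral_withDensity_eq_lintegral_mul _ measurable_rieszNear hm).symm
    _ = ENNReal.ofReal (∫ z, ‖(|f| : Leb n s) (x - z)‖ ∂(rieszNearMeasure n α)) :=
        (ofReal_integral_norm_eq_lintegral_enorm hi).symm
    _ = _ := by
        rw [hx]
        congr 1
        refine integral_congr_ae ?_
        filter_upwards [hnn] with z hz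
        exact Real.norm_of_nonneg hz

theorem nearPart_le_ae (hn : 1 ≤ n) (hα : 0 < α) {M : ℝ} {f : Leb n s}
    (hf : f ∈ supBall (Space n) (ENNReal.ofReal s) M) :
    ∀ᵐ x, nearPart hn hα f x ≤ (rieszNearMeasure n α).real univ * M := by
  have := isFiniteMeasure_rieszNearMeasure hn hα
  have h1 : nearPart hn hα f =ᵐ[volume] fun x => ∫ y, (|f| : Leb n s) (x - y)
      ∂(rieszNearMeasure n α) := coeFn_avg ENNReal.ofReal_ne_top (rieszNearMeasure n α) |f|
  have habs : ∀ᵐ x, ‖(|f| : Leb n s) x‖ ≤ M := by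
    filter_upwards [Lp.coeFn_abs f, hf.2] with x hx h
    rwa [hx, Real.norm_eq_abs, abs_abs]
  filter_upwards [h1] with x hx
  rw [hx, mul_comm]
  exact (le_abs_self _).trans
    (norm_integral_le_of_norm_le_const (ae_comp_sub_rieszNearMeasure habs x))

/-- The assumptions on the exponents in the estimates of the nonlinearity. -/
structure Exponents (n : ℕ) (α p q s : ℝ) : Prop where
  one_le_n : 1 ≤ n
  α_pos : 0 < α
  α_lt : α < n
  one_lt_p : 1 < p
  one_le_q : 1 ≤ q
  s_pos : 0 < s
  /-- `s > n / (n - α)` -/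
  add_lt_one : α / n + 1 / s < 1
  /-- `s < n (p - 1) / α`, of which the weak inequality is enough -/
  s_le : s ≤ (p - 1) * (n / α)

namespace Exponents

/-- The `L^a` norm of the Riesz kernel outside the unit ball, for `1 / a + 1 / s + α / n = 1`. -/
def farConst (n : ℕ) (α s : ℝ) : ℝ :=
  ((∫⁻ z, rieszFar n α z ^ (1 - α / n - 1 / s)⁻¹) ^ (1 - α / n - 1 / s)).toReal

omit [Fact (1 ≤ ENNReal.ofReal s)] in
theorem farConst_nonneg : 0 ≤ farConst n α s := ENNReal.toReal_nonneg

omit [Fact (1 ≤ ENNReal.ofReal s)] in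
theorem n_pos (H : Exponents n α p q s) : (0 : ℝ) < n := H.α_pos.trans H.α_lt

theorem ofReal_farConst (H : Exponents n α p q s) :
    ENNReal.ofReal (farConst n α s) =
      (∫⁻ z, rieszFar n α z ^ (1 - α / n - 1 / s)⁻¹) ^ (1 - α / n - 1 / s) := by
  have hn := H.n_pos
  have hs := H.s_pos
  have hθ : 0 < 1 - α / n - 1 / s := by linarith [H.add_lt_one]
  refine ENNReal.ofReal_toReal (ENNReal.rpow_ne_top_of_nonneg hθ.le
    (lintegral_rieszFar_rpow_lt_top H.one_le_n (inv_pos.2 hθ) ?_).ne)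
  rw [← div_eq_mul_inv, lt_div_iff₀ hθ]
  have : (n : ℝ) - α = n * (1 - α / n) := by field_simp
  rw [this]
  have : 0 < 1 / s := by positivity
  exact mul_lt_mul_of_pos_left (by linarith) hn

/-- The basic estimate: the Riesz potential of `||f|^p - |g|^p|` is at most the sum of a function
controlled in `L^s` and of a constant, both linear in `f - g`. -/
theorem lintegral_riesz_le (H : Exponents n α p q s) {M : ℝ} {f g : Leb n s}
    (hf : f ∈ supBall (Space n) (ENNReal.ofReal s) M)
    (hg : g ∈ supBall (Space n) (ENNReal.ofReal s) M) :
    ∀ᵐ x, ∫⁻ y, ENNReal.ofReal (|(|f y| ^ p - |g y| ^ p)| / ‖x - y‖ ^ ((n : ℝ) - α)) ≤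
      ENNReal.ofReal (p * (2 * M) ^ (p - 1) *
        (nearPart H.one_le_n H.α_pos (f - g) x + farConst n α s * ‖f - g‖)) := by
  have hn := H.n_pos
  have hα := H.α_pos
  have hp1 : 0 ≤ p - 1 := by linarith [H.one_lt_p]
  have hp0 : 0 < p := by linarith [H.one_lt_p]
  have hM : 0 ≤ M := (norm_nonneg f).trans hf.1
  set m : Leb n s := |f| + |g| with hm
  have habs : ∀ {f : Leb n s}, f ∈ supBall (Space n) (ENNReal.ofReal s) M →
      |f| ∈ supBall (Space n) (ENNReal.ofReal s) M := fun {f} hf =>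
    ⟨(norm_abs_eq_norm f).trans_le hf.1, by
      filter_upwards [hf.2, Lp.coeFn_abs f] with x h1 h2; rwa [h2, abs_abs]⟩
  have hmM : m ∈ supBall (Space n) (ENNReal.ofReal s) (2 * M) := by
    rw [two_mul]; exact add_mem_supBall (habs hf) (habs hg)
  have hmm : Measurable fun y => ‖m y‖ₑ := (Lp.stronglyMeasurable m).measurable.enorm
  have hdm : Measurable fun y => ‖(f - g : Leb n s) y‖ₑ :=
    (Lp.stronglyMeasurable (f - g)).measurable.enorm
  have hpt : ∀ᵐ y, ∀ x, ENNReal.ofReal (|(|f y| ^ p - |g y| ^ p)| / ‖x - y‖ ^ ((n : ℝ) - α)) ≤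
      ENNReal.ofReal p * (ENNReal.ofReal ((2 * M) ^ (p - 1)) *
        (rieszNear n α (x - y) * ‖(f - g : Leb n s) y‖ₑ) +
        rieszFar n α (x - y) * (‖m y‖ₑ ^ (p - 1) * ‖(f - g : Leb n s) y‖ₑ)) := by
    filter_upwards [Lp.coeFn_sub f g, Lp.coeFn_add |f| |g|, Lp.coeFn_abs f, Lp.coeFn_abs g,
      hmM.2] with y h1 h2 h3 h4 h5 x
    have h6 : m y = |f y| + |g y| := by rw [hm, h2, Pi.add_apply, h3, h4]
    have h7 : ‖m y‖ₑ = ENNReal.ofReal (|f y| + |g y|) := by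
      rw [h6, ← ofReal_norm, Real.norm_of_nonneg (by positivity)]
    have h8 : ‖(f - g : Leb n s) y‖ₑ = ENNReal.ofReal |f y - g y| := by
      rw [h1, Pi.sub_apply, ← ofReal_norm, Real.norm_eq_abs]
    have h9 : |(|f y| ^ p - |g y| ^ p)| ≤ p * ((|f y| + |g y|) ^ (p - 1) * |f y - g y|) := by
      refine (abs_rpow_sub_rpow_le (abs_nonneg _) (abs_nonneg _)
        (le_add_of_nonneg_right (abs_nonneg (g y))) (le_add_of_nonneg_left (abs_nonneg (f y)))
        H.one_lt_p.le).trans ?_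
      rw [mul_assoc]
      have := abs_abs_sub_abs_le (f y) (g y)
      gcongr
    have h10 : ENNReal.ofReal (|f y| + |g y|) ^ (p - 1) ≤ ENNReal.ofReal ((2 * M) ^ (p - 1)) := by
      rw [← ENNReal.ofReal_rpow_of_nonneg (by positivity) hp1]
      refine ENNReal.rpow_le_rpow (ENNReal.ofReal_le_ofReal ?_) hp1
      rw [h6] at h5
      exact (le_abs_self _).trans h5
    calc ENNReal.ofReal (|(|f y| ^ p - |g y| ^ p)| / ‖x - y‖ ^ ((n : ℝ) - α))
        ≤ ENNReal.ofReal (p * ((|f y| + |g y|) ^ (p - 1) * |f y - g y|) *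
            (1 / ‖x - y‖ ^ ((n : ℝ) - α))) := by
          rw [div_eq_mul_one_div]
          gcongr
      _ = ENNReal.ofReal p * ((ENNReal.ofReal (|f y| + |g y|) ^ (p - 1) *
            ENNReal.ofReal |f y - g y|) * (rieszNear n α (x - y) + rieszFar n α (x - y))) := by
          rw [ENNReal.ofReal_mul (by positivity), ENNReal.ofReal_mul hp0.le,
            ENNReal.ofReal_mul (by positivity), ENNReal.ofReal_rpow_of_nonneg (by positivity) hp1,
            rieszNear_add_rieszFar, mul_assoc]
      _ ≤ _ := by
          rw [h7, h8]
          gcongr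
          rw [mul_add]
          gcongr ?_ + ?_
          · calc _ ≤ ENNReal.ofReal ((2 * M) ^ (p - 1)) * ENNReal.ofReal |f y - g y| *
                  rieszNear n α (x - y) := by gcongr
              _ = _ := by ring
          · exact (mul_comm _ _).le
  have hk1 : ∀ x, Measurable fun y => rieszNear n α (x - y) := fun x =>
    measurable_rieszNear.comp (measurable_const.sub measurable_id)
  have hnear : ∀ x, Measurable fun y => ENNReal.ofReal ((2 * M) ^ (p - 1)) *
      (rieszNear n α (x - y) * ‖(f - g : Leb n s) y‖ₑ) := fun x =>
    ((hk1 x).mul hdm).const_mul _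
  filter_upwards [nearPart_ae H.one_le_n H.α_pos (f - g)] with x hx
  have hfar := lintegral_rieszFar_mul_le (n := n) hα H.s_pos hn H.add_lt_one (p := p - 1)
    hmm.aemeasurable
    hdm.aemeasurable x
  rw [← H.ofReal_farConst, lintegral_enorm_rpow_eq H.s_pos] at hfar
  have hfar2 : (∫⁻ y, ‖m y‖ₑ ^ ((p - 1) * (n / α))) ^ (α / n) ≤
      ENNReal.ofReal ((2 * M) ^ (p - 1)) := by
    refine (ENNReal.rpow_le_rpow (lintegral_enorm_rpow_le_of_mem_supBall H.s_pos H.s_le hmM)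
      (by positivity)).trans_eq ?_
    rw [← ENNReal.rpow_mul, ← ENNReal.ofReal_rpow_of_nonneg (by positivity) hp1]
    congr 1
    field_simp
  refine (lintegral_mono_ae (hpt.mono fun y hy => hy x)).trans ?_
  rw [lintegral_const_mul' _ _ ENNReal.ofReal_ne_top,
    lintegral_add_left (hnear x),
    lintegral_const_mul' _ _ ENNReal.ofReal_ne_top, hx.2, mul_assoc p,
    ENNReal.ofReal_mul hp0.le, ENNReal.ofReal_mul (by positivity),
    ENNReal.ofReal_add hx.1 (mul_nonneg farConst_nonneg (norm_nonneg _)),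
    ENNReal.ofReal_mul farConst_nonneg,
    mul_add (ENNReal.ofReal ((2 * M) ^ (p - 1)))]
  gcongr
  calc _ ≤ _ := hfar
    _ ≤ ENNReal.ofReal (farConst n α s) * (ENNReal.ofReal ((2 * M) ^ (p - 1)) *
        ENNReal.ofReal ‖f - g‖) := by gcongr
    _ = _ := by ring

theorem zero_mem_supBall {M : ℝ} (hM : 0 ≤ M) :
    (0 : Leb n s) ∈ supBall (Space n) (ENNReal.ofReal s) M :=
  ⟨by simpa using hM, by
    filter_upwards [Lp.coeFn_zero ℝ (ENNReal.ofReal s) (volume : Measure (Space n))] with x hx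
    rw [hx]; simpa using hM⟩

theorem ae_integrable_riesz (H : Exponents n α p q s) {M : ℝ} {f : Leb n s}
    (hf : f ∈ supBall (Space n) (ENNReal.ofReal s) M) :
    ∀ᵐ x, Integrable fun y => |f y| ^ p / ‖x - y‖ ^ ((n : ℝ) - α) := by
  have hM : 0 ≤ M := (norm_nonneg f).trans hf.1
  have hp0 : p ≠ 0 := by linarith [H.one_lt_p]
  filter_upwards [H.lintegral_riesz_le hf (zero_mem_supBall hM)] with x hx
  have hfm : Measurable f := (Lp.stronglyMeasurable f).measurable
  have hm : Measurable fun y => |f y| ^ p / ‖x - y‖ ^ ((n : ℝ) - α) := by fun_prop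
  refine ⟨hm.aestronglyMeasurable, ?_⟩
  rw [hasFiniteIntegral_iff_ofReal (ae_of_all _ fun y => by positivity)]
  refine lt_of_le_of_lt (le_trans (le_of_eq ?_) hx) ENNReal.ofReal_lt_top
  refine lintegral_congr_ae ?_
  filter_upwards [Lp.coeFn_zero ℝ (ENNReal.ofReal s) (volume : Measure (Space n))] with y hy
  rw [hy, Pi.zero_apply, abs_zero, Real.zero_rpow hp0, sub_zero,
    abs_of_nonneg (by positivity : 0 ≤ |f y| ^ p)]

omit [Fact (1 ≤ ENNReal.ofReal s)] in
theorem rieszConst_pos (H : Exponents n α p q s) : 0 < rieszConst n α := by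
  have h1 : 0 < Real.Gamma (((n : ℝ) - α) / 2) := Real.Gamma_pos_of_pos (by linarith [H.α_lt])
  have h2 : 0 < Real.Gamma (α / 2) := Real.Gamma_pos_of_pos (by linarith [H.α_pos])
  have := Real.pi_pos
  rw [rieszConst]
  positivity

theorem rieszPotential_rpow_nonneg (H : Exponents n α p q s) (v : Space n → ℝ) (x : Space n) :
    0 ≤ rieszPotential α (fun y => |v y| ^ p) x :=
  mul_nonneg H.rieszConst_pos.le (integral_nonneg fun y => by positivity)

theorem abs_rieszPotential_sub_le (H : Exponents n α p q s) {M : ℝ} {f g : Leb n s}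
    (hf : f ∈ supBall (Space n) (ENNReal.ofReal s) M)
    (hg : g ∈ supBall (Space n) (ENNReal.ofReal s) M) :
    ∀ᵐ x, |rieszPotential α (fun y => |f y| ^ p) x - rieszPotential α (fun y => |g y| ^ p) x| ≤
      rieszConst n α * (p * (2 * M) ^ (p - 1)) *
        (nearPart H.one_le_n H.α_pos (f - g) x + farConst n α s * ‖f - g‖) := by
  have hp0 : 0 < p := by linarith [H.one_lt_p]
  have hM : 0 ≤ M := (norm_nonneg f).trans hf.1
  filter_upwards [H.lintegral_riesz_le hf hg, H.ae_integrable_riesz hf, H.ae_integrable_riesz hg,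
    nearPart_ae H.one_le_n H.α_pos (f - g)] with x h1 h2 h3 h4
  rw [rieszPotential, rieszPotential, ← mul_sub, ← integral_sub h2 h3, abs_mul,
    abs_of_pos H.rieszConst_pos, mul_assoc]
  refine mul_le_mul_of_nonneg_left ?_ H.rieszConst_pos.le
  rw [← Real.norm_eq_abs]
  refine (norm_integral_le_lintegral_norm _).trans ?_
  refine ENNReal.toReal_le_of_le_ofReal (mul_nonneg (by positivity)
    (add_nonneg h4.1 (mul_nonneg farConst_nonneg (norm_nonneg _)))) ?_
  refine le_trans (le_of_eq ?_) h1
  refine lintegral_congr fun y => ?_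
  rw [← sub_div, norm_div, Real.norm_eq_abs, Real.norm_of_nonneg (by positivity)]

omit [Fact (1 ≤ ENNReal.ofReal s)] in
theorem rieszPotential_zero (H : Exponents n α p q s) (x : Space n) :
    rieszPotential α (fun y => |(0 : Leb n s) y| ^ p) x = 0 := by
  have hp0 : p ≠ 0 := by linarith [H.one_lt_p]
  rw [rieszPotential, integral_eq_zero_of_ae, mul_zero]
  filter_upwards [Lp.coeFn_zero ℝ (ENNReal.ofReal s) (volume : Measure (Space n))] with y hy
  rw [hy, Pi.zero_apply, abs_zero, Real.zero_rpow hp0, zero_div]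

/-- A bound for the Riesz potential of `|f| ^ p` on bounded sets. -/
def rieszBound (n : ℕ) (α p s M : ℝ) : ℝ :=
  rieszConst n α * (p * (2 * M) ^ (p - 1)) *
    ((rieszNearMeasure n α).real univ * M + farConst n α s * M)

theorem rieszBound_nonneg (H : Exponents n α p q s) {M : ℝ} (hM : 0 ≤ M) :
    0 ≤ rieszBound n α p s M := by
  have hp0 : 0 < p := by linarith [H.one_lt_p]
  have := H.rieszConst_pos
  have := farConst_nonneg (n := n) (α := α) (s := s)
  rw [rieszBound]
  positivity

theorem rieszPotential_le (H : Exponents n α p q s) {M : ℝ} {f : Leb n s}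
    (hf : f ∈ supBall (Space n) (ENNReal.ofReal s) M) :
    ∀ᵐ x, rieszPotential α (fun y => |f y| ^ p) x ≤ rieszBound n α p s M := by
  have hp0 : 0 < p := by linarith [H.one_lt_p]
  have hM : 0 ≤ M := (norm_nonneg f).trans hf.1
  have h := H.abs_rieszPotential_sub_le hf (zero_mem_supBall hM)
  simp only [H.rieszPotential_zero, sub_zero] at h
  filter_upwards [h, nearPart_le_ae H.one_le_n H.α_pos hf] with x h1 h2
  refine ((le_abs_self _).trans h1).trans ?_
  have := H.rieszConst_pos
  have := farConst_nonneg (n := n) (α := α) (s := s)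
  rw [rieszBound]
  gcongr
  exact hf.1

theorem abs_nonlinearity_sub_le (H : Exponents n α p q s) {M : ℝ} {f g : Leb n s}
    (hf : f ∈ supBall (Space n) (ENNReal.ofReal s) M)
    (hg : g ∈ supBall (Space n) (ENNReal.ofReal s) M) :
    ∀ᵐ x, |nonlinearity α p q f x - nonlinearity α p q g x| ≤
      rieszBound n α p s M * (q * M ^ (q - 1)) * |f x - g x| +
      rieszConst n α * (p * (2 * M) ^ (p - 1)) * (M ^ q * nearPart H.one_le_n H.α_pos (f - g) x +
        farConst n α s * ‖f - g‖ * (q * M ^ (q - 1)) * |g x|) := by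
  have hp0 : 0 < p := by linarith [H.one_lt_p]
  have hq0 : 0 < q := by linarith [H.one_le_q]
  have hM : 0 ≤ M := (norm_nonneg f).trans hf.1
  have hrc := H.rieszConst_pos
  have hfc := farConst_nonneg (n := n) (α := α) (s := s)
  filter_upwards [hf.2, hg.2, H.abs_rieszPotential_sub_le hf hg, H.rieszPotential_le hf,
    nearPart_ae H.one_le_n H.α_pos (f - g)] with x h1 h2 h3 h4 h5
  have h6 : |(|f x| ^ q - |g x| ^ q)| ≤ q * M ^ (q - 1) * |f x - g x| := by
    refine (abs_rpow_sub_rpow_le (abs_nonneg _) (abs_nonneg _) h1 h2 H.one_le_q).trans ?_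
    have := abs_abs_sub_abs_le (f x) (g x)
    gcongr
  -- the part of the potential in `L^s` meets the bounded factor `M ^ q`, the bounded part meets
  -- `|g|`, which is in `L^s`
  have h7 : |g x| ^ q ≤ q * M ^ (q - 1) * |g x| := by
    have := abs_rpow_sub_rpow_le (abs_nonneg (g x)) le_rfl h2 hM H.one_le_q
    rwa [Real.zero_rpow hq0.ne', sub_zero, sub_zero, abs_of_nonneg (by positivity), abs_abs] at this
  have h8 : |g x| ^ q ≤ M ^ q := Real.rpow_le_rpow (abs_nonneg _) h2 hq0.le
  set A := rieszPotential α (fun y => |f y| ^ p) x with hA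
  set B := rieszPotential α (fun y => |g y| ^ p) x with hB
  have hA0 : 0 ≤ A := H.rieszPotential_rpow_nonneg _ x
  have h9 : nonlinearity α p q f x - nonlinearity α p q g x =
      A * (|f x| ^ q - |g x| ^ q) + (A - B) * |g x| ^ q := by
    rw [nonlinearity, nonlinearity, ← hA, ← hB]; ring
  rw [h9]
  refine (abs_add_le _ _).trans (add_le_add ?_ ?_)
  · rw [abs_mul, abs_of_nonneg hA0, mul_assoc]
    exact mul_le_mul h4 h6 (abs_nonneg _) (H.rieszBound_nonneg hM)
  · rw [abs_mul, abs_of_nonneg (by positivity : 0 ≤ |g x| ^ q)]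
    set c := rieszConst n α * (p * (2 * M) ^ (p - 1)) with hc
    have hc0 : 0 ≤ c := by positivity
    have hN := h5.1
    calc |A - B| * |g x| ^ q ≤ c * (nearPart H.one_le_n H.α_pos (f - g) x +
          farConst n α s * ‖f - g‖) * |g x| ^ q := by gcongr
      _ = c * (nearPart H.one_le_n H.α_pos (f - g) x * |g x| ^ q +
          farConst n α s * ‖f - g‖ * |g x| ^ q) := by ring
      _ ≤ c * (nearPart H.one_le_n H.α_pos (f - g) x * M ^ q +
          farConst n α s * ‖f - g‖ * (q * M ^ (q - 1) * |g x|)) := by gcongr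
      _ = _ := by ring

/-- The Lipschitz constant of the nonlinearity in `L^s`, on bounded sets. -/
def lipConst (n : ℕ) (α p q s M : ℝ) : ℝ :=
  rieszBound n α p s M * (q * M ^ (q - 1)) + rieszConst n α * (p * (2 * M) ^ (p - 1)) *
    (M ^ q * (rieszNearMeasure n α).real univ + farConst n α s * (q * M ^ (q - 1)) * M)

theorem lipConst_nonneg (H : Exponents n α p q s) {M : ℝ} (hM : 0 ≤ M) :
    0 ≤ lipConst n α p q s M := by
  have hp0 : 0 < p := by linarith [H.one_lt_p]
  have hq0 : 0 < q := by linarith [H.one_le_q]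
  have := H.rieszConst_pos
  have := farConst_nonneg (n := n) (α := α) (s := s)
  have := H.rieszBound_nonneg hM
  rw [lipConst]
  positivity

/-- A pointwise domination by an element of `L^s` gives both integrability and the Lipschitz
estimate. -/
theorem exists_dominating (H : Exponents n α p q s) {M : ℝ} {f g : Leb n s}
    (hf : f ∈ supBall (Space n) (ENNReal.ofReal s) M)
    (hg : g ∈ supBall (Space n) (ENNReal.ofReal s) M) :
    ∃ h : Leb n s, ‖h‖ ≤ lipConst n α p q s M * ‖f - g‖ ∧
      ∀ᵐ x, |nonlinearity α p q f x - nonlinearity α p q g x| ≤ h x := by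
  have hp0 : 0 < p := by linarith [H.one_lt_p]
  have hq0 : 0 < q := by linarith [H.one_le_q]
  have hM : 0 ≤ M := (norm_nonneg f).trans hf.1
  have hrc := H.rieszConst_pos
  have hfc := farConst_nonneg (n := n) (α := α) (s := s)
  have hrb := H.rieszBound_nonneg hM
  set c := rieszConst n α * (p * (2 * M) ^ (p - 1)) with hc
  have hc0 : 0 ≤ c := by positivity
  set a₁ := rieszBound n α p s M * (q * M ^ (q - 1)) with ha₁
  have ha₁0 : 0 ≤ a₁ := by positivity
  set a₂ := c * M ^ q with ha₂
  have ha₂0 : 0 ≤ a₂ := by positivity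
  set a₃ := c * (farConst n α s * ‖f - g‖ * (q * M ^ (q - 1))) with ha₃
  have ha₃0 : 0 ≤ a₃ := by positivity
  refine ⟨a₁ • |f - g| + a₂ • nearPart H.one_le_n H.α_pos (f - g) + a₃ • |g|, ?_, ?_⟩
  · refine (norm_add₃_le).trans ?_
    simp only [norm_smul, norm_abs_eq_norm, Real.norm_of_nonneg ha₁0, Real.norm_of_nonneg ha₂0,
      Real.norm_of_nonneg ha₃0]
    calc a₁ * ‖f - g‖ + a₂ * ‖nearPart H.one_le_n H.α_pos (f - g)‖ + a₃ * ‖g‖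
        ≤ a₁ * ‖f - g‖ + a₂ * ((rieszNearMeasure n α).real univ * ‖f - g‖) + a₃ * M := by
          gcongr
          · exact norm_nearPart_le H.one_le_n H.α_pos (f - g)
          · exact hg.1
      _ = _ := by rw [lipConst, ← hc, ← ha₁, ha₂, ha₃]; ring
  · filter_upwards [H.abs_nonlinearity_sub_le hf hg,
      Lp.coeFn_add (a₁ • |f - g| + a₂ • nearPart H.one_le_n H.α_pos (f - g)) (a₃ • |g|),
      Lp.coeFn_add (a₁ • |f - g|) (a₂ • nearPart H.one_le_n H.α_pos (f - g)),
      Lp.coeFn_smul a₁ |f - g|, Lp.coeFn_smul a₂ (nearPart H.one_le_n H.α_pos (f - g)),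
      Lp.coeFn_smul a₃ |g|, Lp.coeFn_abs (f - g), Lp.coeFn_abs g, Lp.coeFn_sub f g]
      with x h1 h2 h3 h4 h5 h6 h7 h8 h9
    refine h1.trans (le_of_eq ?_)
    rw [h2, Pi.add_apply, h3, Pi.add_apply, h4, h5, h6]
    simp only [Pi.smul_apply, smul_eq_mul]
    rw [h7, h8, h9, Pi.sub_apply, ha₁, ha₂, ha₃]
    ring

omit [Fact (1 ≤ ENNReal.ofReal s)] in
theorem stronglyMeasurable_nonlinearity (f : Leb n s) :
    StronglyMeasurable (nonlinearity α p q f) := by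
  have hf : Measurable f := (Lp.stronglyMeasurable f).measurable
  have h1 : StronglyMeasurable fun x => ∫ y, |f y| ^ p / ‖x - y‖ ^ ((n : ℝ) - α) := by
    refine StronglyMeasurable.integral_prod_right'
      (f := fun z : Space n × Space n => |f z.2| ^ p / ‖z.1 - z.2‖ ^ ((n : ℝ) - α)) ?_
    exact Measurable.stronglyMeasurable (by fun_prop)
  have h2 : Measurable fun x => |f x| ^ q := by fun_prop
  exact (stronglyMeasurable_const.mul h1).mul h2.stronglyMeasurable

theorem nonlinearity_zero (H : Exponents n α p q s) (x : Space n) :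
    nonlinearity α p q (0 : Leb n s) x = 0 := by
  rw [nonlinearity, H.rieszPotential_zero, zero_mul]

theorem memLp_nonlinearity (H : Exponents n α p q s) {M : ℝ} {f : Leb n s}
    (hf : f ∈ supBall (Space n) (ENNReal.ofReal s) M) :
    MemLp (nonlinearity α p q f) (ENNReal.ofReal s) := by
  have hM : 0 ≤ M := (norm_nonneg f).trans hf.1
  obtain ⟨h, -, hh⟩ := H.exists_dominating hf (zero_mem_supBall hM)
  simp only [H.nonlinearity_zero, sub_zero] at hh
  exact (Lp.memLp h).mono' (stronglyMeasurable_nonlinearity f).aestronglyMeasurable hh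

end Exponents

open Classical in
/-- The nonlinearity as a map of `L^s` (with the junk value `0` outside `L^∞`). -/
def nonlinearityLp (α p q : ℝ) (f : Leb n s) : Leb n s :=
  if h : MemLp (nonlinearity α p q f) (ENNReal.ofReal s) then h.toLp else 0

namespace Exponents

theorem coeFn_nonlinearityLp (H : Exponents n α p q s) {M : ℝ} {f : Leb n s}
    (hf : f ∈ supBall (Space n) (ENNReal.ofReal s) M) :
    nonlinearityLp α p q f =ᵐ[volume] nonlinearity α p q f := by
  rw [nonlinearityLp, dif_pos (H.memLp_nonlinearity hf)]
  exact MemLp.coeFn_toLp _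

theorem norm_nonlinearityLp_sub_le (H : Exponents n α p q s) {M : ℝ} {f g : Leb n s}
    (hf : f ∈ supBall (Space n) (ENNReal.ofReal s) M)
    (hg : g ∈ supBall (Space n) (ENNReal.ofReal s) M) :
    ‖nonlinearityLp α p q f - nonlinearityLp α p q g‖ ≤ lipConst n α p q s M * ‖f - g‖ := by
  obtain ⟨h, h1, h2⟩ := H.exists_dominating hf hg
  refine le_trans (Lp.norm_le_norm_of_ae_le ?_) h1
  filter_upwards [h2, H.coeFn_nonlinearityLp hf, H.coeFn_nonlinearityLp hg,
    Lp.coeFn_sub (nonlinearityLp α p q f) (nonlinearityLp α p q g)] with x h3 h4 h5 h6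
  rw [h6, Pi.sub_apply, h4, h5]
  exact h3.trans (le_abs_self _)

theorem nonlinearityLp_zero (H : Exponents n α p q s) :
    nonlinearityLp α p q (0 : Leb n s) = 0 := by
  refine Lp.ext ?_
  filter_upwards [H.coeFn_nonlinearityLp (zero_mem_supBall (n := n) (s := s) le_rfl),
    Lp.coeFn_zero ℝ (ENNReal.ofReal s) (volume : Measure (Space n))] with x h1 h2
  rw [h1, h2, H.nonlinearity_zero, Pi.zero_apply]

theorem nonlinearityLp_mem_supBall (H : Exponents n α p q s) {M : ℝ} {f : Leb n s}
    (hf : f ∈ supBall (Space n) (ENNReal.ofReal s) M) :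
    nonlinearityLp α p q f ∈ supBall (Space n) (ENNReal.ofReal s)
      (max (lipConst n α p q s M * M) (rieszBound n α p s M * M ^ q)) := by
  have hM : 0 ≤ M := (norm_nonneg f).trans hf.1
  have hq0 : 0 ≤ q := by linarith [H.one_le_q]
  refine ⟨le_trans ?_ (le_max_left _ _), ?_⟩
  · have := H.norm_nonlinearityLp_sub_le hf (zero_mem_supBall hM)
    rw [H.nonlinearityLp_zero, sub_zero, sub_zero] at this
    exact this.trans (mul_le_mul_of_nonneg_left hf.1 (H.lipConst_nonneg hM))
  · filter_upwards [H.coeFn_nonlinearityLp hf, H.rieszPotential_le hf, hf.2] with x h1 h2 h3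
    refine le_trans ?_ (le_max_right _ _)
    have h4 := H.rieszPotential_rpow_nonneg f x
    rw [h1, nonlinearity, abs_of_nonneg (by positivity)]
    exact mul_le_mul h2 (Real.rpow_le_rpow (abs_nonneg _) h3 hq0) (by positivity)
      (H.rieszBound_nonneg hM)

theorem nonlinearityLp_nonneg (H : Exponents n α p q s) (f : Leb n s) :
    0 ≤ nonlinearityLp α p q f := by
  rw [nonlinearityLp]
  split_ifs with h
  · rw [← Lp.coeFn_nonneg]
    filter_upwards [h.coeFn_toLp] with x hx
    rw [hx]
    exact mul_nonneg (H.rieszPotential_rpow_nonneg f x) (by positivity)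
  · exact le_rfl

end Exponents

end

/-! ### Mild solutions of abstract semilinear equations -/

/-- The data of a semilinear problem `u' = A u + F u` in a Banach space: a strongly continuous
semigroup `S` of contractions, a growing family `B M` of closed convex sets invariant under `S`, and
a nonlinearity `F` which is Lipschitz on each `B M` and maps it to some `B (Φ M)`. The sets `B M`
play the role of the balls of a finer norm, for which `S` need not be strongly continuous.
For convenience, `S t` is defined for all real `t`, but the semigroup law is required for
nonnegative times only. -/
structure SemilinearProblem (E : Type*) [NormedAddCommGroup E] [NormedSpace ℝ E] where
  /-- the semigroup -/
  S : ℝ → E →L[ℝ] E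
  S_zero : ∀ x, S 0 x = x
  S_add : ∀ t r : ℝ, 0 ≤ t → 0 ≤ r → ∀ x, S (t + r) x = S t (S r x)
  norm_S_le : ∀ t x, ‖S t x‖ ≤ ‖x‖
  continuous_S : ∀ x, Continuous fun t => S t x
  /-- the bounded sets -/
  B : ℝ → Set E
  isClosed_B : ∀ M, IsClosed (B M)
  convex_B : ∀ M, Convex ℝ (B M)
  mono_B : Monotone B
  add_mem_B : ∀ {a b x y}, x ∈ B a → y ∈ B b → x + y ∈ B (a + b)
  smul_mem_B : ∀ {a c x}, 0 ≤ c → x ∈ B a → c • x ∈ B (c * a)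
  neg_mem_B : ∀ {a x}, x ∈ B a → -x ∈ B a
  S_mem_B : ∀ {M x} t, x ∈ B M → S t x ∈ B M
  /-- the nonlinearity -/
  F : E → E
  /-- its Lipschitz constants -/
  lip : ℝ → ℝ≥0
  lipschitzOn_F : ∀ M, LipschitzOnWith (lip M) F (B M)
  /-- its bounds -/
  Φ : ℝ → ℝ
  Φ_nonneg : ∀ M, 0 ≤ Φ M
  F_mem_B : ∀ {M x}, x ∈ B M → F x ∈ B (Φ M)

namespace SemilinearProblem

variable {E : Type*} [NormedAddCommGroup E] [NormedSpace ℝ E] (d : SemilinearProblem E)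

/-- Mild solutions on `[0, T]` with values in one of the bounded sets. -/
structure Mild (x : E) (T : ℝ) (u : ℝ → E) : Prop where
  continuousOn : ContinuousOn u (Icc 0 T)
  exists_mem_B : ∃ M, ∀ t ∈ Icc 0 T, u t ∈ d.B M
  eq : ∀ t ∈ Icc 0 T, u t = d.S t x + ∫ τ in (0 : ℝ)..t, d.S (t - τ) (d.F (u τ))

theorem continuous_uncurry_S : Continuous fun z : ℝ × E => d.S z.1 z.2 := by
  refine continuous_prod_of_continuous_lipschitzWith' _ 1 (fun t => ?_) d.continuous_S
  refine LipschitzWith.of_dist_le_mul fun x y => ?_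
  rw [NNReal.coe_one, one_mul, dist_eq_norm, dist_eq_norm, ← map_sub]
  exact d.norm_S_le _ _

theorem continuous_S_sub {g : ℝ → E} (hg : Continuous g) :
    Continuous fun z : ℝ × ℝ => d.S (z.1 - z.2) (g z.2) :=
  d.continuous_uncurry_S.comp
    (f := fun z : ℝ × ℝ => ((z.1 - z.2, g z.2) : ℝ × E)) (by fun_prop)

theorem continuous_S_sub_right {g : ℝ → E} (hg : Continuous g) (t : ℝ) :
    Continuous fun τ => d.S (t - τ) (g τ) :=
  (d.continuous_S_sub hg).comp (f := fun τ : ℝ => ((t, τ) : ℝ × ℝ)) (by fun_prop)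

theorem continuous_duhamel {g : ℝ → E} (hg : Continuous g) :
    Continuous fun t : ℝ => ∫ τ in (0 : ℝ)..t, d.S (t - τ) (g τ) :=
  intervalIntegral.continuous_parametric_intervalIntegral_of_continuous
    (f := fun t τ => d.S (t - τ) (g τ)) (d.continuous_S_sub hg) continuous_id

/-- A function which is continuous on `[0, T]` agrees there with a continuous function. -/
theorem exists_continuous_eqOn {X : Type*} [TopologicalSpace X] {T : ℝ} (hT : 0 ≤ T) {f : ℝ → X}
    (hf : ContinuousOn f (Icc 0 T)) : ∃ g : ℝ → X, Continuous g ∧ EqOn f g (Icc 0 T) :=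
  ⟨IccExtend hT ((Icc 0 T).domRestrict f),
    (continuousOn_iff_continuous_domRestrict.1 hf).Icc_extend',
    fun t ht => by rw [IccExtend_of_mem hT _ ht]; rfl⟩

theorem integral_congr_Icc {T : ℝ} {f g : ℝ → E} (h : EqOn f g (Icc 0 T)) {t : ℝ}
    (ht : t ∈ Icc 0 T) :
    ∫ τ in (0 : ℝ)..t, d.S (t - τ) (f τ) = ∫ τ in (0 : ℝ)..t, d.S (t - τ) (g τ) := by
  refine intervalIntegral.integral_congr fun τ hτ => ?_
  rw [uIcc_of_le ht.1] at hτ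
  simp only [h ⟨hτ.1, hτ.2.trans ht.2⟩]

variable {d}

theorem continuousOn_F_comp {T M : ℝ} {u : ℝ → E} (hu : ContinuousOn u (Icc 0 T))
    (hM : ∀ t ∈ Icc 0 T, u t ∈ d.B M) : ContinuousOn (fun t => d.F (u t)) (Icc 0 T) :=
  (d.lipschitzOn_F M).continuousOn.comp hu hM

theorem Mild.exists_continuous {x : E} {T : ℝ} (hT : 0 ≤ T) {u : ℝ → E} (hu : d.Mild x T u) :
    ∃ g : ℝ → E, Continuous g ∧ EqOn (fun t => d.F (u t)) g (Icc 0 T) := by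
  obtain ⟨M, hM⟩ := hu.exists_mem_B
  exact exists_continuous_eqOn hT (continuousOn_F_comp hu.continuousOn hM)

theorem Mild.mono {x : E} {T T' : ℝ} {u : ℝ → E} (hu : d.Mild x T u) (h : T' ≤ T) :
    d.Mild x T' u := by
  have hs : Icc 0 T' ⊆ Icc 0 T := Icc_subset_Icc_right h
  exact ⟨hu.continuousOn.mono hs, hu.exists_mem_B.imp fun M hM t ht => hM t (hs ht),
    fun t ht => hu.eq t (hs ht)⟩

theorem Mild.congr {x : E} {T : ℝ} {u v : ℝ → E} (hu : d.Mild x T u) (h : EqOn v u (Icc 0 T)) :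
    d.Mild x T v := by
  refine ⟨hu.continuousOn.congr h, hu.exists_mem_B.imp fun M hM t ht => h ht ▸ hM t ht,
    fun t ht => ?_⟩
  rw [h ht, hu.eq t ht]
  exact congrArg _ (d.integral_congr_Icc (fun τ hτ => by simp only [h hτ]) ht)

theorem Mild.apply_zero {x : E} {T : ℝ} (hT : 0 ≤ T) {u : ℝ → E} (hu : d.Mild x T u) :
    u 0 = x := by
  rw [hu.eq 0 ⟨le_rfl, hT⟩, d.S_zero, intervalIntegral.integral_same, add_zero]

theorem Mild.eqOn {x : E} {T : ℝ} {u v : ℝ → E} (hu : d.Mild x T u) (hv : d.Mild x T v) :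
    EqOn u v (Icc 0 T) := by
  rcases lt_or_ge T 0 with hT | hT
  · intro t ht; exact absurd (ht.1.trans ht.2) (not_le.2 hT)
  obtain ⟨M₁, hM₁⟩ := hu.exists_mem_B
  obtain ⟨M₂, hM₂⟩ := hv.exists_mem_B
  set L := d.lip (max M₁ M₂)
  obtain ⟨f, hf, hfu⟩ := hu.exists_continuous hT
  obtain ⟨g, hg, hgv⟩ := hv.exists_continuous hT
  obtain ⟨w, hw, hweq⟩ := exists_continuous_eqOn hT
    (f := fun t => ‖u t - v t‖) (hu.continuousOn.sub hv.continuousOn).norm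
  have hfg : ∀ t ∈ Icc 0 T, ‖f t - g t‖ ≤ L * w t := fun t ht => by
    rw [← hfu ht, ← hgv ht, ← hweq ht, ← dist_eq_norm]
    simp only [← dist_eq_norm]
    exact (d.lipschitzOn_F _).dist_le_mul _ (d.mono_B (le_max_left _ _) (hM₁ t ht)) _
      (d.mono_B (le_max_right _ _) (hM₂ t ht))
  have hle : ∀ t ∈ Icc 0 T, w t ≤ L * ∫ τ in (0 : ℝ)..t, w τ := fun t ht => by
    have h1 : u t - v t = ∫ τ in (0 : ℝ)..t, d.S (t - τ) (f τ - g τ) := by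
      rw [hu.eq t ht, hv.eq t ht, d.integral_congr_Icc hfu ht, d.integral_congr_Icc hgv ht,
        add_sub_add_left_eq_sub, ← intervalIntegral.integral_sub
          ((d.continuous_S_sub_right hf t).intervalIntegrable _ _)
          ((d.continuous_S_sub_right hg t).intervalIntegrable _ _)]
      simp only [map_sub]
    rw [← hweq ht]
    simp only
    rw [h1, ← intervalIntegral.integral_const_mul]
    refine intervalIntegral.norm_integral_le_of_norm_le ht.1 (ae_of_all _ fun τ hτ => ?_)
      ((continuous_const.mul hw).intervalIntegrable _ _)
    exact (d.norm_S_le _ _).trans (hfg τ ⟨hτ.1.le, hτ.2.trans ht.2⟩)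
  have hw0 : ∀ t ∈ Icc 0 T, 0 ≤ w t := fun t ht => by
    rw [← hweq ht]; exact norm_nonneg _
  have hφ : ∀ t ∈ Icc 0 T, 0 ≤ ∫ τ in (0 : ℝ)..t, w τ := fun t ht =>
    intervalIntegral.integral_nonneg ht.1 fun τ hτ => hw0 τ ⟨hτ.1, hτ.2.trans ht.2⟩
  -- Gronwall's inequality for the primitive of `w`
  have hgr := norm_le_gronwallBound_of_norm_deriv_right_le (f := fun t => ∫ τ in (0 : ℝ)..t, w τ)
    (f' := w) (δ := 0) (K := L) (ε := 0) (a := 0) (b := T)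
    (intervalIntegral.continuous_primitive (fun a b => hw.intervalIntegrable a b) 0).continuousOn
    (fun t _ => (intervalIntegral.integral_hasDerivAt_right (hw.intervalIntegrable _ _)
      (hw.stronglyMeasurableAtFilter _ _) hw.continuousAt).hasDerivWithinAt) (by simp)
    (fun t ht => by
      have ht' : t ∈ Icc 0 T := Ico_subset_Icc_self ht
      rw [Real.norm_of_nonneg (hw0 t ht'), Real.norm_of_nonneg (hφ t ht'), add_zero]
      exact hle t ht')
  intro t ht
  have h1 := hgr t ht
  rw [gronwallBound_ε0_δ0] at h1
  have h2 := hle t ht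
  rw [norm_le_zero_iff.1 h1, mul_zero, ← hweq ht] at h2
  exact sub_eq_zero.1 (norm_le_zero_iff.1 h2)

variable [CompleteSpace E]

/-- An integral over `[0, t]` is `t` times an average. -/
theorem exists_integral_eq_smul {K : Set E} (hK : Convex ℝ K) (hKc : IsClosed K) {t : ℝ}
    (ht : 0 < t) {g : ℝ → E} (hg : IntervalIntegrable g volume 0 t)
    (hmem : ∀ τ ∈ Ioc 0 t, g τ ∈ K) : ∃ y ∈ K, ∫ τ in (0 : ℝ)..t, g τ = t • y := by
  refine ⟨⨍ τ in Ioc 0 t, g τ, hK.set_average_mem hKc (by simp [ht]) (by simp)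
    ((ae_restrict_iff' measurableSet_Ioc).2 (ae_of_all _ hmem))
    ((intervalIntegrable_iff_integrableOn_Ioc_of_le ht.le).1 hg), ?_⟩
  rw [setAverage_eq, smul_smul, measureReal_def, Real.volume_Ioc, sub_zero,
    ENNReal.toReal_ofReal ht.le, mul_inv_cancel₀ ht.ne', one_smul,
    ← intervalIntegral.integral_of_le ht.le]

theorem integral_mem_B {a t : ℝ} (ht : 0 < t) {g : ℝ → E} (hg : IntervalIntegrable g volume 0 t)
    (hmem : ∀ τ ∈ Ioc 0 t, g τ ∈ d.B a) : ∫ τ in (0 : ℝ)..t, g τ ∈ d.B (t * a) := by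
  obtain ⟨y, hy, h⟩ := exists_integral_eq_smul (d.convex_B a) (d.isClosed_B a) ht hg hmem
  rw [h]
  exact d.smul_mem_B ht.le hy

/-- A closed convex cone which is invariant under the semigroup and contains the range of the
nonlinearity is invariant under the evolution. -/
theorem Mild.mem_cone {K : Set E} (hK : Convex ℝ K) (hKc : IsClosed K)
    (hadd : ∀ y ∈ K, ∀ z ∈ K, y + z ∈ K) (hsmul : ∀ c : ℝ, 0 ≤ c → ∀ y ∈ K, c • y ∈ K)
    (hS : ∀ t, ∀ y ∈ K, d.S t y ∈ K) (hF : ∀ y, d.F y ∈ K) {x : E} (hx : x ∈ K) {T : ℝ}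
    {u : ℝ → E} (hu : d.Mild x T u) {t : ℝ} (ht : t ∈ Icc 0 T) : u t ∈ K := by
  have hT : 0 ≤ T := ht.1.trans ht.2
  rcases ht.1.eq_or_lt with rfl | ht0
  · rwa [hu.apply_zero hT]
  obtain ⟨g, hg, hgu⟩ := hu.exists_continuous hT
  obtain ⟨y, hy, h⟩ := exists_integral_eq_smul hK hKc ht0
    ((d.continuous_S_sub_right hg t).intervalIntegrable 0 t)
    fun τ hτ => hS _ _ (hgu ⟨hτ.1.le, hτ.2.trans ht.2⟩ ▸ hF (u τ))
  rw [hu.eq t ht, d.integral_congr_Icc hgu ht, h]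
  exact hadd _ (hS _ _ hx) _ (hsmul _ ht0.le _ hy)

/-- The Duhamel formula restarted at a time `r`. -/
theorem Mild.eq_restart {x : E} {T : ℝ} {u : ℝ → E} (hu : d.Mild x T u) {r t : ℝ} (hr : 0 ≤ r)
    (hrt : r ≤ t) (ht : t ≤ T) :
    u t = d.S (t - r) (u r) + ∫ τ in r..t, d.S (t - τ) (d.F (u τ)) := by
  have hT : 0 ≤ T := hr.trans (hrt.trans ht)
  obtain ⟨g, hg, hgu⟩ := hu.exists_continuous hT
  have hint : ∀ c a b : ℝ, IntervalIntegrable (fun τ => d.S (c - τ) (g τ)) volume a b :=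
    fun c a b => (d.continuous_S_sub_right hg c).intervalIntegrable _ _
  have h1 : ∫ τ in r..t, d.S (t - τ) (d.F (u τ)) = ∫ τ in r..t, d.S (t - τ) (g τ) := by
    refine intervalIntegral.integral_congr fun τ hτ => ?_
    rw [uIcc_of_le hrt] at hτ
    simp only [← hgu ⟨hr.trans hτ.1, hτ.2.trans ht⟩]
  rw [h1, hu.eq t ⟨hr.trans hrt, ht⟩, hu.eq r ⟨hr, hrt.trans ht⟩,
    d.integral_congr_Icc hgu ⟨hr.trans hrt, ht⟩, d.integral_congr_Icc hgu ⟨hr, hrt.trans ht⟩,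
    map_add, ← d.S_add _ _ (sub_nonneg.2 hrt) hr, sub_add_cancel, add_assoc,
    ← intervalIntegral.integral_add_adjacent_intervals (hint t 0 r) (hint t r t),
    ← (d.S (t - r)).intervalIntegral_comp_comm (hint r 0 r)]
  congr 2
  refine intervalIntegral.integral_congr fun τ hτ => ?_
  rw [uIcc_of_le hr] at hτ
  rw [← d.S_add _ _ (sub_nonneg.2 hrt) (by linarith [hτ.2])]
  congr 2; ring

theorem Mild.integral_mem_B_restart {x : E} {T : ℝ} {u : ℝ → E} (hu : d.Mild x T u) {M : ℝ}
    (hM : ∀ t ∈ Icc 0 T, u t ∈ d.B M) {r t : ℝ} (hr : 0 ≤ r) (hrt : r < t) (ht : t ≤ T) :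
    ∫ τ in r..t, d.S (t - τ) (d.F (u τ)) ∈ d.B ((t - r) * d.Φ M) := by
  obtain ⟨g, hg, hgu⟩ := hu.exists_continuous (hr.trans (hrt.le.trans ht))
  have h1 : ∫ τ in r..t, d.S (t - τ) (d.F (u τ)) =
      ∫ τ in (0 : ℝ)..(t - r), d.S (t - (τ + r)) (g (τ + r)) := by
    have h2 := intervalIntegral.integral_comp_add_right (a := 0) (b := t - r)
      (fun τ => d.S (t - τ) (g τ)) r
    rw [zero_add, sub_add_cancel] at h2
    rw [h2]
    refine intervalIntegral.integral_congr fun τ hτ => ?_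
    rw [uIcc_of_le hrt.le] at hτ
    simp only [← hgu ⟨hr.trans hτ.1, hτ.2.trans ht⟩]
  rw [h1]
  refine integral_mem_B (sub_pos.2 hrt)
    (((d.continuous_S_sub_right hg t).comp (continuous_id.add continuous_const)).intervalIntegrable
      _ _) fun τ hτ => ?_
  have hτ' : τ + r ∈ Icc 0 T := ⟨by linarith [hτ.1], by linarith [hτ.2]⟩
  rw [← hgu hτ']
  exact d.S_mem_B _ (d.F_mem_B (hM _ hτ'))

/-- If the semigroup is, for positive times, strongly continuous for the finer norm, then so are the
mild solutions. Restarting shortly before `t₀` makes the integral term small. -/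
theorem Mild.eventually_sub_mem_B
    (hS : ∀ M, ∀ x ∈ d.B M, ∀ t₀ > 0, ∀ ε > 0, ∀ᶠ t in 𝓝 t₀, d.S t x - d.S t₀ x ∈ d.B ε)
    {x : E} {T : ℝ} {u : ℝ → E} (hu : d.Mild x T u) {t₀ : ℝ} (ht₀ : t₀ ∈ Ioo 0 T) {ε : ℝ}
    (hε : 0 < ε) : ∀ᶠ t in 𝓝 t₀, u t - u t₀ ∈ d.B ε := by
  obtain ⟨M, hM⟩ := hu.exists_mem_B
  have hΦ := d.Φ_nonneg M
  set η := min (t₀ / 2) (ε / (6 * (d.Φ M + 1))) with hη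
  have hη0 : 0 < η := lt_min (by linarith [ht₀.1]) (by positivity)
  have hηt : η ≤ t₀ / 2 := min_le_left _ _
  have hηΦ : η * d.Φ M ≤ ε / 6 := by
    have h1 : η * (6 * (d.Φ M + 1)) ≤ ε := (le_div_iff₀ (by positivity)).1 (min_le_right _ _)
    linarith
  set r := t₀ - η with hr
  have hr0 : 0 ≤ r := by rw [hr]; linarith [ht₀.1]
  have hev := hS M (u r) (hM r ⟨hr0, by rw [hr]; linarith [ht₀.2]⟩) (t₀ - r)
    (by rw [hr]; linarith) (ε / 2) (by positivity)
  have hev' : ∀ᶠ t in 𝓝 t₀, d.S (t - r) (u r) - d.S (t₀ - r) (u r) ∈ d.B (ε / 2) :=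
    (Continuous.tendsto (by fun_prop : Continuous fun t : ℝ => t - r) t₀).eventually hev
  filter_upwards [hev', Ioo_mem_nhds (by linarith : t₀ - η < t₀) (by linarith : t₀ < t₀ + η),
    Iio_mem_nhds ht₀.2] with t h1 h2 h3
  have h4 := hu.integral_mem_B_restart hM hr0 h2.1 (le_of_lt h3)
  have h5 := hu.integral_mem_B_restart hM hr0 (by rw [hr]; linarith : r < t₀) ht₀.2.le
  rw [hu.eq_restart hr0 h2.1.le (le_of_lt h3),
    hu.eq_restart hr0 (by rw [hr]; linarith : r ≤ t₀) ht₀.2.le]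
  have h6 := d.add_mem_B h1 (d.add_mem_B h4 (d.neg_mem_B h5))
  have h7 : (t - r) * d.Φ M ≤ 2 * (η * d.Φ M) := by
    rw [← mul_assoc]
    refine mul_le_mul_of_nonneg_right ?_ hΦ
    rw [hr]; linarith [h2.2]
  have h8 : (t₀ - r) * d.Φ M = η * d.Φ M := by rw [hr]; ring
  refine d.mono_B ?_ (by convert h6 using 1; abel)
  linarith

/-- Local existence, on a time interval which depends only on the size of the initial value:
the Duhamel map is a contraction of the continuous functions with values in a `B (M + 1)`. -/
theorem exists_mild (d : SemilinearProblem E) (M : ℝ) :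
    ∃ δ : ℝ, 0 < δ ∧ ∀ x ∈ d.B M, ∃ u, d.Mild x δ u := by
  set R := M + 1 with hR
  set δ : ℝ := 1 / (2 * (d.Φ R + d.lip R + 1)) with hδ
  have hΦ := d.Φ_nonneg R
  have hL : (0 : ℝ) ≤ d.lip R := (d.lip R).2
  have hδ0 : 0 < δ := by positivity
  have hδΦ : δ * d.Φ R ≤ 1 := by
    rw [hδ, one_div_mul_eq_div, div_le_one (by positivity)]
    linarith
  have hδL : d.lip R * δ ≤ 1 / 2 := by
    rw [hδ, mul_one_div, div_le_div_iff₀ (by positivity) (by positivity)]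
    linarith
  refine ⟨δ, hδ0, fun x hx => ?_⟩
  let K : Set C(Icc 0 δ, E) := {u | ∀ t, u t ∈ d.B R}
  have hKc : IsClosed K := by
    have : K = ⋂ t, (fun u : C(Icc 0 δ, E) => u t) ⁻¹' d.B R := by
      ext u; simp [K]
    rw [this]
    exact isClosed_iInter fun t => (d.isClosed_B R).preimage (continuous_eval_const t)
  have hcomplete : CompleteSpace K := hKc.completeSpace_coe
  have hne : Nonempty K :=
    ⟨⟨ContinuousMap.const _ x, fun _ => d.mono_B (by rw [hR]; linarith) hx⟩⟩
  let ext : C(Icc 0 δ, E) → ℝ → E := fun u => IccExtend hδ0.le u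
  have hext_mem : ∀ u ∈ K, ∀ t, ext u t ∈ d.B R := fun u hu t => hu _
  have hFc : ∀ u ∈ K, Continuous fun t => d.F (ext u t) := fun u hu => by
    have h1 : Continuous (ext u) := u.continuous.Icc_extend'
    rw [← continuousOn_univ] at h1 ⊢
    exact (d.lipschitzOn_F R).continuousOn.comp h1 fun t _ => hext_mem u hu t
  let Ψ : K → K := fun u => ⟨⟨fun t => d.S t x + ∫ τ in (0 : ℝ)..t, d.S (t - τ) (d.F (ext u τ)),
      ((d.continuous_S x).add (d.continuous_duhamel (hFc u u.2))).comp continuous_subtype_val⟩, by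
    intro t
    simp only [ContinuousMap.coe_mk]
    rcases t.2.1.eq_or_lt with h0 | h0
    · rw [← h0, intervalIntegral.integral_same, add_zero]
      exact d.mono_B (by rw [hR]; linarith) (d.S_mem_B _ hx)
    · refine d.mono_B ?_ (d.add_mem_B (d.S_mem_B _ hx) (integral_mem_B h0
        ((d.continuous_S_sub_right (hFc u u.2) t).intervalIntegrable _ _)
        fun τ _ => d.S_mem_B _ (d.F_mem_B (hext_mem u u.2 τ))))
      have : (t : ℝ) * d.Φ R ≤ δ * d.Φ R := mul_le_mul_of_nonneg_right t.2.2 hΦ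
      rw [hR]
      linarith⟩
  have hcontr : ContractingWith (1 / 2) Ψ := by
    refine ⟨by rw [← NNReal.coe_lt_coe]; norm_num, LipschitzWith.of_dist_le_mul fun u v => ?_⟩
    rw [Subtype.dist_eq, Subtype.dist_eq]
    refine (ContinuousMap.dist_le (by positivity)).2 fun t => ?_
    have hbd : ∀ τ, ‖d.S (t - τ) (d.F (ext u τ)) - d.S (t - τ) (d.F (ext v τ))‖ ≤
        d.lip R * dist (u : C(Icc 0 δ, E)) v := fun τ => by
      rw [← map_sub]
      refine (d.norm_S_le _ _).trans ?_
      rw [← dist_eq_norm]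
      refine ((d.lipschitzOn_F R).dist_le_mul _ (hext_mem u u.2 τ) _ (hext_mem v v.2 τ)).trans ?_
      gcongr
      exact ContinuousMap.dist_apply_le_dist _
    simp only [Ψ, ContinuousMap.coe_mk]
    rw [dist_add_left, dist_eq_norm, ← intervalIntegral.integral_sub
      ((d.continuous_S_sub_right (hFc u u.2) t).intervalIntegrable _ _)
      ((d.continuous_S_sub_right (hFc v v.2) t).intervalIntegrable _ _)]
    refine (intervalIntegral.norm_integral_le_of_norm_le_const fun τ _ => hbd τ).trans ?_
    rw [sub_zero, abs_of_nonneg t.2.1]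
    calc d.lip R * dist (u : C(Icc 0 δ, E)) v * t ≤ d.lip R * dist (u : C(Icc 0 δ, E)) v * δ := by
          gcongr; exact t.2.2
      _ = (d.lip R * δ) * dist (u : C(Icc 0 δ, E)) v := by ring
      _ ≤ 1 / 2 * dist (u : C(Icc 0 δ, E)) v := by gcongr
      _ = _ := by norm_num
  set u := ContractingWith.fixedPoint Ψ hcontr with hu
  have hfix : Ψ u = u := hcontr.fixedPoint_isFixedPt
  have hcont : Continuous (ext u) := (u : C(Icc 0 δ, E)).continuous.Icc_extend'
  refine ⟨ext u, hcont.continuousOn, ⟨R, fun t _ => hext_mem u u.2 t⟩, fun t ht => ?_⟩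
  have h1 : (Ψ u : C(Icc 0 δ, E)) ⟨t, ht⟩ = (u : C(Icc 0 δ, E)) ⟨t, ht⟩ := by rw [hfix]
  rw [show ext u t = (u : C(Icc 0 δ, E)) ⟨t, ht⟩ from IccExtend_of_mem hδ0.le _ ht, ← h1]
  rfl

/-- Concatenation of mild solutions. -/
theorem Mild.concat {x : E} {T δ : ℝ} (hT : 0 ≤ T) (hδ : 0 ≤ δ) {u v : ℝ → E}
    (hu : d.Mild x T u) (hv : d.Mild (u T) δ v) :
    d.Mild x (T + δ) fun t => if t ≤ T then u t else v (t - T) := by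
  set w : ℝ → E := fun t => if t ≤ T then u t else v (t - T) with hw
  have hwu : EqOn w u (Icc 0 T) := fun t ht => if_pos ht.2
  have hwv : EqOn (fun t => w (T + t)) v (Icc 0 δ) := fun t ht => by
    simp only [hw]
    rcases ht.1.eq_or_lt with rfl | h
    · rw [if_pos (by simp), add_zero, hv.apply_zero hδ]
    · rw [if_neg (by linarith), add_sub_cancel_left]
  have hwv' : EqOn w (fun t => v (t - T)) (Icc T (T + δ)) := fun t ht => by
    have := hwv (x := t - T) ⟨by linarith [ht.1], by linarith [ht.2]⟩
    simpa using this
  have hunion : Icc 0 T ∪ Icc T (T + δ) = Icc 0 (T + δ) :=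
    Icc_union_Icc_eq_Icc hT (by linarith)
  have hwc : ContinuousOn w (Icc 0 (T + δ)) := by
    rw [← hunion]
    refine (hu.continuousOn.congr hwu).union_of_isClosed
      (ContinuousOn.congr ?_ hwv') isClosed_Icc isClosed_Icc
    exact hv.continuousOn.comp (by fun_prop)
      fun t ht => ⟨by linarith [ht.1], by linarith [ht.2]⟩
  obtain ⟨M₁, hM₁⟩ := hu.exists_mem_B
  obtain ⟨M₂, hM₂⟩ := hv.exists_mem_B
  have hwM : ∀ t ∈ Icc 0 (T + δ), w t ∈ d.B (max M₁ M₂) := by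
    rw [← hunion]
    rintro t (ht | ht)
    · rw [hwu ht]; exact d.mono_B (le_max_left _ _) (hM₁ t ht)
    · rw [hwv' ht]
      exact d.mono_B (le_max_right _ _) (hM₂ _ ⟨by linarith [ht.1], by linarith [ht.2]⟩)
  refine ⟨hwc, ⟨_, hwM⟩, fun t ht => ?_⟩
  obtain ⟨g, hg, hgw⟩ := exists_continuous_eqOn (add_nonneg hT hδ) (continuousOn_F_comp hwc hwM)
  have hint : ∀ r a b : ℝ, IntervalIntegrable (fun τ => d.S (r - τ) (g τ)) volume a b :=
    fun r a b => (d.continuous_S_sub_right hg r).intervalIntegrable _ _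
  rw [d.integral_congr_Icc hgw ht]
  have hgu : EqOn (fun t => d.F (u t)) g (Icc 0 T) := fun τ hτ => by
    rw [← hgw ⟨hτ.1, by linarith [hτ.2]⟩]
    simp only [hwu hτ]
  rcases le_or_gt t T with htT | htT
  · have htT' : t ∈ Icc 0 T := ⟨ht.1, htT⟩
    rw [hwu htT', hu.eq t htT', d.integral_congr_Icc hgu htT']
  · have ht' : t - T ∈ Icc 0 δ := ⟨by linarith, by linarith [ht.2]⟩
    have hgv : EqOn (fun t => d.F (v t)) (fun r => g (r + T)) (Icc 0 δ) := fun τ hτ => by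
      simp only
      rw [← hgw (x := τ + T) ⟨by linarith [hτ.1], by linarith [hτ.2]⟩, ← hwv hτ]
      simp only [add_comm T]
    rw [hwv' ⟨htT.le, ht.2⟩]
    simp only
    rw [hv.eq _ ht', d.integral_congr_Icc hgv ht', hu.eq T ⟨hT, le_rfl⟩,
      d.integral_congr_Icc hgu ⟨hT, le_rfl⟩, map_add, ← d.S_add _ _ ht'.1 hT, sub_add_cancel,
      add_assoc, ← intervalIntegral.integral_add_adjacent_intervals (hint t 0 T) (hint t T t)]
    congr 2
    · rw [← (d.S (t - T)).intervalIntegral_comp_comm (hint T 0 T)]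
      refine intervalIntegral.integral_congr fun τ hτ => ?_
      rw [uIcc_of_le hT] at hτ
      rw [← d.S_add _ _ ht'.1 (by linarith [hτ.2])]
      congr 2; ring
    · have := intervalIntegral.integral_comp_add_right (a := 0) (b := t - T)
        (fun τ => d.S (t - τ) (g τ)) T
      rw [zero_add, sub_add_cancel] at this
      rw [← this]
      congr 1; ext τ
      congr 2; ring

/-- Existence of the maximal solution, and blow-up of its size in the sense of the sets `B M`. -/
theorem exists_maximal (d : SemilinearProblem E) {x : E} {M₀ : ℝ} (hx : x ∈ d.B M₀) :
    ∃ (Tmax : EReal) (U : ℝ → E), 0 < Tmax ∧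
      (∀ T : ℝ, (T : EReal) < Tmax → d.Mild x T U) ∧
      (∀ (T : ℝ) (v : ℝ → E), 0 < T → d.Mild x T v →
        (T : EReal) < Tmax ∧ EqOn v U (Icc 0 T)) ∧
      (Tmax ≠ ⊤ → ∀ M, ∀ᶠ t in 𝓝[<] Tmax.toReal, U t ∉ d.B M) := by
  classical
  set 𝒯 : Set ℝ := {T | 0 < T ∧ ∃ u, d.Mild x T u} with h𝒯
  choose! sol hsol using fun T (hT : T ∈ 𝒯) => hT.2
  set Tmax : EReal := sSup ((↑) '' 𝒯) with hTmax
  have hle : ∀ T ∈ 𝒯, (T : EReal) ≤ Tmax := fun T hT => le_sSup (mem_image_of_mem _ hT)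
  have hlt_iff : ∀ t : ℝ, (t : EReal) < Tmax → ∃ T ∈ 𝒯, t < T := fun t ht => by
    obtain ⟨_, ⟨T, hT, rfl⟩, h⟩ := lt_sSup_iff.1 ht
    exact ⟨T, hT, EReal.coe_lt_coe_iff.1 h⟩
  -- a solution can always be continued
  have hcont : ∀ T, 0 < T → ∀ v, d.Mild x T v → ∀ M δ, 0 < δ →
      (∀ y ∈ d.B M, ∃ u, d.Mild y δ u) → v T ∈ d.B M → T + δ ∈ 𝒯 :=
    fun T hT v hv M δ hδ hδM hM => by
      obtain ⟨w, hw⟩ := hδM _ hM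
      exact ⟨by linarith, _, hv.concat hT.le hδ.le hw⟩
  have hlt : ∀ T ∈ 𝒯, (T : EReal) < Tmax := fun T hT => by
    obtain ⟨M, hM⟩ := (hsol T hT).exists_mem_B
    obtain ⟨δ, hδ, hδM⟩ := d.exists_mild M
    have h := hcont T hT.1 _ (hsol T hT) M δ hδ hδM (hM T ⟨hT.1.le, le_rfl⟩)
    exact lt_of_lt_of_le (EReal.coe_lt_coe_iff.2 (by linarith)) (hle _ h)
  set U : ℝ → E := fun t => if h : ∃ T ∈ 𝒯, t < T then sol h.choose t else 0 with hU
  have hUeq : ∀ (T : ℝ) (v : ℝ → E), 0 < T → d.Mild x T v → EqOn v U (Icc 0 T) := by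
    intro T v hT hv t ht
    have h : ∃ T' ∈ 𝒯, t < T' := hlt_iff t
      ((EReal.coe_le_coe_iff.2 ht.2).trans_lt (hlt T ⟨hT, v, hv⟩))
    rw [hU]
    simp only
    rw [dif_pos h]
    obtain ⟨h1, h2⟩ := h.choose_spec
    exact (hv.mono ht.2).eqOn ((hsol _ h1).mono h2.le) ⟨ht.1, le_rfl⟩
  have hUmild : ∀ T : ℝ, (T : EReal) < Tmax → d.Mild x T U := fun T hT => by
    obtain ⟨T', hT', h⟩ := hlt_iff T hT
    exact ((hsol T' hT').congr (hUeq T' _ hT'.1 (hsol T' hT')).symm).mono h.le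
  have hpos : 0 < Tmax := by
    obtain ⟨δ, hδ, hδM⟩ := d.exists_mild M₀
    have : δ ∈ 𝒯 := ⟨hδ, hδM x hx⟩
    exact lt_trans (EReal.coe_lt_coe_iff.2 hδ) (hlt δ this)
  refine ⟨Tmax, U, hpos, hUmild, fun T v hT hv => ⟨hlt T ⟨hT, v, hv⟩, hUeq T v hT hv⟩,
    fun htop M => ?_⟩
  have hreal : ((Tmax.toReal : ℝ) : EReal) = Tmax :=
    EReal.coe_toReal htop (ne_bot_of_gt hpos)
  have hpos' : 0 < Tmax.toReal := by
    rw [← EReal.coe_lt_coe_iff, hreal]; exact hpos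
  obtain ⟨δ, hδ, hδM⟩ := d.exists_mild M
  have hnhds : Ioo (max 0 (Tmax.toReal - δ)) Tmax.toReal ∈ 𝓝[<] Tmax.toReal :=
    Ioo_mem_nhdsLT (max_lt hpos' (by linarith))
  filter_upwards [hnhds] with t ht hUt
  have ht0 : 0 < t := (le_max_left _ _).trans_lt ht.1
  have htT : (t : EReal) < Tmax := by
    rw [← hreal, EReal.coe_lt_coe_iff]; exact ht.2
  have h := hlt _ (hcont t ht0 U (hUmild t htT) M δ hδ hδM hUt)
  rw [← hreal, EReal.coe_lt_coe_iff] at h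
  have := (le_max_right 0 (Tmax.toReal - δ)).trans_lt ht.1
  linarith

end SemilinearProblem

/-! ### The Hartree-type problem -/

section

variable {n : ℕ} {α β p q s : ℝ} [Fact (1 ≤ ENNReal.ofReal s)]

/-- The semilinear problem in `L^s`, with the bounded sets of `L^s ∩ L^∞`. -/
def Exponents.problem (H : Exponents n α p q s) (hβ : 0 < β ∧ β ≤ 2) :
    SemilinearProblem (Leb n s) where
  S := stableOp H.one_le_n hβ
  S_zero := stableOp_zero H.one_le_n hβ
  S_add _ _ ht hr := stableOp_add H.one_le_n hβ ht hr
  norm_S_le := norm_stableOp_le H.one_le_n hβ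
  continuous_S := continuous_stableOp H.one_le_n hβ
  B := supBall (Space n) (ENNReal.ofReal s)
  isClosed_B := isClosed_supBall
  convex_B := convex_supBall
  mono_B := supBall_mono _ _
  add_mem_B := add_mem_supBall
  smul_mem_B := smul_mem_supBall
  neg_mem_B := neg_mem_supBall
  S_mem_B t := stableOp_mem_supBall H.one_le_n hβ t
  F := nonlinearityLp α p q
  lip M := (Exponents.lipConst n α p q s M).toNNReal
  lipschitzOn_F M := by
    refine LipschitzOnWith.of_dist_le_mul fun f hf g hg => ?_
    rw [dist_eq_norm, dist_eq_norm,
      Real.coe_toNNReal _ (H.lipConst_nonneg ((norm_nonneg f).trans hf.1))]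
    exact H.norm_nonlinearityLp_sub_le hf hg
  Φ M := max 0 (max (Exponents.lipConst n α p q s M * M)
    (Exponents.rieszBound n α p s M * M ^ q))
  Φ_nonneg _ := le_max_left _ _
  F_mem_B hf := supBall_mono _ _ (le_max_right _ _) (H.nonlinearityLp_mem_supBall hf)

/-- A solution which is essentially bounded at almost every time is bounded at every time, by
continuity in `L^s`. -/
theorem IsMildSolution.exists_mem_supBall {u₀ : Leb n s} {T : ℝ} (hT : 0 < T) {u : ℝ → Leb n s}
    (hu : IsMildSolution α β p q u₀ T u) :
    ∃ M, ∀ t ∈ Icc 0 T, u t ∈ supBall (Space n) (ENNReal.ofReal s) M := by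
  obtain ⟨v, hv, hvu⟩ := hu.memLinfty
  obtain ⟨C, hC⟩ := isCompact_Icc.exists_bound_of_continuousOn hu.continuousOn
  set K := (eLpNorm v ⊤ (volume.restrict (Ioo 0 T))).toReal with hK
  have hvK : ∀ᵐ t ∂(volume.restrict (Ioo 0 T)), ‖v t‖ ≤ K := by
    have h := ae_le_eLpNormEssSup (f := v) (μ := volume.restrict (Ioo 0 T))
    filter_upwards [h] with t ht
    rw [← eLpNorm_exponent_top] at ht
    have h2 := ENNReal.toReal_mono hv.eLpNorm_ne_top ht
    rwa [toReal_enorm] at h2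
  set M := max C K with hM
  have hgood : ∀ᵐ t ∂(volume.restrict (Ioo 0 T)),
      u t ∈ supBall (Space n) (ENNReal.ofReal s) M := by
    filter_upwards [hvK, hvu, ae_restrict_mem measurableSet_Ioo] with t h1 h2 h3
    refine ⟨(hC t (Ioo_subset_Icc_self h3)).trans (le_max_left _ _), ?_⟩
    have h4 : ∀ᵐ x, ‖v t x‖ₑ ≤ eLpNorm (v t) ⊤ volume := by
      rw [eLpNorm_exponent_top]; exact ae_le_eLpNormEssSup
    filter_upwards [h2, h4] with x h5 h6
    rw [← h5]
    have h7 := ENNReal.toReal_mono (Lp.memLp (v t)).eLpNorm_ne_top h6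
    rw [toReal_enorm, ← Lp.norm_def, Real.norm_eq_abs] at h7
    exact h7.trans (h1.trans (le_max_right _ _))
  -- the good times are dense
  set G : Set ℝ := {t | t ∈ Ioo 0 T ∧ u t ∈ supBall (Space n) (ENNReal.ofReal s) M} with hG
  have hdense : Icc 0 T ⊆ closure G := by
    rw [← closure_Ioo hT.ne]
    refine closure_minimal (fun t ht => ?_) isClosed_closure
    rw [mem_closure_iff_nhds]
    intro W hW
    obtain ⟨ε, hε, hεW⟩ := Metric.mem_nhds_iff.1 (inter_mem hW (Ioo_mem_nhds ht.1 ht.2))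
    have hpos : volume (Metric.ball t ε) ≠ 0 := (Metric.measure_ball_pos volume t hε).ne'
    have h0 : volume {t | ¬ (t ∈ Ioo 0 T → u t ∈ supBall (Space n) (ENNReal.ofReal s) M)} = 0 :=
      (ae_restrict_iff' measurableSet_Ioo).1 hgood
    by_contra hne
    refine hpos (measure_mono_null (fun r hr => ?_) h0)
    simp only [mem_ofPred_eq]
    intro himp
    exact hne ⟨r, (hεW hr).1, (hεW hr).2, himp (hεW hr).2⟩
  refine ⟨M, fun t ht => ?_⟩
  have hGsub : G ⊆ Icc 0 T := fun r hr => Ioo_subset_Icc_self hr.1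
  have h1 : u t ∈ closure (u '' G) :=
    ((hu.continuousOn t ht).mono hGsub).mem_closure_image (hdense ht)
  refine closure_minimal ?_ (isClosed_supBall M) h1
  rintro _ ⟨r, hr, rfl⟩
  exact hr.2

theorem IsMildSolution.mild (H : Exponents n α p q s) (hβ : 0 < β ∧ β ≤ 2) {u₀ : Leb n s} {T : ℝ}
    (hT : 0 < T) {u : ℝ → Leb n s} (hu : IsMildSolution α β p q u₀ T u) :
    (H.problem hβ).Mild u₀ T u := by
  obtain ⟨M, hM⟩ := hu.exists_mem_supBall hT
  refine ⟨hu.continuousOn, ⟨M, hM⟩, fun t ht => ?_⟩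
  obtain ⟨w, g, hw, hg, -, heq⟩ := hu.duhamel t ht
  rw [heq]
  congr 1
  · exact Lp.ext (hw.trans (semigroup_ae_eq_stableOp H.one_le_n hβ ht.1 (ae_eq_refl _)))
  · rw [intervalIntegral.integral_of_le ht.1, intervalIntegral.integral_of_le ht.1,
      integral_Ioc_eq_integral_Ioo, integral_Ioc_eq_integral_Ioo]
    refine integral_congr_ae ?_
    filter_upwards [hg, ae_restrict_mem measurableSet_Ioo] with τ h1 h2
    refine Lp.ext (h1.trans ?_)
    exact semigroup_ae_eq_stableOp H.one_le_n hβ (by linarith [h2.2])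
      (H.coeFn_nonlinearityLp (hM τ ⟨h2.1.le, h2.2.le.trans ht.2⟩)).symm

omit [Fact (1 ≤ ENNReal.ofReal s)] in
theorem memLp_top_of_mem_supBall {M : ℝ} {f : Leb n s}
    (hf : f ∈ supBall (Space n) (ENNReal.ofReal s) M) : MemLp f ⊤ :=
  memLp_top_of_bound (Lp.aestronglyMeasurable f) M hf.2

open Classical in
/-- The class in `L^∞` of a function in `L^s` (with the junk value `0` for unbounded functions). -/
def toLinfty (f : Leb n s) : Lp ℝ ⊤ (volume : Measure (Space n)) :=
  if h : MemLp f ⊤ then h.toLp else 0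

theorem coeFn_toLinfty {M : ℝ} {f : Leb n s} (hf : f ∈ supBall (Space n) (ENNReal.ofReal s) M) :
    toLinfty f =ᵐ[volume] f := by
  rw [toLinfty, dif_pos (memLp_top_of_mem_supBall hf)]
  exact MemLp.coeFn_toLp _

theorem norm_le_of_ae_abs_le {f : Lp ℝ ⊤ (volume : Measure (Space n))} {C : ℝ} (hC : 0 ≤ C)
    (h : ∀ᵐ x, |f x| ≤ C) : ‖f‖ ≤ C := by
  rw [Lp.norm_def, eLpNorm_exponent_top]
  exact ENNReal.toReal_le_of_le_ofReal hC (eLpNormEssSup_le_of_ae_bound h)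

/-- Mild solutions in the abstract sense are mild solutions. The point is strong measurability with
values in the nonseparable space `L^∞`, which holds because the solution is continuous with values
in `L^∞` at positive times. -/
theorem SemilinearProblem.Mild.isMildSolution (H : Exponents n α p q s) (hβ : 0 < β ∧ β ≤ 2)
    {u₀ : Leb n s} {T : ℝ} (hT : 0 < T) {u : ℝ → Leb n s} (hu : (H.problem hβ).Mild u₀ T u) :
    IsMildSolution α β p q u₀ T u := by
  obtain ⟨M, hM⟩ := hu.exists_mem_B
  have hM' : ∀ t ∈ Icc 0 T, u t ∈ supBall (Space n) (ENNReal.ofReal s) M := hM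
  have hM0 : 0 ≤ M := (norm_nonneg _).trans (hM' 0 ⟨le_rfl, hT.le⟩).1
  refine ⟨hu.continuousOn, ⟨fun t => toLinfty (u t), ?_, ?_⟩, hu.apply_zero hT.le, fun t ht => ?_⟩
  · have hcont : ContinuousOn (fun t => toLinfty (u t)) (Ioo 0 T) := by
      intro t₀ ht₀
      refine ContinuousAt.continuousWithinAt (Metric.tendsto_nhds.2 fun ε hε => ?_)
      filter_upwards [hu.eventually_sub_mem_B (fun M x hx t₀ ht₀ ε hε =>
        eventually_stableOp_sub_mem_supBall H.one_le_n hβ hx ht₀ hε) ht₀ (half_pos hε),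
        Ioo_mem_nhds ht₀.1 ht₀.2] with t ht htT
      refine lt_of_le_of_lt ?_ (half_lt_self hε)
      rw [dist_eq_norm]
      refine norm_le_of_ae_abs_le (half_pos hε).le ?_
      have ht2 : ∀ᵐ x, |(u t - u t₀ : Leb n s) x| ≤ ε / 2 := ht.2
      filter_upwards [ht2, coeFn_toLinfty (hM' t (Ioo_subset_Icc_self htT)),
        coeFn_toLinfty (hM' t₀ (Ioo_subset_Icc_self ht₀)), Lp.coeFn_sub (u t) (u t₀),
        Lp.coeFn_sub (toLinfty (u t)) (toLinfty (u t₀))] with x h1 h2 h3 h4 h5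
      rw [h5, Pi.sub_apply, h2, h3]
      rwa [h4] at h1
    refine memLp_top_of_bound (hcont.aestronglyMeasurable measurableSet_Ioo) M ?_
    filter_upwards [ae_restrict_mem measurableSet_Ioo] with t ht
    refine norm_le_of_ae_abs_le hM0 ?_
    filter_upwards [coeFn_toLinfty (hM' t (Ioo_subset_Icc_self ht)),
      (hM' t (Ioo_subset_Icc_self ht)).2] with x h1 h2
    rwa [h1]
  · filter_upwards [ae_restrict_mem measurableSet_Ioo] with t ht
    exact coeFn_toLinfty (hM' t (Ioo_subset_Icc_self ht))
  · obtain ⟨g, hg, hgu⟩ := hu.exists_continuous hT.le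
    refine ⟨stableOp H.one_le_n hβ t u₀,
      fun τ => stableOp H.one_le_n hβ (t - τ) (nonlinearityLp α p q (u τ)),
      (semigroup_ae_eq_stableOp H.one_le_n hβ ht.1 (ae_eq_refl _)).symm, ?_, ?_, hu.eq t ht⟩
    · filter_upwards [ae_restrict_mem measurableSet_Ioo] with τ hτ
      exact (semigroup_ae_eq_stableOp H.one_le_n hβ (by linarith [hτ.2])
        (H.coeFn_nonlinearityLp (hM' τ ⟨hτ.1.le, hτ.2.le.trans ht.2⟩)).symm).symm
    · refine (((H.problem hβ).continuous_S_sub_right hg t).intervalIntegrable 0 t).congr ?_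
      intro τ hτ
      rw [uIoc_of_le ht.1] at hτ
      have h1 : nonlinearityLp α p q (u τ) = g τ := hgu ⟨hτ.1.le, hτ.2.trans ht.2⟩
      simp only [h1]
      rfl

/-- Nonnegative functions form an invariant cone, since the nonlinearity is nonnegative. -/
theorem SemilinearProblem.Mild.nonneg (H : Exponents n α p q s) (hβ : 0 < β ∧ β ≤ 2)
    {u₀ : Leb n s} (h₀ : 0 ≤ u₀) {T : ℝ} {u : ℝ → Leb n s} (hu : (H.problem hβ).Mild u₀ T u)
    {t : ℝ} (ht : t ∈ Icc 0 T) : 0 ≤ u t := by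
  have hK : Convex ℝ (Ici (0 : Leb n s)) := convex_Ici_zero
  refine SemilinearProblem.Mild.mem_cone (d := H.problem hβ) hK isClosed_Ici (fun f hf g hg => ?_)
    (fun c hc f hf => ?_) (fun t f hf => stableOp_nonneg H.one_le_n hβ t hf)
    H.nonlinearityLp_nonneg h₀ hu ht
  · exact add_nonneg (mem_Ici.1 hf) (mem_Ici.1 hg)
  · rw [mem_Ici, ← Lp.coeFn_nonneg] at hf ⊢
    filter_upwards [hf, Lp.coeFn_smul c f] with x h1 h2
    rw [h2]
    exact mul_nonneg hc h1

end

theorem exponents_of_lt {n : ℕ} {α p q s : ℝ} (hα : 0 < α ∧ α < n)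
    (hp : (n : ℝ) / (n - α) < p) (hq : 1 ≤ q) (hs₁ : (n : ℝ) / (n - α) < s)
    (hs₂ : s < n * (p - 1) / α) : Exponents n α p q s := by
  have hn : (0 : ℝ) < n := hα.1.trans hα.2
  have hnα : (0 : ℝ) < n - α := sub_pos.2 hα.2
  have h1 : 1 < (n : ℝ) / (n - α) := by
    rw [one_lt_div hnα]; linarith [hα.1]
  have hs : 0 < s := by linarith
  refine ⟨by exact_mod_cast hn, hα.1, hα.2, h1.trans hp, hq, hs, ?_, ?_⟩
  · rw [div_lt_iff₀ hnα] at hs₁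
    rw [div_add_div _ _ hn.ne' hs.ne', div_lt_one (by positivity)]
    linarith
  · rw [mul_div_assoc', mul_comm (p - 1)]
    exact hs₂.le

end Hartree

end

/-- Local existence, uniqueness, maximal continuation with blow-up alternative, and preservation of
nonnegativity. The `Fact` only provides the norm of `L^s`; it follows from `hs₁`. -/
theorem theorem1p3 (n : ℕ) (α β p q s : ℝ)
    (hα : 0 < α ∧ α < n) (hβ : 0 < β ∧ β ≤ 2)
    (hp : (n : ℝ) / (n - α) < p) (hq : 1 ≤ q)
    (hs₁ : (n : ℝ) / (n - α) < s) (hs₂ : s < n * (p - 1) / α)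
    [Fact (1 ≤ ENNReal.ofReal s)]
    (u₀ : Hartree.Leb n s)
    (hu₀ : MeasureTheory.MemLp (u₀ : Hartree.Space n → ℝ) ⊤ MeasureTheory.volume) :
    ∃ (T : ℝ) (u : ℝ → Hartree.Leb n s), 0 < T ∧
      Hartree.IsMildSolution α β p q u₀ T u ∧
      (∀ v : ℝ → Hartree.Leb n s, Hartree.IsMildSolution α β p q u₀ T v →
        Set.EqOn v u (Set.Icc 0 T)) ∧
      (∃ (Tmax : EReal) (U : ℝ → Hartree.Leb n s),
        Hartree.IsMaximalMildSolution α β p q u₀ Tmax U ∧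
        (Tmax ≠ ⊤ →
          Filter.Tendsto
            (fun t : ℝ =>
              MeasureTheory.eLpNorm (U t : Hartree.Space n → ℝ) ⊤ MeasureTheory.volume +
              MeasureTheory.eLpNorm (U t : Hartree.Space n → ℝ) (ENNReal.ofReal s)
                MeasureTheory.volume)
            (nhdsWithin Tmax.toReal (Set.Iio Tmax.toReal)) (nhds ⊤)) ∧
        (0 ≤ u₀ → ∀ t : ℝ, 0 ≤ t → (t : EReal) < Tmax → 0 ≤ U t)) ∧
      (0 ≤ u₀ → ∀ t ∈ Set.Icc 0 T, 0 ≤ u t) := by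
  open Hartree MeasureTheory in
  have H : Exponents n α p q s := exponents_of_lt hα hp hq hs₁ hs₂
  set M₀ : ℝ := max ‖u₀‖ (eLpNorm u₀ ⊤ volume).toReal with hM₀
  have hmem : u₀ ∈ (H.problem hβ).B M₀ := by
    refine ⟨le_max_left _ _, ?_⟩
    have h : ∀ᵐ x, ‖u₀ x‖ₑ ≤ eLpNorm u₀ ⊤ volume := by
      rw [eLpNorm_exponent_top]; exact ae_le_eLpNormEssSup
    filter_upwards [h] with x hx
    have h2 := ENNReal.toReal_mono hu₀.eLpNorm_ne_top hx
    rw [toReal_enorm] at h2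
    exact h2.trans (le_max_right _ _)
  obtain ⟨Tmax, U, hpos, hU, hmax, hblow⟩ := (H.problem hβ).exists_maximal hmem
  obtain ⟨T, hT0, hT⟩ := EReal.lt_iff_exists_real_btwn.1 hpos
  have hT0' : 0 < T := by exact_mod_cast hT0
  refine ⟨T, U, hT0', (hU T hT).isMildSolution H hβ hT0',
    fun v hv => (hmax T v hT0' (hv.mild H hβ hT0')).2, ⟨Tmax, U, ⟨hpos,
      fun T' hT' h => (hU T' h).isMildSolution H hβ hT',
      fun T' v hT' hv => hmax T' v hT' (hv.mild H hβ hT')⟩, fun htop => ?_,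
      fun h₀ t ht htT => (hU t htT).nonneg H hβ h₀ ⟨ht, le_rfl⟩⟩,
    fun h₀ t ht => (hU T hT).nonneg H hβ h₀ ht⟩
  refine ENNReal.tendsto_nhds_top fun k => ?_
  filter_upwards [hblow htop k] with t ht
  by_contra hle
  rw [not_lt] at hle
  refine ht ⟨?_, ?_⟩
  · rw [Lp.norm_def]
    exact ENNReal.toReal_le_of_le_ofReal (Nat.cast_nonneg k)
      ((le_add_self.trans hle).trans_eq (ENNReal.ofReal_natCast k).symm)
  · have h : ∀ᵐ x, ‖U t x‖ₑ ≤ eLpNorm (U t) ⊤ volume := by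
      rw [eLpNorm_exponent_top]; exact ae_le_eLpNormEssSup
    filter_upwards [h] with x hx
    have h2 := ENNReal.toReal_mono (ENNReal.natCast_ne_top k)
      ((hx.trans le_self_add).trans hle)
    rwa [toReal_enorm, ENNReal.toReal_natCast] at h2
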